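/- **Asymptotic first linear programming bound for entanglement-assisted (EA) quantum codes.** For $m\ge 0$ let $\overline{\mathcal G}_m$ be the set of the $4^m$ operators $M_1\otimes\cdots\otimes M_m$ on $(\mathbb C^2)^{\otimes m}$ with $M_j\in\{I,X,Y,Z\}$ (Pauli matrices), and let the weight $\mathrm{wt}$ of such an operator be the number of its non-identity factors. An $((n,M,d;c))$ EA quantum code is an $M$-dimensional subspace $\mathcal Q$, $M\ge 1$, of $(\mathbb C^2)^{\otimes n}\otimes(\mathbb C^2)^{\otimes c}$ (parties $A$ and $B$), with orthogonal projector $P$, such that (1) $\mathrm{Tr}_A|\psi\rangle\langle\psi|=2^{-c}\,\mathbb I^B$ for every unit vector $\psi\in\mathcal Q$; (2) for every $E\in\overline{\mathcal G}_n$ of weight at most $d-1$ there is a scalar $\lambda_E$ with $P(E\otimes\mathbb I^B)P=\lambda_E P$. The code is called nondegenerate if $$B_{i,0}=\frac1{M^2}\sum_{E\in\overline{\mathcal G}_n,\ \mathrm{wt}(E)=i}\bigl(\mathrm{Tr}\,(E\otimes\mathbb I^B)P\bigr)^2=0\qquad\text{for all } 0<i<d.$$ Put $R=\frac1n\log_2M$,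 $\delta=d/n$, $\rho=c/n$, $H_2(x)=-x\log_2x-(1-x)\log_2(1-x)$ (with $0\log_2 0=0$), and $\gamma(\delta)=\frac34-\frac\delta2-\frac12\sqrt{3\delta(1-\delta)}$. There is a function $\eta:\mathbb N\to\mathbb R$ with $\eta(n)\to0$ as $n\to\infty$ such that every $((n,M,d;c))$ EA quantum code with $n\ge1$ and $0\le\delta\le 0.3152$ satisfies $$R\le\rho-1+H_2(\gamma(\delta))+\gamma(\delta)\log_23+\eta(n),$$ and every nondegenerate $((n,M,d;c))$ EA quantum code with $n\ge1$ and $0\le\delta\le1$ satisfies the same inequality. -/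

import Mathlib

noncomputable section

namespace EAQuantum

open scoped Kronecker

/-- Labels of the four single-qubit Pauli matrices. -/
inductive Pauli
  | I
  | X
  | Y
  | Z
  deriving DecidableEq

instance : Fintype Pauli where
  elems := {.I, .X, .Y, .Z}
  complete := by intro x; cases x <;> decide

/-- The Pauli matrices, with `Y = i X Z`. -/
def Pauli.mat : Pauli → Matrix (Fin 2) (Fin 2) ℂ
  | .I => 1
  | .X => !![0, 1; 1, 0]
  | .Y => !![0, -Complex.I; Complex.I, 0]
  | .Z => !![1, 0; 0, -1]

/-- Computational basis labels of `m` qubits. -/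
abbrev Bits (m : ℕ) : Type := Fin m → Fin 2

/-- The tensor product `M₁ ⊗ ⋯ ⊗ Mₘ` of the Pauli matrices labelled by `σ`; as `σ` varies, these
are exactly the `4 ^ m` elements of the set of phase-free `m`-qubit Pauli operators. -/
def pauliOp {m : ℕ} (σ : Fin m → Pauli) : Matrix (Bits m) (Bits m) ℂ :=
  Matrix.of fun x y => ∏ j, (σ j).mat (x j) (y j)

/-- The number of non-identity tensor factors. -/
def wt {m : ℕ} (σ : Fin m → Pauli) : ℕ :=
  (Finset.univ.filter fun j => σ j ≠ Pauli.I).card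

/-- The state space of `n` qubits (held by Alice) together with `c` qubits (held by Bob). -/
abbrev StateSpace (n c : ℕ) : Type := EuclideanSpace ℂ (Bits n × Bits c)

/-- The rank-one operator `|ψ⟩⟨ψ|`. -/
def ketBra {n c : ℕ} (ψ : StateSpace n c) : Matrix (Bits n × Bits c) (Bits n × Bits c) ℂ :=
  Matrix.of fun x y => ψ x * star (ψ y)

/-- The partial trace over the qubits of Alice. -/
def partialTraceA {n c : ℕ} (T : Matrix (Bits n × Bits c) (Bits n × Bits c) ℂ) :
    Matrix (Bits c) (Bits c) ℂ :=
  Matrix.of fun b b' => ∑ a, T (a, b) (a, b')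

/-- The matrix of the orthogonal projector onto the subspace `Q`. -/
def projector {n c : ℕ} (Q : Submodule ℂ (StateSpace n c)) :
    Matrix (Bits n × Bits c) (Bits n × Bits c) ℂ :=
  Matrix.toEuclideanLin.symm (Q.starProjection : StateSpace n c →ₗ[ℂ] StateSpace n c)

/-- The error `E` is detectable by `Q`: `P E P = μ P` for some scalar `μ`. -/
def Detectable {n c : ℕ} (Q : Submodule ℂ (StateSpace n c))
    (E : Matrix (Bits n × Bits c) (Bits n × Bits c) ℂ) : Prop :=
  ∃ μ : ℂ, projector Q * E * projector Q = μ • projector Q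

/-- `Q` is an `((n, M, d; c))` entanglement-assisted quantum code. -/
structure IsEACode (n M d c : ℕ) (Q : Submodule ℂ (StateSpace n c)) : Prop where
  finrank_eq : Module.finrank ℂ Q = M
  reduced : ∀ ψ ∈ Q, ‖ψ‖ = 1 →
    partialTraceA (ketBra ψ) = ((1 : ℂ) / 2 ^ c) • (1 : Matrix (Bits c) (Bits c) ℂ)
  detects : ∀ σ : Fin n → Pauli, wt σ < d →
    Detectable Q (pauliOp σ ⊗ₖ (1 : Matrix (Bits c) (Bits c) ℂ))

/-- The split weight enumerator
`B i j = (1 / M ^ 2) ∑ (Tr ((E ⊗ F) P)) ^ 2`, over the Pauli operators `E` on the qubits of Alice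
of weight `i` and `F` on the qubits of Bob of weight `j`, where `M = dim Q`. The traces are real,
so that the squared modulus is the square. -/
def splitB {n c : ℕ} (Q : Submodule ℂ (StateSpace n c)) (i j : ℕ) : ℝ :=
  (1 / (Module.finrank ℂ Q : ℝ) ^ 2) *
    ∑ σ : Fin n → Pauli with wt σ = i, ∑ τ : Fin c → Pauli with wt τ = j,
      ‖((pauliOp σ ⊗ₖ pauliOp τ) * projector Q).trace‖ ^ 2

/-- `Q`, as a code of minimum distance `d`, is degenerate. -/
def IsDegenerate {n c : ℕ} (d : ℕ) (Q : Submodule ℂ (StateSpace n c)) : Prop :=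
  ∃ i : ℕ, 0 < i ∧ i < d ∧ 0 < splitB Q i 0

/-- The binary entropy function, in bits. -/
def H₂ (x : ℝ) : ℝ := -x * Real.logb 2 x - (1 - x) * Real.logb 2 (1 - x)

/-- `γ(δ) = 3/4 - δ/2 - (1/2) √(3 δ (1 - δ))`. -/
def lpGamma (δ : ℝ) : ℝ := 3 / 4 - δ / 2 - 1 / 2 * Real.sqrt (3 * δ * (1 - δ))

end EAQuantum

end

noncomputable section

namespace EAQuantum

open scoped Kronecker

/-! ### Pauli operators: commutation signs, characters and the Pauli basis. -/

section

/-! Put K = M 2^n / 2^c. Three functions on Alice's Pauli labels carry the code: b = `bCoeff`, D =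
`dCoeff` (the same with all of Bob's Paulis) and b* = `bDual`. Then 0 ≤ b ≤ D and b* ≥ 0.
Detectability gives b* = b on weights below d. Expanding the projector in the Pauli basis gives Σ_σ
χ(σ,υ) b*(σ) = K D(υ) (`sum_chi_mul_bDual`). So every φ ≥ 0 satisfies K Σ φ b ≤ K Σ φ D = Σ φ̂ b*.

The test function is φ = (Ah − (3n−4d)h) * h, with A the adjacency operator of the quaternary
Hamming graph and h ≥ 0 such that Ah ≥ (3n−4d+1)h. Its transform 4(d − wt σ) ĥ(σ)² is nonpositive
from weight d on. If ĥ² ≤ L (h * h) at the labels of weight below d where b ≠ 0, then K ≤ 4dL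
(`spectral_lp_bound`). For a nondegenerate code only σ = 0 matters. For a general code the condition
concerns every weight below d, and this is what limits δ.

For h one takes a parabolic bump on a window of bounded width in the radius, divided by the square
root of the sphere size. Near radius τn its eigenvalue is about n(2τ + 2√(3τ(1−τ))), which equals (3
− 4δ)n at τ = γ(δ); a radius slightly beyond γ(δ)n suffices (`bump_eigen`, `eigenvalue_gap`,
`exists_window`). By Cauchy–Schwarz the condition on L becomes K_w(i)² ≤ L · #{v : wt v = wt(v+σ) =
w} for i = wt σ, and L can be the sphere size up to a subexponential factor (`exists_kraw_sq_le`).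
The sphere size is the exponential of n(H(γ) + γ log 3), which is the bound.

For `exists_kraw_sq_le`, the ratios of K_w(i)/K_w(0) before the first zero obey a three-term
recurrence in i, and a saddle-point supersolution bounds them. The pair count is bounded below by an
explicit family with an entropy exponent. Monotonicity in w reduces the comparison to relative
degrees 0.19 and 1/2. Joint concavity of the pair exponent against an affine saddle bound reduces it
further to finitely many rational points, where it is an inequality between integers. The range δ ≤
0.3152 fits because γ(0.3152) still exceeds 0.19. -/

/-- Multiplication of Pauli matrices up to phase, written additively. -/
def Pauli.add : Pauli → Pauli → Pauli
  | .I, b => b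
  | a, .I => a
  | .X, .X => .I
  | .X, .Y => .Z
  | .X, .Z => .Y
  | .Y, .X => .Z
  | .Y, .Y => .I
  | .Y, .Z => .X
  | .Z, .X => .Y
  | .Z, .Y => .X
  | .Z, .Z => .I

instance : Zero Pauli := ⟨.I⟩

instance : Add Pauli := ⟨Pauli.add⟩

instance : Neg Pauli := ⟨id⟩

instance : AddCommGroup Pauli where
  add_assoc := by decide
  zero_add := by decide
  add_zero := by decide
  neg_add_cancel := by decide
  add_comm := by decide
  nsmul := nsmulRec
  zsmul := zsmulRec

theorem Pauli.I_eq_zero : Pauli.I = 0 := rfl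

theorem Pauli.add_self (a : Pauli) : a + a = 0 := by revert a; decide

theorem Pauli.sum_univ {β : Type*} [AddCommMonoid β] (f : Pauli → β) :
    ∑ a, f a = f .I + f .X + f .Y + f .Z := by
  have : (Finset.univ : Finset Pauli) = {.I, .X, .Y, .Z} := rfl
  rw [this, Finset.sum_insert (by decide), Finset.sum_insert (by decide),
    Finset.sum_insert (by decide), Finset.sum_singleton]
  simp only [add_assoc]

/-- The commutation sign of two Pauli matrices. -/
def Pauli.sign (a b : Pauli) : ℝ := if a = .I ∨ b = .I ∨ a = b then 1 else -1

theorem Pauli.sign_comm (a b : Pauli) : a.sign b = b.sign a := by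
  cases a <;> cases b <;> simp [Pauli.sign]

theorem Pauli.sign_add (a b c : Pauli) : a.sign (b + c) = a.sign b * a.sign c := by
  have key : ∀ a b c : Pauli, (a = .I ∨ b + c = .I ∨ a = b + c) ↔
      ((a = .I ∨ b = .I ∨ a = b) ↔ (a = .I ∨ c = .I ∨ a = c)) := by decide
  unfold Pauli.sign
  have := key a b c
  by_cases h1 : (a = .I ∨ b = .I ∨ a = b) <;> by_cases h2 : (a = .I ∨ c = .I ∨ a = c) <;>
    simp only [h1, h2] at this ⊢ <;> simp [this]

theorem Pauli.sum_sign (a : Pauli) : ∑ b, a.sign b = if a = 0 then 4 else 0 := by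
  rw [Pauli.sum_univ]
  cases a <;> simp [Pauli.sign, ← Pauli.I_eq_zero] <;> norm_num

theorem Pauli.sum_sign_ne (a : Pauli) :
    ∑ b with b ≠ 0, a.sign b = if a = 0 then 3 else -1 := by
  rw [Finset.sum_filter, Pauli.sum_univ]
  cases a <;> simp [Pauli.sign, ← Pauli.I_eq_zero] <;> norm_num

theorem Pauli.conj_mat (a b : Pauli) : a.mat * b.mat * a.mat = (a.sign b : ℂ) • b.mat := by
  cases a <;> cases b <;> ext i j <;> fin_cases i <;> fin_cases j <;>
    simp [Pauli.mat, Pauli.sign, Matrix.mul_apply, Fin.sum_univ_two]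

theorem Pauli.mat_isHermitian (a : Pauli) : a.mat.IsHermitian := by
  cases a <;> ext i j <;> fin_cases i <;> fin_cases j <;> simp [Pauli.mat]

theorem Pauli.sum_mat_mul_mat (x y z w : Fin 2) :
    ∑ a : Pauli, a.mat x y * a.mat z w = if x = w ∧ y = z then 2 else 0 := by
  rw [Pauli.sum_univ]
  fin_cases x <;> fin_cases y <;> fin_cases z <;> fin_cases w <;>
    simp [Pauli.mat] <;> norm_num

variable {m n c : ℕ}

/-- The commutation sign of two phase-free Pauli operators. -/
def chi (σ τ : Fin m → Pauli) : ℝ := ∏ j, (σ j).sign (τ j)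

theorem chi_comm (σ τ : Fin m → Pauli) : chi σ τ = chi τ σ :=
  Finset.prod_congr rfl fun _ _ => Pauli.sign_comm _ _

theorem chi_add_right (σ τ υ : Fin m → Pauli) : chi σ (τ + υ) = chi σ τ * chi σ υ := by
  simp only [chi, Pi.add_apply, Pauli.sign_add, Finset.prod_mul_distrib]

theorem chi_add_left (σ τ υ : Fin m → Pauli) : chi (σ + τ) υ = chi σ υ * chi τ υ := by
  simp only [chi_comm _ υ, chi_add_right]

theorem add_self_eq_zero (σ : Fin m → Pauli) : σ + σ = 0 := by
  ext j; exact Pauli.add_self _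

theorem chi_zero_left (σ : Fin m → Pauli) : chi 0 σ = 1 := by
  simp [chi, Pauli.sign, Pauli.I_eq_zero]

theorem sum_chi (σ : Fin m → Pauli) : ∑ τ, chi σ τ = if σ = 0 then 4 ^ m else 0 := by
  unfold chi
  rw [← Fintype.prod_sum fun j a => (σ j).sign a]
  simp only [Pauli.sum_sign]
  split_ifs with h
  · subst h; simp
  · obtain ⟨j, hj⟩ := Function.ne_iff.mp h
    exact Finset.prod_eq_zero (Finset.mem_univ j) (by simpa using hj)

theorem add_eq_zero_iff (σ τ : Fin m → Pauli) : σ + τ = 0 ↔ σ = τ := by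
  constructor
  · intro h
    have := add_self_eq_zero τ
    exact add_right_cancel (h.trans this.symm)
  · rintro rfl; exact add_self_eq_zero _

theorem sum_chi_mul_chi (σ τ : Fin m → Pauli) :
    ∑ υ, chi υ σ * chi υ τ = if σ = τ then 4 ^ m else 0 := by
  simp only [← chi_add_right, chi_comm _ (σ + τ), sum_chi, add_eq_zero_iff]

theorem pauliOp_isHermitian (σ : Fin m → Pauli) : (pauliOp σ).IsHermitian := by
  ext x y
  simp only [pauliOp, Matrix.conjTranspose_apply, Matrix.of_apply, star_prod]
  exact Finset.prod_congr rfl fun j _ => (σ j).mat_isHermitian.apply _ _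

theorem pauliOp_zero : pauliOp (0 : Fin m → Pauli) = 1 := by
  ext x y
  simp only [pauliOp, Pauli.mat, Matrix.of_apply, Matrix.one_apply]
  by_cases h : x = y
  · simp [h]
  · obtain ⟨j, hj⟩ := Function.ne_iff.mp h
    rw [if_neg h]
    exact Finset.prod_eq_zero (Finset.mem_univ j) (by simp [hj])

theorem pauliOp_conj (σ τ : Fin m → Pauli) :
    pauliOp σ * pauliOp τ * pauliOp σ = (chi σ τ : ℂ) • pauliOp τ := by
  ext x y
  have hmul : ∀ A B : Fin m → Matrix (Fin 2) (Fin 2) ℂ,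
      (Matrix.of fun x y : Bits m => ∏ j, A j (x j) (y j)) *
        (Matrix.of fun x y : Bits m => ∏ j, B j (x j) (y j)) =
      Matrix.of fun x y : Bits m => ∏ j, (A j * B j) (x j) (y j) := by
    intro A B
    ext x y
    simp only [Matrix.mul_apply, Matrix.of_apply, ← Finset.prod_mul_distrib]
    rw [← Fintype.prod_sum fun j a => A j (x j) a * B j a (y j)]
  unfold pauliOp
  rw [hmul, hmul]
  simp only [Pauli.conj_mat, Matrix.of_apply, Matrix.smul_apply, chi, smul_eq_mul,
    Finset.prod_mul_distrib, Complex.ofReal_prod]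

theorem sum_pauliOp_mul (x y z w : Bits m) :
    ∑ σ : Fin m → Pauli, pauliOp σ x y * pauliOp σ z w = if x = w ∧ y = z then 2 ^ m else 0 := by
  simp only [pauliOp, Matrix.of_apply, ← Finset.prod_mul_distrib]
  rw [← Fintype.prod_sum fun j (a : Pauli) => a.mat (x j) (y j) * a.mat (z j) (w j)]
  simp only [Pauli.sum_mat_mul_mat]
  split_ifs with h
  · obtain ⟨rfl, rfl⟩ := h; simp
  · by_cases hx : x = w
    · obtain ⟨j, hj⟩ := Function.ne_iff.mp fun hy => h ⟨hx, hy⟩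
      exact Finset.prod_eq_zero (Finset.mem_univ j) (by simp [hj])
    · obtain ⟨j, hj⟩ := Function.ne_iff.mp hx
      exact Finset.prod_eq_zero (Finset.mem_univ j) (by simp [hj])

/-- Expansion of an operator in the Pauli basis. -/
theorem pauli_expansion (T : Matrix (Bits n × Bits c) (Bits n × Bits c) ℂ) :
    ∑ σ : Fin n → Pauli, ∑ τ : Fin c → Pauli,
      ((pauliOp σ ⊗ₖ pauliOp τ) * T).trace • (pauliOp σ ⊗ₖ pauliOp τ) = (2 ^ (n + c) : ℂ) • T := by
  ext ⟨z, z'⟩ ⟨w, w'⟩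
  simp only [Matrix.sum_apply, Matrix.smul_apply, Matrix.trace, Matrix.diag, Matrix.mul_apply,
    smul_eq_mul, Finset.sum_mul, Matrix.kroneckerMap_apply, Fintype.sum_prod_type]
  have : ∀ (σ : Fin n → Pauli) (τ : Fin c → Pauli) (x : Bits n) (x' : Bits c) (y : Bits n)
      (y' : Bits c), pauliOp σ x y * pauliOp τ x' y' * T (y, y') (x, x') *
        (pauliOp σ z w * pauliOp τ z' w') =
      T (y, y') (x, x') * ((pauliOp σ x y * pauliOp σ z w) *
        (pauliOp τ x' y' * pauliOp τ z' w')) := by intros; ring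
  simp only [this]
  have h2 : ∑ σ : Fin n → Pauli, ∑ τ : Fin c → Pauli, ∑ x, ∑ x', ∑ y, ∑ y',
      T (y, y') (x, x') * ((pauliOp σ x y * pauliOp σ z w) *
        (pauliOp τ x' y' * pauliOp τ z' w')) =
      ∑ x, ∑ x', ∑ y, ∑ y', T (y, y') (x, x') *
        ((∑ σ : Fin n → Pauli, pauliOp σ x y * pauliOp σ z w) *
        (∑ τ : Fin c → Pauli, pauliOp τ x' y' * pauliOp τ z' w')) := by
    simp only [Finset.mul_sum, Finset.sum_mul]
    simp only [Finset.sum_comm (s := (Finset.univ : Finset (Fin c → Pauli)))]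
    simp only [Finset.sum_comm (s := (Finset.univ : Finset (Fin n → Pauli)))]
  rw [h2]
  simp only [sum_pauliOp_mul, ite_and, ite_mul, mul_ite, zero_mul, mul_zero,
    Finset.sum_ite_eq', Finset.mem_univ, if_true,
    Finset.sum_ite_irrel, Finset.sum_const_zero]
  rw [pow_add]; ring

end

/-! ### Enumerators of a code and the MacWilliams identity. -/

section

variable {n c : ℕ} (Q : Submodule ℂ (StateSpace n c))

theorem toEuclideanLin_projector :
    Matrix.toEuclideanLin (projector Q) =
      (Q.starProjection : StateSpace n c →ₗ[ℂ] StateSpace n c) := by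
  simp [projector]

theorem projector_isHermitian : (projector Q).IsHermitian := by
  rw [← Matrix.isSymmetric_toEuclideanLin_iff, toEuclideanLin_projector]
  exact Q.starProjection_isSymmetric

theorem projector_mul_self : projector Q * projector Q = projector Q := by
  apply Matrix.toEuclideanLin.injective
  rw [Matrix.toEuclideanLin_eq_toLin_orthonormal, Matrix.toLin_mul _
    (EuclideanSpace.basisFun (Bits n × Bits c) ℂ).toBasis,
    ← Matrix.toEuclideanLin_eq_toLin_orthonormal, toEuclideanLin_projector]
  ext1 v
  simpa using Submodule.starProjection_eq_self_iff.mpr (Q.starProjection_apply_mem v)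

theorem trace_projector : (projector Q).trace = Module.finrank ℂ Q := by
  have hp : LinearMap.IsProj Q (Q.starProjection : StateSpace n c →ₗ[ℂ] StateSpace n c) :=
    ⟨fun x => Q.starProjection_apply_mem x, fun x hx => by
      simpa using Submodule.starProjection_eq_self_iff.mpr hx⟩
  rw [← hp.trace, ← toEuclideanLin_projector, Matrix.toEuclideanLin_eq_toLin_orthonormal,
    Matrix.trace_toLin_eq]

/-- The expectation `Tr ((σ ⊗ τ) P)`. -/
def pauliTrace (σ : Fin n → Pauli) (τ : Fin c → Pauli) : ℂ :=
  ((pauliOp σ ⊗ₖ pauliOp τ) * projector Q).trace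

/-- `(1 / M ^ 2) |Tr ((σ ⊗ I) P)| ^ 2`. -/
def bCoeff (σ : Fin n → Pauli) : ℝ :=
  ‖pauliTrace Q σ 0‖ ^ 2 / (Module.finrank ℂ Q : ℝ) ^ 2

/-- `(1 / M ^ 2) ∑ |Tr ((σ ⊗ τ) P)| ^ 2`, summed over the Pauli operators `τ` of Bob. -/
def dCoeff (σ : Fin n → Pauli) : ℝ :=
  (∑ τ, ‖pauliTrace Q σ τ‖ ^ 2) / (Module.finrank ℂ Q : ℝ) ^ 2

/-- `(1 / M) Tr ((σ ⊗ I) P (σ ⊗ I) P)`. -/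
def bDual (σ : Fin n → Pauli) : ℝ :=
  ((pauliOp σ ⊗ₖ (1 : Matrix (Bits c) (Bits c) ℂ)) * projector Q *
    (pauliOp σ ⊗ₖ (1 : Matrix (Bits c) (Bits c) ℂ)) * projector Q).trace.re /
    Module.finrank ℂ Q

theorem bCoeff_nonneg (σ : Fin n → Pauli) : 0 ≤ bCoeff Q σ := by
  unfold bCoeff; positivity

theorem bCoeff_le_dCoeff (σ : Fin n → Pauli) : bCoeff Q σ ≤ dCoeff Q σ := by
  unfold bCoeff dCoeff
  gcongr
  exact Finset.single_le_sum (f := fun τ => ‖pauliTrace Q σ τ‖ ^ 2) (fun _ _ => by positivity)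
    (Finset.mem_univ 0)

theorem kronecker_isHermitian (σ : Fin n → Pauli) (τ : Fin c → Pauli) :
    (pauliOp σ ⊗ₖ pauliOp τ).IsHermitian := by
  unfold Matrix.IsHermitian
  rw [Matrix.conjTranspose_kronecker, pauliOp_isHermitian, pauliOp_isHermitian]

/-- Both factors are Hermitian, so the trace is real; the Pauli expansion produces the plain square.
-/
theorem pauliTrace_mul_self (σ : Fin n → Pauli) (τ : Fin c → Pauli) :
    pauliTrace Q σ τ * pauliTrace Q σ τ = ((‖pauliTrace Q σ τ‖ ^ 2 : ℝ) : ℂ) := by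
  have h : star (pauliTrace Q σ τ) = pauliTrace Q σ τ := by
    unfold pauliTrace
    rw [← Matrix.trace_conjTranspose, Matrix.conjTranspose_mul, projector_isHermitian,
      kronecker_isHermitian, Matrix.trace_mul_comm]
  calc pauliTrace Q σ τ * pauliTrace Q σ τ = pauliTrace Q σ τ * star (pauliTrace Q σ τ) := by
        rw [h]
    _ = _ := by rw [Complex.star_def, Complex.mul_conj, Complex.normSq_eq_norm_sq]

theorem bCoeff_zero (hM : 0 < Module.finrank ℂ Q) : bCoeff Q 0 = 1 := by
  have : (Module.finrank ℂ Q : ℝ) ≠ 0 := by positivity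
  simp [bCoeff, pauliTrace, pauliOp_zero, trace_projector, this]

/-- P = P² and cyclicity of the trace turn it into the squared Hilbert–Schmidt norm of PEP. This
shows that `bDual` is nonnegative and evaluates it when PEP is a multiple of P. -/
theorem bDual_eq_norm (σ : Fin n → Pauli) :
    ((pauliOp σ ⊗ₖ (1 : Matrix (Bits c) (Bits c) ℂ)) * projector Q *
      (pauliOp σ ⊗ₖ (1 : Matrix (Bits c) (Bits c) ℂ)) * projector Q).trace =
    (star (projector Q * (pauliOp σ ⊗ₖ (1 : Matrix (Bits c) (Bits c) ℂ)) * projector Q) *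
      (projector Q * (pauliOp σ ⊗ₖ (1 : Matrix (Bits c) (Bits c) ℂ)) * projector Q)).trace := by
  have hE : star (pauliOp σ ⊗ₖ (1 : Matrix (Bits c) (Bits c) ℂ)) =
      pauliOp σ ⊗ₖ (1 : Matrix (Bits c) (Bits c) ℂ) := by
    rw [← pauliOp_zero]; exact kronecker_isHermitian _ _
  have hP : star (projector Q) = projector Q := projector_isHermitian Q
  rw [star_mul, star_mul, hE, hP]
  generalize pauliOp σ ⊗ₖ (1 : Matrix (Bits c) (Bits c) ℂ) = E
  have hPP := projector_mul_self Q
  generalize projector Q = P at *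
  calc (E * P * E * P).trace = (E * P * E * (P * P)).trace := by rw [hPP]
    _ = (P * (E * P * E * P)).trace := by rw [← mul_assoc, Matrix.trace_mul_comm]
    _ = _ := by
      congr 1
      calc P * (E * P * E * P) = P * E * (P * P) * E * P := by rw [hPP]; noncomm_ring
        _ = _ := by noncomm_ring

theorem bDual_nonneg (σ : Fin n → Pauli) : 0 ≤ bDual Q σ := by
  unfold bDual
  rw [bDual_eq_norm]
  refine div_nonneg ?_ (Nat.cast_nonneg _)
  generalize projector Q * (pauliOp σ ⊗ₖ (1 : Matrix (Bits c) (Bits c) ℂ)) * projector Q = A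
  simp only [Matrix.trace, Matrix.diag, Matrix.mul_apply, Matrix.star_apply, Complex.re_sum]
  refine Finset.sum_nonneg fun i _ => Finset.sum_nonneg fun j _ => ?_
  rw [Complex.star_def, mul_comm, Complex.mul_conj]
  exact_mod_cast Complex.normSq_nonneg _

theorem bDual_eq_bCoeff (σ : Fin n → Pauli)
    (h : Detectable Q (pauliOp σ ⊗ₖ (1 : Matrix (Bits c) (Bits c) ℂ))) :
    bDual Q σ = bCoeff Q σ := by
  obtain ⟨μ, hμ⟩ := h
  have hP : star (projector Q) = projector Q := projector_isHermitian Q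
  have h1 : pauliTrace Q σ 0 = μ * Module.finrank ℂ Q := by
    have := congrArg Matrix.trace hμ
    rw [mul_assoc, Matrix.trace_mul_comm, mul_assoc, projector_mul_self, Matrix.trace_smul,
      trace_projector] at this
    rw [pauliTrace, pauliOp_zero, this, smul_eq_mul]
  unfold bDual bCoeff
  rw [bDual_eq_norm, hμ, h1, star_smul, hP, smul_mul_smul_comm, projector_mul_self,
    Matrix.trace_smul, trace_projector, smul_eq_mul, mul_comm (star μ), Complex.star_def,
    Complex.mul_conj, norm_mul, mul_pow, Complex.normSq_eq_norm_sq]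
  by_cases hM : (Module.finrank ℂ Q : ℝ) = 0
  · simp [hM]
  · have : ((‖μ‖ ^ 2 : ℝ) * (Module.finrank ℂ Q : ℂ)).re = ‖μ‖ ^ 2 * Module.finrank ℂ Q := by
      rw [← Complex.ofReal_natCast, ← Complex.ofReal_mul, Complex.ofReal_re]
    rw [this]
    simp only [Complex.norm_natCast]
    field_simp

/-- MacWilliams identity. -/
theorem bDual_eq_sum (σ : Fin n → Pauli) :
    bDual Q σ = (Module.finrank ℂ Q : ℝ) / 2 ^ (n + c) * ∑ υ, chi σ υ * dCoeff Q υ := by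
  have hconj : ∀ (υ : Fin n → Pauli) (τ : Fin c → Pauli),
      (pauliOp σ ⊗ₖ (1 : Matrix (Bits c) (Bits c) ℂ)) * (pauliOp υ ⊗ₖ pauliOp τ) *
        (pauliOp σ ⊗ₖ (1 : Matrix (Bits c) (Bits c) ℂ)) =
      (chi σ υ : ℂ) • (pauliOp υ ⊗ₖ pauliOp τ) := by
    intro υ τ
    rw [← Matrix.mul_kronecker_mul, ← Matrix.mul_kronecker_mul, pauliOp_conj, one_mul, mul_one,
      Matrix.smul_kronecker]
  have key : (2 ^ (n + c) : ℂ) * ((pauliOp σ ⊗ₖ (1 : Matrix (Bits c) (Bits c) ℂ)) * projector Q *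
      (pauliOp σ ⊗ₖ (1 : Matrix (Bits c) (Bits c) ℂ)) * projector Q).trace =
      ((∑ υ, chi σ υ * ∑ τ, ‖pauliTrace Q υ τ‖ ^ 2 : ℝ) : ℂ) := by
    rw [← smul_eq_mul, ← Matrix.trace_smul, ← Matrix.smul_mul, ← Matrix.smul_mul,
      ← Matrix.mul_smul, ← pauli_expansion]
    simp only [Matrix.mul_sum, Matrix.sum_mul, Matrix.mul_smul, Matrix.smul_mul, hconj,
      Matrix.trace_sum, Matrix.trace_smul, smul_eq_mul]
    push_cast
    simp only [Finset.mul_sum]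
    refine Finset.sum_congr rfl fun υ _ => Finset.sum_congr rfl fun τ _ => ?_
    have := pauliTrace_mul_self Q υ τ
    push_cast at this
    rw [← this]
    unfold pauliTrace
    ring
  have key2 : (2 ^ (n + c) : ℝ) * ((pauliOp σ ⊗ₖ (1 : Matrix (Bits c) (Bits c) ℂ)) * projector Q *
      (pauliOp σ ⊗ₖ (1 : Matrix (Bits c) (Bits c) ℂ)) * projector Q).trace.re =
      ∑ υ, chi σ υ * ∑ τ, ‖pauliTrace Q υ τ‖ ^ 2 := by
    have h := congrArg Complex.re key
    rw [Complex.ofReal_re] at h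
    rw [← h]
    have : (2 ^ (n + c) : ℂ) = ((2 ^ (n + c) : ℝ) : ℂ) := by push_cast; rfl
    rw [this, Complex.re_ofReal_mul]
  have : ∑ υ, chi σ υ * dCoeff Q υ =
      (∑ υ, chi σ υ * ∑ τ, ‖pauliTrace Q υ τ‖ ^ 2) / (Module.finrank ℂ Q : ℝ) ^ 2 := by
    simp only [dCoeff, Finset.sum_div, mul_div_assoc]
  rw [this, ← key2]
  unfold bDual
  by_cases hM : (Module.finrank ℂ Q : ℝ) = 0
  · simp [hM]
  · field_simp

/-- Inversion of `bDual_eq_sum` by orthogonality of the characters; this is the form that pairs with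
a test function. -/
theorem sum_chi_mul_bDual (υ : Fin n → Pauli) :
    ∑ σ, chi σ υ * bDual Q σ = (Module.finrank ℂ Q : ℝ) * 2 ^ n / 2 ^ c * dCoeff Q υ := by
  simp only [bDual_eq_sum, Finset.mul_sum]
  rw [Finset.sum_comm]
  have : ∀ τ, ∑ σ, chi σ υ * ((Module.finrank ℂ Q : ℝ) / 2 ^ (n + c) * (chi σ τ * dCoeff Q τ)) =
      (Module.finrank ℂ Q : ℝ) / 2 ^ (n + c) * dCoeff Q τ * ∑ σ, chi σ υ * chi σ τ := by
    intro τ; rw [Finset.mul_sum]; exact Finset.sum_congr rfl fun _ _ => by ring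
  simp only [this, sum_chi_mul_chi, mul_ite, mul_zero, Finset.sum_ite_eq, Finset.mem_univ, if_true]
  rw [pow_add, show (4 : ℝ) = 2 * 2 by norm_num, mul_pow]
  field_simp

theorem wt_eq_zero_iff {m : ℕ} (σ : Fin m → Pauli) : wt σ = 0 ↔ σ = 0 := by
  simp [wt, Finset.filter_eq_empty_iff, funext_iff, Pauli.I_eq_zero]

theorem splitB_zero_right (i : ℕ) : splitB Q i 0 = ∑ σ with wt σ = i, bCoeff Q σ := by
  unfold splitB bCoeff
  rw [Finset.mul_sum]
  refine Finset.sum_congr rfl fun σ _ => ?_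
  simp only [wt_eq_zero_iff, Finset.filter_eq', Finset.mem_univ, if_true, Finset.sum_singleton]
  rw [pauliTrace]; ring

theorem bCoeff_eq_zero_of_not_isDegenerate {d : ℕ} (h : ¬ IsDegenerate d Q) (σ : Fin n → Pauli)
    (h0 : 0 < wt σ) (hd : wt σ < d) : bCoeff Q σ = 0 := by
  have h1 : ¬ 0 < splitB Q (wt σ) 0 := fun h2 => h ⟨_, h0, hd, h2⟩
  rw [splitB_zero_right] at h1
  refine le_antisymm (le_trans ?_ (not_lt.mp h1)) (bCoeff_nonneg Q σ)
  exact Finset.single_le_sum (f := bCoeff Q) (fun _ _ => bCoeff_nonneg Q _) (by simp)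

end

/-! ### Fourier analysis on the quaternary Hamming graph and the spectral bound. -/

section

variable {n : ℕ}

/-- The sum of the values of `h` at the neighbours of `v` in the quaternary Hamming graph. -/
def adj (h : (Fin n → Pauli) → ℝ) (v : Fin n → Pauli) : ℝ :=
  ∑ j, ∑ a with a ≠ (0 : Pauli), h (v + Pi.single j a)

/-- The Fourier transform with respect to the commutation signs. -/
def fourier (h : (Fin n → Pauli) → ℝ) (σ : Fin n → Pauli) : ℝ := ∑ v, chi σ v * h v

/-- The convolution of `g` and `h`. -/
def conv (g h : (Fin n → Pauli) → ℝ) (u : Fin n → Pauli) : ℝ := ∑ v, g v * h (v + u)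

theorem chi_single (σ : Fin n → Pauli) (j : Fin n) (a : Pauli) :
    chi σ (Pi.single j a) = (σ j).sign a := by
  unfold chi
  rw [Finset.prod_eq_single j]
  · simp
  · intro i _ hi
    simp [Pi.single_eq_of_ne hi, Pauli.sign, Pauli.I_eq_zero]
  · simp

theorem fourier_translate (h : (Fin n → Pauli) → ℝ) (σ u : Fin n → Pauli) :
    ∑ v, chi σ v * h (v + u) = chi σ u * fourier h σ := by
  unfold fourier
  rw [Finset.mul_sum]
  refine Fintype.sum_equiv (Equiv.addRight u) _ _ fun v => ?_
  have : chi σ u * chi σ u = 1 := by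
    rw [← chi_add_right, add_self_eq_zero, chi_comm, chi_zero_left]
  simp only [Equiv.coe_addRight, chi_add_right]
  linear_combination (- chi σ v * h (v + u)) * this

/-- Every label is its own inverse, so correlation and convolution coincide and no conjugation
appears. -/
theorem fourier_conv (g h : (Fin n → Pauli) → ℝ) (σ : Fin n → Pauli) :
    fourier (conv g h) σ = fourier g σ * fourier h σ := by
  have : fourier (conv g h) σ = ∑ v, g v * ∑ u, chi σ u * h (u + v) := by
    simp only [fourier, conv, Finset.mul_sum]
    rw [Finset.sum_comm]
    refine Finset.sum_congr rfl fun v _ => Finset.sum_congr rfl fun u _ => ?_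
    rw [add_comm v u]; ring
  rw [this]
  simp only [fourier_translate]
  conv_rhs => rw [fourier, Finset.sum_mul]
  exact Finset.sum_congr rfl fun _ _ => by ring

theorem sum_ite_wt (σ : Fin n → Pauli) (x y : ℝ) :
    ∑ j, (if σ j = 0 then x else y) = (n - wt σ) * x + wt σ * y := by
  have h := Finset.card_filter_add_card_filter_not
    (s := (Finset.univ : Finset (Fin n))) (fun j => σ j ≠ Pauli.I)
  simp only [not_not, Finset.card_univ, Fintype.card_fin] at h
  rw [Finset.sum_ite, Finset.sum_const, Finset.sum_const, nsmul_eq_mul, nsmul_eq_mul]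
  have h2 : ((Finset.univ.filter fun j => σ j = 0).card : ℝ) = n - wt σ := by
    rw [eq_sub_iff_add_eq]
    unfold wt
    exact_mod_cast (add_comm _ _).trans h
  rw [h2]
  rfl

theorem wt_le (σ : Fin n → Pauli) : wt σ ≤ n := by
  exact (Finset.card_le_univ _).trans_eq (Fintype.card_fin n)

/-- Characters diagonalise the graph: the three neighbours in a coordinate contribute 3 where σ is
trivial and 1 − 1 − 1 = −1 elsewhere. -/
theorem fourier_adj (h : (Fin n → Pauli) → ℝ) (σ : Fin n → Pauli) :
    fourier (adj h) σ = (3 * n - 4 * wt σ) * fourier h σ := by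
  have : fourier (adj h) σ = ∑ j, ∑ a with a ≠ (0 : Pauli), (σ j).sign a * fourier h σ := by
    simp only [← chi_single, ← fourier_translate]
    simp only [fourier, adj, Finset.mul_sum]
    rw [Finset.sum_comm]
    exact Finset.sum_congr rfl fun j _ => Finset.sum_comm
  rw [this]
  simp only [← Finset.sum_mul, Pauli.sum_sign_ne, sum_ite_wt]
  ring

theorem sum_adj_chi (σ u : Fin n → Pauli) :
    adj (fun τ => chi τ u) σ = (3 * n - 4 * wt u) * chi σ u := by
  unfold adj
  simp only [chi_add_left, chi_comm (Pi.single _ _), chi_single, ← Finset.mul_sum,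
    Pauli.sum_sign_ne, sum_ite_wt]
  ring

theorem wt_add_single (σ : Fin n → Pauli) (j : Fin n) (a : Pauli) :
    wt (σ + Pi.single j a) + (if σ j = 0 then 0 else 1) =
      wt σ + (if σ j + a = 0 then 0 else 1) := by
  have key : ∀ τ : Fin n → Pauli,
      wt τ = (if τ j = 0 then 0 else 1) + ∑ i ∈ Finset.univ.erase j, if τ i = 0 then 0 else 1 := by
    intro τ
    rw [Finset.add_sum_erase _ (fun i => if τ i = 0 then 0 else 1) (Finset.mem_univ j), wt,
      Finset.card_filter]
    exact Finset.sum_congr rfl fun i _ => by simp [Pauli.I_eq_zero]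
  have e1 := key (σ + (Pi.single j a : Fin n → Pauli))
  rw [e1, key σ]
  have : ∑ i ∈ Finset.univ.erase j, (if (σ + Pi.single j a : Fin n → Pauli) i = 0 then 0 else 1) =
      ∑ i ∈ Finset.univ.erase j, if σ i = 0 then 0 else 1 := by
    refine Finset.sum_congr rfl fun i hi => ?_
    rw [Pi.add_apply, Pi.single_eq_of_ne (Finset.ne_of_mem_erase hi), add_zero]
  rw [this]
  simp only [Pi.add_apply, Pi.single_eq_same]
  ring

/-- From weight w, 3(n − w) neighbours go up, 2w stay on the sphere and w go down. At w = 0 the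
truncated index w − 1 has coefficient 0. -/
theorem adj_radial (g : ℕ → ℝ) (σ : Fin n → Pauli) :
    adj (fun v => g (wt v)) σ =
      3 * (n - wt σ) * g (wt σ + 1) + 2 * wt σ * g (wt σ) + wt σ * g (wt σ - 1) := by
  have key : ∀ j, ∑ a with a ≠ (0 : Pauli), g (wt (σ + Pi.single j a)) =
      if σ j = 0 then 3 * g (wt σ + 1) else g (wt σ - 1) + 2 * g (wt σ) := by
    intro j
    have h0 : ∀ a, σ j = 0 → a ≠ 0 → wt (σ + Pi.single j a) = wt σ + 1 := by
      intro a h ha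
      have := wt_add_single σ j a
      simpa [h, ha] using this
    have h1 : ∀ a, σ j ≠ 0 → σ j + a = 0 → wt (σ + Pi.single j a) = wt σ - 1 := by
      intro a h ha
      have := wt_add_single σ j a
      rw [if_neg h, if_pos ha] at this
      omega
    have h2 : ∀ a, σ j ≠ 0 → σ j + a ≠ 0 → wt (σ + Pi.single j a) = wt σ := by
      intro a h ha
      have := wt_add_single σ j a
      rw [if_neg h, if_neg ha] at this
      omega
    by_cases h : σ j = 0
    · rw [if_pos h, Finset.sum_congr rfl fun a ha => by
        rw [h0 a h (Finset.mem_filter.mp ha).2], Finset.sum_const]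
      have : (Finset.univ.filter fun a : Pauli => a ≠ 0).card = 3 := by decide
      rw [this]; simp
    · rw [if_neg h, Finset.sum_congr rfl fun a _ => show g (wt (σ + Pi.single j a)) =
          if σ j + a = 0 then g (wt σ - 1) else g (wt σ) by
        split_ifs with ha
        · rw [h1 a h ha]
        · rw [h2 a h ha]]
      generalize σ j = p at *
      rw [Finset.sum_filter, Pauli.sum_univ]
      generalize g (wt σ - 1) = x
      generalize g (wt σ) = y
      cases p
      · exact absurd rfl h
      all_goals
        simp only [show (Pauli.X + Pauli.X = 0) = True by decide,
          show (Pauli.X + Pauli.Y = 0) = False by decide,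
          show (Pauli.X + Pauli.Z = 0) = False by decide,
          show (Pauli.Y + Pauli.X = 0) = False by decide,
          show (Pauli.Y + Pauli.Y = 0) = True by decide,
          show (Pauli.Y + Pauli.Z = 0) = False by decide,
          show (Pauli.Z + Pauli.X = 0) = False by decide,
          show (Pauli.Z + Pauli.Y = 0) = False by decide,
          show (Pauli.Z + Pauli.Z = 0) = True by decide,
          show (Pauli.I ≠ 0) = False by decide,
          show (Pauli.X ≠ 0) = True by decide,
          show (Pauli.Y ≠ 0) = True by decide,
          show (Pauli.Z ≠ 0) = True by decide, if_true, if_false]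
        ring
  unfold adj
  simp only [key, sum_ite_wt]
  ring

/-- The linear programming bound for an enumerator dominated by the Fourier transform of its dual,
with the test function of the spectral method. -/
theorem spectral_lp_bound (b D bd : (Fin n → Pauli) → ℝ) (K : ℝ) (hK : 0 ≤ K) (d : ℕ) (hd : 0 < d)
    (hb : ∀ σ, 0 ≤ b σ) (hbD : ∀ σ, b σ ≤ D σ) (hbd : ∀ σ, 0 ≤ bd σ)
    (heq : ∀ σ, wt σ < d → bd σ = b σ) (hb0 : b 0 = 1)
    (hF : ∀ υ, ∑ σ, chi σ υ * bd σ = K * D υ)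
    (h : (Fin n → Pauli) → ℝ) (hh : ∀ v, 0 ≤ h v) (hne : ∃ v, h v ≠ 0)
    (hA : ∀ v, (3 * n - 4 * d + 1 : ℝ) * h v ≤ adj h v) (L : ℝ)
    (hL : ∀ σ, wt σ < d → b σ ≠ 0 → fourier h σ ^ 2 ≤ L * conv h h σ) :
    K ≤ 4 * d * L := by
  -- The shift 3n − 4d makes the transform change sign exactly at weight d. The extra 1 in `hA`
  -- makes φ dominate h * h.
  set φ : (Fin n → Pauli) → ℝ := conv (fun v => adj h v - (3 * n - 4 * d : ℝ) * h v) h with hφ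
  have hcc : ∀ u, 0 ≤ conv h h u := fun u =>
    Finset.sum_nonneg fun v _ => mul_nonneg (hh _) (hh _)
  have hφc : ∀ u, conv h h u ≤ φ u := by
    intro u
    refine Finset.sum_le_sum fun v _ => mul_le_mul_of_nonneg_right ?_ (hh _)
    linarith [hA v]
  have hφ0 : ∀ u, 0 ≤ φ u := fun u => (hcc u).trans (hφc u)
  have hc0 : 0 < conv h h 0 := by
    obtain ⟨v, hv⟩ := hne
    refine Finset.sum_pos' (fun v _ => mul_nonneg (hh _) (hh _)) ⟨v, Finset.mem_univ _, ?_⟩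
    rw [add_zero]
    exact mul_self_pos.mpr hv
  have hwt0 : wt (0 : Fin n → Pauli) = 0 := (wt_eq_zero_iff _).mpr rfl
  have hL0 : 0 ≤ L := by
    by_contra hneg
    have := hL 0 (by rw [hwt0]; exact hd) (by rw [hb0]; exact one_ne_zero)
    nlinarith [sq_nonneg (fourier h (0 : Fin n → Pauli))]
  have hfφ : ∀ σ, fourier φ σ = 4 * (d - wt σ) * fourier h σ ^ 2 := by
    intro σ
    rw [hφ, fourier_conv]
    have : fourier (fun v => adj h v - (3 * n - 4 * d : ℝ) * h v) σ =
        fourier (adj h) σ - (3 * n - 4 * d : ℝ) * fourier h σ := by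
      simp only [fourier, Finset.mul_sum, ← Finset.sum_sub_distrib]
      exact Finset.sum_congr rfl fun _ _ => by ring
    rw [this, fourier_adj]
    ring
  have hdual : ∑ σ, fourier φ σ * bd σ = K * ∑ υ, φ υ * D υ := by
    simp only [fourier, Finset.sum_mul, Finset.mul_sum]
    rw [Finset.sum_comm]
    refine Finset.sum_congr rfl fun υ _ => ?_
    have := hF υ
    calc ∑ σ, chi σ υ * φ υ * bd σ = φ υ * ∑ σ, chi σ υ * bd σ := by
          rw [Finset.mul_sum]; exact Finset.sum_congr rfl fun _ _ => by ring
      _ = _ := by rw [this]; ring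
  -- Below weight d, bd is b and `hL` applies wherever b ≠ 0. From weight d on the left side is
  -- nonpositive, whatever bd is.
  have hterm : ∀ σ, fourier φ σ * bd σ ≤ 4 * d * L * (φ σ * b σ) := by
    intro σ
    rw [hfφ]
    have hr : 0 ≤ 4 * d * L * (φ σ * b σ) := by
      have := hφ0 σ; have := hb σ; positivity
    rcases lt_or_ge (wt σ) d with hw | hw
    · rw [heq σ hw]
      by_cases hz : b σ = 0
      · simp [hz]
      · have h1 := hL σ hw hz
        have h2 : fourier h σ ^ 2 ≤ L * φ σ := h1.trans (mul_le_mul_of_nonneg_left (hφc σ) hL0)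
        have h3 : 4 * ((d : ℝ) - wt σ) * fourier h σ ^ 2 ≤ 4 * d * (L * φ σ) := by
          have hd1 : (0 : ℝ) ≤ wt σ := Nat.cast_nonneg _
          have hd2 : (0 : ℝ) ≤ d := Nat.cast_nonneg _
          nlinarith [sq_nonneg (fourier h σ)]
        calc _ ≤ 4 * d * (L * φ σ) * b σ := mul_le_mul_of_nonneg_right h3 (hb σ)
          _ = _ := by ring
    · refine le_trans ?_ hr
      have : (d : ℝ) ≤ wt σ := by exact_mod_cast hw
      have h1 : 4 * ((d : ℝ) - wt σ) * fourier h σ ^ 2 ≤ 0 :=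
        mul_nonpos_of_nonpos_of_nonneg (by linarith) (sq_nonneg _)
      exact mul_nonpos_of_nonpos_of_nonneg h1 (hbd σ)
  have hpos : 0 < ∑ σ, φ σ * b σ := by
    refine Finset.sum_pos' (fun v _ => mul_nonneg (hφ0 _) (hb _)) ⟨0, Finset.mem_univ _, ?_⟩
    rw [hb0, mul_one]
    exact hc0.trans_le (hφc 0)
  refine le_of_mul_le_mul_right ?_ hpos
  calc K * ∑ σ, φ σ * b σ ≤ K * ∑ σ, φ σ * D σ :=
        mul_le_mul_of_nonneg_left
          (Finset.sum_le_sum fun σ _ => mul_le_mul_of_nonneg_left (hbD σ) (hφ0 σ)) hK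
    _ = ∑ σ, fourier φ σ * bd σ := hdual.symm
    _ ≤ ∑ σ, 4 * d * L * (φ σ * b σ) := Finset.sum_le_sum fun σ _ => hterm σ
    _ = _ := by rw [Finset.mul_sum]

end

/-! ### Krawtchouk polynomials, pair counts and radial test functions. -/

section

section

open Polynomial

/-- The quaternary Krawtchouk polynomial `K_w(i)`, as a coefficient of its generating function. -/
def kraw (n w i : ℕ) : ℝ := ((1 + 3 * X) ^ (n - i) * (1 - X) ^ i : ℝ[X]).coeff w

theorem wt_eq_sum {m : ℕ} (σ : Fin m → Pauli) : wt σ = ∑ j, if σ j = 0 then 0 else 1 := by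
  rw [wt, Finset.card_filter]
  exact Finset.sum_congr rfl fun i _ => by simp [Pauli.I_eq_zero]

theorem prod_ite_wt {m : ℕ} {R : Type*} [CommMonoid R] (σ : Fin m → Pauli) (x y : R) :
    ∏ j, (if σ j = 0 then x else y) = x ^ (m - wt σ) * y ^ wt σ := by
  have h := Finset.card_filter_add_card_filter_not
    (s := (Finset.univ : Finset (Fin m))) (fun j => σ j ≠ Pauli.I)
  simp only [not_not, Finset.card_univ, Fintype.card_fin] at h
  rw [Finset.prod_ite, Finset.prod_const, Finset.prod_const]
  have h2 : (Finset.univ.filter fun j => σ j = 0).card = m - wt σ := by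
    refine Nat.eq_sub_of_add_eq ?_
    unfold wt
    exact (add_comm _ _).trans h
  rw [h2]
  rfl

/-- The weight generating function of the signs factors over coordinates: 1 + 3X where σ is trivial,
and 1 + X − 2X = 1 − X elsewhere. -/
theorem sum_chi_wt_eq_kraw {n : ℕ} (σ : Fin n → Pauli) (w : ℕ) :
    ∑ v with wt v = w, chi σ v = kraw n w (wt σ) := by
  have hgen : ∑ v : Fin n → Pauli, C (chi σ v) * X ^ wt v =
      ((1 + 3 * X) ^ (n - wt σ) * (1 - X) ^ wt σ : ℝ[X]) := by
    rw [← prod_ite_wt]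
    have h1 : ∀ j, (if σ j = 0 then (1 + 3 * X : ℝ[X]) else 1 - X) =
        ∑ a : Pauli, C ((σ j).sign a) * X ^ (if a = 0 then 0 else 1) := by
      intro j
      rw [Pauli.sum_univ]
      generalize σ j = p
      cases p <;> simp [Pauli.sign, ← Pauli.I_eq_zero] <;> ring
    simp only [h1]
    rw [Fintype.prod_sum]
    refine Finset.sum_congr rfl fun v _ => ?_
    rw [Finset.prod_mul_distrib, Finset.prod_pow_eq_pow_sum, ← wt_eq_sum, chi, map_prod]
  rw [kraw, ← hgen, finsetSum_coeff, Finset.sum_filter]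
  refine Finset.sum_congr rfl fun v _ => ?_
  rw [coeff_C_mul_X_pow]
  simp [eq_comm]

theorem kraw_zero_right (n w : ℕ) : kraw n w 0 = n.choose w * 3 ^ w := by
  unfold kraw
  have : (1 + 3 * X : ℝ[X]) = C 3 * X + 1 := by
    rw [add_comm]; rfl
  simp only [Nat.sub_zero, pow_zero, mul_one]
  rw [this, add_pow, finsetSum_coeff]
  have h : ∀ k ∈ Finset.range (n + 1), ((C 3 * X) ^ k * 1 ^ (n - k) * (n.choose k : ℝ[X])).coeff w =
      if w = k then (n.choose w * 3 ^ w : ℝ) else 0 := by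
    intro k _
    rw [one_pow, mul_one, mul_pow, ← C_pow, ← C_eq_natCast, mul_comm, ← mul_assoc, ← C_mul,
      coeff_C_mul_X_pow]
    split_ifs with hk
    · rw [hk]
    · rfl
  rw [Finset.sum_congr rfl h, Finset.sum_ite_eq]
  split_ifs with hw
  · rfl
  · rw [Nat.choose_eq_zero_of_lt (by simpa using hw)]; simp

theorem exists_wt_eq {n i : ℕ} (h : i ≤ n) : ∃ σ : Fin n → Pauli, wt σ = i := by
  refine ⟨fun j => if j.val < i then .X else .I, ?_⟩
  have : (Finset.univ.filter fun j : Fin n =>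
      (if j.val < i then Pauli.X else Pauli.I) ≠ Pauli.I) = Finset.univ.filter fun j => j.val < i := by
    ext j; simp
  rw [wt, this, Fin.card_filter_val_lt, min_eq_right h]

/-- The three-term recurrence of the Krawtchouk polynomials in their argument. -/
theorem kraw_recurrence {n i : ℕ} (w : ℕ) (hi : i ≤ n) :
    3 * (n - i) * kraw n w (i + 1) + 2 * i * kraw n w i + i * kraw n w (i - 1) =
      (3 * n - 4 * w) * kraw n w i := by
  obtain ⟨σ, rfl⟩ := exists_wt_eq hi
  rw [← adj_radial (kraw n w) σ]
  simp only [← sum_chi_wt_eq_kraw]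
  have : adj (fun v => ∑ u with wt u = w, chi v u) σ =
      ∑ u with wt u = w, adj (fun v => chi v u) σ := by
    unfold adj
    conv_rhs => rw [Finset.sum_comm]
    exact Finset.sum_congr rfl fun j _ => Finset.sum_comm
  rw [this, Finset.mul_sum]
  refine Finset.sum_congr rfl fun u hu => ?_
  rw [sum_adj_chi, (Finset.mem_filter.mp hu).2]

/-- The number of vectors of weight `w` at distance `w` from `σ`. -/
def pairCount {n : ℕ} (σ : Fin n → Pauli) (w : ℕ) : ℕ :=
  (Finset.univ.filter fun v : Fin n → Pauli => wt v = w ∧ wt (v + σ) = w).card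

/-- Over ℕ[X] nothing cancels, so a single term bounds a coefficient from below; `le_pairCount`
extracts its family this way. -/
theorem coeff_mul_coeff_le (p q : ℕ[X]) (a b : ℕ) : p.coeff a * q.coeff b ≤ (p * q).coeff (a + b) := by
  rw [coeff_mul]
  exact Finset.single_le_sum (f := fun x : ℕ × ℕ => p.coeff x.1 * q.coeff x.2)
    (fun _ _ => Nat.zero_le _) (Finset.HasAntidiagonal.mem_antidiagonal.mpr (rfl : (a, b).1 + (a, b).2 = a + b))

theorem choose_mul_coeff_le (p q : ℕ[X]) {j k : ℕ} (h : j ≤ k) (m : ℕ) :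
    k.choose j * (p ^ j * q ^ (k - j)).coeff m ≤ ((p + q) ^ k).coeff m := by
  rw [add_pow, finsetSum_coeff]
  refine le_trans (le_of_eq ?_) (Finset.single_le_sum
    (f := fun j => (p ^ j * q ^ (k - j) * (k.choose j : ℕ[X])).coeff m)
    (fun _ _ => Nat.zero_le _) (Finset.mem_range_succ_iff.mpr h))
  rw [mul_comm _ (k.choose j : ℕ[X]), ← C_eq_natCast, coeff_C_mul]
  rfl

theorem coeff_natMul_X_pow_pow (c e k : ℕ) : (((c : ℕ[X]) * X ^ e) ^ k).coeff (k * e) = c ^ k := by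
  rw [mul_pow, ← pow_mul, mul_comm e k, ← Nat.cast_pow, ← C_eq_natCast, coeff_C_mul, coeff_X_pow]
  simp

/-- The family counted: on the support of σ, choose 2a coordinates, with v zero on a of them and
equal to σ on the other a; on the rest of the support v is one of the two remaining values. Off the
support, v is nonzero in w + a − wt σ places. Then v and v + σ both have weight w. -/
theorem le_pairCount {n : ℕ} (σ : Fin n → Pauli) {w a : ℕ} (hw : w ≤ n) (ha : 2 * a ≤ wt σ)
    (hwa : wt σ ≤ w + a) :
    (wt σ).choose (2 * a) * ((2 * a).choose a) * 2 ^ (wt σ - 2 * a) *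
      ((n - wt σ).choose (w + a - wt σ) * 3 ^ (w + a - wt σ)) ≤ pairCount σ w := by
  -- Weights are at most n, so base n + 1 encodes the pair (wt v, wt (v + σ)) in a single exponent.
  set N := n + 1
  have hgen : ∑ v : Fin n → Pauli, (X : ℕ[X]) ^ (wt v + N * wt (v + σ)) =
      (((1 : ℕ) : ℕ[X]) * X ^ 0 + ((3 : ℕ) : ℕ[X]) * X ^ (1 + N)) ^ (n - wt σ) *
        ((((1 : ℕ) : ℕ[X]) * X ^ 1 + ((1 : ℕ) : ℕ[X]) * X ^ N) +
          ((2 : ℕ) : ℕ[X]) * X ^ (1 + N)) ^ wt σ := by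
    rw [← prod_ite_wt]
    have h1 : ∀ j, (if σ j = 0 then (((1 : ℕ) : ℕ[X]) * X ^ 0 + ((3 : ℕ) : ℕ[X]) * X ^ (1 + N))
        else ((((1 : ℕ) : ℕ[X]) * X ^ 1 + ((1 : ℕ) : ℕ[X]) * X ^ N) +
          ((2 : ℕ) : ℕ[X]) * X ^ (1 + N))) =
        ∑ a : Pauli, (X : ℕ[X]) ^ ((if a = 0 then 0 else 1) +
          N * (if a + σ j = 0 then 0 else 1)) := by
      intro j
      rw [Pauli.sum_univ]
      generalize σ j = p
      simp only [← Pauli.I_eq_zero]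
      cases p <;>
      simp only [show ∀ a : Pauli, Pauli.I + a = a from zero_add,
        show ∀ a : Pauli, a + Pauli.I = a from add_zero,
        show ∀ a : Pauli, a + a = Pauli.I from Pauli.add_self,
        show Pauli.X + Pauli.Y = Pauli.Z by rfl,
        show Pauli.X + Pauli.Z = Pauli.Y by rfl, show Pauli.Y + Pauli.X = Pauli.Z by rfl,
        show Pauli.Y + Pauli.Z = Pauli.X by rfl, show Pauli.Z + Pauli.X = Pauli.Y by rfl,
        show Pauli.Z + Pauli.Y = Pauli.X by rfl, reduceCtorEq, if_true, if_false] <;>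
      push_cast <;> ring
    simp only [h1]
    rw [Fintype.prod_sum]
    refine Finset.sum_congr rfl fun v _ => ?_
    rw [Finset.prod_pow_eq_pow_sum, Finset.sum_add_distrib, ← Finset.mul_sum, ← wt_eq_sum,
      wt_eq_sum (v + σ)]
    rfl
  have hcount : (∑ v : Fin n → Pauli, (X : ℕ[X]) ^ (wt v + N * wt (v + σ))).coeff (w * (1 + N)) ≤
      pairCount σ w := by
    rw [finsetSum_coeff]
    simp only [coeff_X_pow]
    rw [← Finset.card_filter, pairCount]
    refine Finset.card_le_card fun v hv => ?_
    rw [Finset.mem_filter] at hv ⊢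
    have h := hv.2
    have h1 : wt v = w := by
      have := congrArg (· % N) h
      simp only [mul_add, mul_one, mul_comm w N, Nat.add_mul_mod_self_left] at this
      rw [Nat.mod_eq_of_lt (Nat.lt_succ_of_le hw),
        Nat.mod_eq_of_lt (Nat.lt_succ_of_le (wt_le v))] at this
      exact this.symm
    refine ⟨Finset.mem_univ _, h1, ?_⟩
    rw [h1, mul_add, mul_one, mul_comm w N] at h
    exact (Nat.eq_of_mul_eq_mul_left (Nat.succ_pos n) (Nat.add_left_cancel h)).symm
  refine le_trans ?_ hcount
  rw [hgen]
  have hsplit : w * (1 + N) = (w + a - wt σ) * (1 + N) +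
      ((a * 1 + a * N) + (wt σ - 2 * a) * (1 + N)) := by
    have : w = (w + a - wt σ) + (a + (wt σ - 2 * a)) := by omega
    calc w * (1 + N) = ((w + a - wt σ) + (a + (wt σ - 2 * a))) * (1 + N) := by rw [← this]
      _ = _ := by ring
  rw [hsplit]
  refine le_trans ?_ (coeff_mul_coeff_le _ _ _ _)
  rw [mul_comm]
  refine Nat.mul_le_mul ?_ ?_
  · by_cases hle : w + a - wt σ ≤ n - wt σ
    · rw [add_comm (((1 : ℕ) : ℕ[X]) * X ^ 0)]
      refine le_trans ?_ (choose_mul_coeff_le _ _ hle _)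
      refine Nat.mul_le_mul_left _ ?_
      have := coeff_mul_coeff_le ((((3 : ℕ) : ℕ[X]) * X ^ (1 + N)) ^ (w + a - wt σ))
        ((((1 : ℕ) : ℕ[X]) * X ^ 0) ^ (n - wt σ - (w + a - wt σ))) ((w + a - wt σ) * (1 + N))
        ((n - wt σ - (w + a - wt σ)) * 0)
      rw [coeff_natMul_X_pow_pow, coeff_natMul_X_pow_pow] at this
      simpa using this
    · rw [Nat.choose_eq_zero_of_lt (not_le.mp hle)]; simp
  · refine le_trans ?_ (choose_mul_coeff_le _ _ ha _)
    rw [mul_assoc]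
    refine Nat.mul_le_mul_left _ ?_
    refine le_trans ?_ (coeff_mul_coeff_le _ _ _ _)
    rw [coeff_natMul_X_pow_pow]
    refine Nat.mul_le_mul_right _ ?_
    refine le_trans ?_ (choose_mul_coeff_le _ _ (by omega : a ≤ 2 * a) _)
    have := coeff_mul_coeff_le ((((1 : ℕ) : ℕ[X]) * X ^ 1) ^ a)
        ((((1 : ℕ) : ℕ[X]) * X ^ N) ^ (2 * a - a)) (a * 1) ((2 * a - a) * N)
    rw [coeff_natMul_X_pow_pow, coeff_natMul_X_pow_pow, show 2 * a - a = a by omega] at this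
    rw [show 2 * a - a = a by omega]
    calc _ = (2 * a).choose a * (1 ^ a * 1 ^ a) := by simp
      _ ≤ _ := Nat.mul_le_mul_left _ this

end

/-- The linear programming bound for radial test functions. -/
theorem radial_lp_bound {n : ℕ} (b D bd : (Fin n → Pauli) → ℝ) (K : ℝ) (hK : 0 ≤ K) (d : ℕ)
    (hd : 0 < d)
    (hb : ∀ σ, 0 ≤ b σ) (hbD : ∀ σ, b σ ≤ D σ) (hbd : ∀ σ, 0 ≤ bd σ)
    (heq : ∀ σ, wt σ < d → bd σ = b σ) (hb0 : b 0 = 1)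
    (hF : ∀ υ, ∑ σ, chi σ υ * bd σ = K * D υ)
    (g : ℕ → ℝ) (hg : ∀ w, 0 ≤ g w) (hne : ∃ w ≤ n, g w ≠ 0)
    (hA : ∀ w ≤ n, (3 * n - 4 * d + 1 : ℝ) * g w ≤
      3 * (n - w) * g (w + 1) + 2 * w * g w + w * g (w - 1)) (L : ℝ)
    (hL : ∀ σ, wt σ < d → b σ ≠ 0 → ∀ w ≤ n, g w ≠ 0 →
      kraw n w (wt σ) ^ 2 ≤ L * pairCount σ w) :
    K ≤ 4 * d * ((n + 1) * L) := by
  refine spectral_lp_bound b D bd K hK d hd hb hbD hbd heq hb0 hF (fun v => g (wt v))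
    (fun v => hg _) ?_ ?_ _ ?_
  · obtain ⟨w, hw, h⟩ := hne
    obtain ⟨σ, rfl⟩ := exists_wt_eq hw
    exact ⟨σ, h⟩
  · intro v
    rw [adj_radial]
    exact hA _ (wt_le v)
  · intro σ hσ hbσ
    have h1 : fourier (fun v => g (wt v)) σ = ∑ w ∈ Finset.range (n + 1), g w * kraw n w (wt σ) := by
      simp only [← sum_chi_wt_eq_kraw, Finset.mul_sum]
      unfold fourier
      rw [← Finset.sum_fiberwise_of_maps_to (s := Finset.univ) (t := Finset.range (n + 1)) (g := wt)
        (fun v _ => Finset.mem_range_succ_iff.mpr (wt_le v))]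
      refine Finset.sum_congr rfl fun w _ => Finset.sum_congr rfl fun v hv => ?_
      simp only [(Finset.mem_filter.mp hv).2, mul_comm]
    -- Only pairs with both ends on the same sphere are kept. Correspondingly, Cauchy–Schwarz over
    -- the n + 1 spheres splits the transform at a cost of n + 1.
    have h2 : ∑ w ∈ Finset.range (n + 1), g w ^ 2 * pairCount σ w ≤
        conv (fun v => g (wt v)) (fun v => g (wt v)) σ := by
      unfold conv
      rw [← Finset.sum_fiberwise_of_maps_to (s := Finset.univ) (t := Finset.range (n + 1)) (g := wt)
        (fun v _ => Finset.mem_range_succ_iff.mpr (wt_le v))]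
      refine Finset.sum_le_sum fun w _ => ?_
      have hsub : (Finset.univ.filter fun v : Fin n → Pauli => wt v = w ∧ wt (v + σ) = w) ⊆
          Finset.univ.filter fun v : Fin n → Pauli => wt v = w := fun v hv => by
        rw [Finset.mem_filter] at hv ⊢
        exact ⟨hv.1, hv.2.1⟩
      refine le_trans (le_of_eq ?_) (Finset.sum_le_sum_of_subset_of_nonneg hsub
        fun v _ _ => mul_nonneg (hg _) (hg _))
      rw [Finset.sum_congr rfl fun v hv => show g (wt v) * g (wt (v + σ)) = g w ^ 2 by
        rw [(Finset.mem_filter.mp hv).2.1, (Finset.mem_filter.mp hv).2.2, sq]]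
      rw [Finset.sum_const, nsmul_eq_mul, mul_comm, pairCount]
    have hL0 : 0 ≤ L := by
      obtain ⟨w, hw, h⟩ := hne
      by_contra hneg
      have h0 : wt (0 : Fin n → Pauli) = 0 := (wt_eq_zero_iff _).mpr rfl
      have h3 := hL 0 (by rw [h0]; exact hd) (by rw [hb0]; exact one_ne_zero) w hw h
      rw [h0, kraw_zero_right] at h3
      have h4 : (0 : ℝ) < (n.choose w * 3 ^ w) ^ 2 := by
        have := Nat.choose_pos hw
        positivity
      have h5 : (0 : ℝ) ≤ pairCount (0 : Fin n → Pauli) w := Nat.cast_nonneg _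
      nlinarith
    rw [h1]
    calc (∑ w ∈ Finset.range (n + 1), g w * kraw n w (wt σ)) ^ 2
        ≤ (Finset.range (n + 1)).card * ∑ w ∈ Finset.range (n + 1), (g w * kraw n w (wt σ)) ^ 2 :=
          sq_sum_le_card_mul_sum_sq
      _ ≤ (n + 1) * ∑ w ∈ Finset.range (n + 1), L * (g w ^ 2 * pairCount σ w) := by
          rw [Finset.card_range]
          push_cast
          refine mul_le_mul_of_nonneg_left (Finset.sum_le_sum fun w hw => ?_) (by positivity)
          by_cases hz : g w = 0
          · simp [hz]
          · rw [mul_pow]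
            calc g w ^ 2 * kraw n w (wt σ) ^ 2 ≤ g w ^ 2 * (L * pairCount σ w) :=
                mul_le_mul_of_nonneg_left
                  (hL σ hσ hbσ w (Finset.mem_range_succ_iff.mp hw) hz) (sq_nonneg _)
              _ = _ := by ring
      _ ≤ (n + 1) * (L * conv (fun v => g (wt v)) (fun v => g (wt v)) σ) := by
          rw [← Finset.mul_sum]
          exact mul_le_mul_of_nonneg_left (mul_le_mul_of_nonneg_left h2 hL0) (by positivity)
      _ = _ := by ring

end

/-! ### The parabolic test function and its eigenvalue inequality. -/

section

/-- The number of vectors of weight `w`. -/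
def shell (n w : ℕ) : ℝ := n.choose w * 3 ^ w

theorem shell_pos {n w : ℕ} (h : w ≤ n) : 0 < shell n w := by
  have := Nat.choose_pos h
  unfold shell; positivity

theorem shell_succ {n w : ℕ} (h : w ≤ n) : shell n (w + 1) * (w + 1) = 3 * (n - w) * shell n w := by
  have := Nat.choose_succ_right_eq n w
  have h2 : (n.choose (w + 1) : ℝ) * (w + 1) = n.choose w * (n - w) := by
    rw [← Nat.cast_sub h]; exact_mod_cast this
  unfold shell
  rw [pow_succ]
  linear_combination (3 * 3 ^ w) * h2

/-- With x, y neighbouring sphere sizes and t, u the edge multiplicities between the spheres, this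
is the symmetrisation of the radial adjacency operator by the square root of the sphere size. -/
theorem div_sqrt_eq {x y t u : ℝ} (hx : 0 < x) (hy : 0 < y) (ht : 0 ≤ t)
    (h : y * u = t * x) : t / √y = √(t * u) / √x := by
  have hu : 0 ≤ u := by
    by_contra hn
    have : y * u < 0 := mul_neg_of_pos_of_neg hy (not_le.mp hn)
    have := mul_nonneg ht hx.le
    linarith
  rw [← Real.sqrt_div (by positivity), ← Real.sqrt_sq (div_nonneg ht (Real.sqrt_nonneg y)), div_pow,
    Real.sq_sqrt hy.le]
  congr 1
  field_simp
  linear_combination (-t) * h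

/-- A parabola supported on the window `(r - s, r]`. -/
def bump (r s w : ℕ) : ℝ := if r - s < w ∧ w ≤ r then ((w : ℝ) - (r - s)) * (r + 1 - w) else 0

theorem bump_nonneg {r s : ℕ} (hsr : s ≤ r) (w : ℕ) : 0 ≤ bump r s w := by
  unfold bump
  split_ifs with h
  · have h1 : (r : ℝ) - s < w := by rw [← Nat.cast_sub hsr]; exact_mod_cast h.1
    have h2 : (w : ℝ) ≤ r := by exact_mod_cast h.2
    exact mul_nonneg (by linarith) (by linarith)
  · exact le_rfl

/-- The parabola vanishes at r − s and r + 1, so its formula holds one step beyond the window on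
each side, where the recurrence needs it. -/
theorem bump_eq {r s w : ℕ} (hsr : s ≤ r) (h1 : r - s ≤ w) (h2 : w ≤ r + 1) :
    bump r s w = ((w : ℝ) - (r - s)) * (r + 1 - w) := by
  unfold bump
  split_ifs with h
  · rfl
  · rcases h1.eq_or_lt with h3 | h3
    · rw [← h3, Nat.cast_sub hsr]; ring
    · have : w = r + 1 := by
        by_contra hne
        exact h ⟨h3, by omega⟩
      rw [this]; push_cast; ring

/-- The eigenvalue inequality for the parabolic test function. -/
theorem bump_eigen {n r s : ℕ} (hs : 1 ≤ s) (hsr : s ≤ r) (hrn : r ≤ n) {lam : ℝ}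
    (hlam : lam ≤ 2 * ((r : ℝ) - s) + 2 * (1 - 1 / s) * √(3 * ((r : ℝ) - s) * (n - r)))
    (w : ℕ) (hw : w ≤ n) :
    lam * (bump r s w / √(shell n w)) ≤
      3 * (n - w) * (bump r s (w + 1) / √(shell n (w + 1))) + 2 * w * (bump r s w / √(shell n w)) +
        w * (bump r s (w - 1) / √(shell n (w - 1))) := by
  have hb := bump_nonneg hsr
  have hwn : (w : ℝ) ≤ n := by exact_mod_cast hw
  by_cases hwin : r - s < w ∧ w ≤ r
  swap
  · have : bump r s w = 0 := by unfold bump; rw [if_neg hwin]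
    rw [this, zero_div, mul_zero, mul_zero, add_zero]
    have h1 := hb (w + 1)
    have h2 := hb (w - 1)
    have : (0 : ℝ) ≤ n - w := by linarith
    positivity
  obtain ⟨hw1, hw2⟩ := hwin
  have hp : (r : ℝ) - s + 1 ≤ w := by
    rw [← Nat.cast_sub hsr]; exact_mod_cast hw1
  have hr : (w : ℝ) ≤ r := by exact_mod_cast hw2
  have hrn' : (r : ℝ) ≤ n := by exact_mod_cast hrn
  have hsr' : (0 : ℝ) ≤ r - s := by rw [← Nat.cast_sub hsr]; positivity
  have hs' : (1 : ℝ) ≤ s := by exact_mod_cast hs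
  have hv := shell_pos hw
  have hw0 : 0 < w := by omega
  have hup : 3 * ((n : ℝ) - w) * (bump r s (w + 1) / √(shell n (w + 1))) =
      √(3 * (n - w) * (w + 1)) * bump r s (w + 1) / √(shell n w) := by
    rcases hw.eq_or_lt with h | h
    · rw [h]; simp
    · have := div_sqrt_eq hv (shell_pos h) (by linarith : (0 : ℝ) ≤ 3 * (n - w)) (shell_succ hw)
      rw [mul_div_assoc', mul_comm, mul_div_assoc, this]; ring
  have hdown : (w : ℝ) * (bump r s (w - 1) / √(shell n (w - 1))) =
      √(w * (3 * (n - w + 1))) * bump r s (w - 1) / √(shell n w) := by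
    obtain ⟨u, rfl⟩ := Nat.exists_eq_succ_of_ne_zero hw0.ne'
    have hu : u ≤ n := by omega
    have h3 := shell_succ hu
    push_cast at hwn h3 ⊢
    have := div_sqrt_eq hv (shell_pos hu) (by positivity : (0 : ℝ) ≤ (u : ℝ) + 1)
      (u := 3 * (n - u)) (by linear_combination -h3)
    simp only [Nat.succ_eq_add_one] at this ⊢
    rw [mul_div_assoc', mul_comm, mul_div_assoc, this,
      show (3 * ((n : ℝ) - (u + 1) + 1)) = 3 * (n - u) by ring]; ring
  rw [hup, hdown, mul_div_assoc', mul_div_assoc', ← add_div, ← add_div]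
  refine div_le_div_of_nonneg_right ?_ (Real.sqrt_nonneg _)
  -- A common lower bound for the two off-diagonal entries throughout the window.
  set c := √(3 * ((r : ℝ) - s) * (n - r)) with hc
  have hc0 : 0 ≤ c := Real.sqrt_nonneg _
  have h1 : c ≤ √(3 * (n - w) * (w + 1)) := by
    apply Real.sqrt_le_sqrt
    nlinarith
  have h2 : c ≤ √(w * (3 * (n - w + 1))) := by
    apply Real.sqrt_le_sqrt
    nlinarith
  have e0 := bump_eq (w := w) hsr hw1.le (by omega)
  have e1 := bump_eq (w := w + 1) hsr (by omega) (by omega)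
  have e2 := bump_eq (w := w - 1) hsr (by omega) (by omega)
  have hcast : ((w - 1 : ℕ) : ℝ) = w - 1 := by rw [Nat.cast_sub hw0]; simp
  rw [hcast] at e2
  push_cast at e1
  -- The second difference of the parabola is −2, and inside the window its value is at least s.
  -- Hence the relative loss is at most 1/s.
  have hsum : bump r s (w + 1) + bump r s (w - 1) = 2 * bump r s w - 2 := by
    rw [e0, e1, e2]; ring
  have hge : (s : ℝ) ≤ bump r s w := by
    rw [e0]; nlinarith
  have hinv : (1 / s : ℝ) * bump r s w ≥ 1 := by
    rw [ge_iff_le, one_div, inv_mul_eq_div, one_le_div (by linarith)]; exact hge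
  calc lam * bump r s w ≤ (2 * ((r : ℝ) - s) + 2 * (1 - 1 / s) * c) * bump r s w :=
        mul_le_mul_of_nonneg_right hlam (hb w)
    _ = 2 * ((r : ℝ) - s) * bump r s w + c * (2 * bump r s w - 2 * (1 / s * bump r s w)) := by ring
    _ ≤ 2 * w * bump r s w + c * (2 * bump r s w - 2) := by
        have := mul_le_mul_of_nonneg_right (by linarith : 2 * ((r : ℝ) - s) ≤ 2 * w) (hb w)
        have := mul_le_mul_of_nonneg_left
          (by linarith : 2 * bump r s w - 2 * (1 / s * bump r s w) ≤ 2 * bump r s w - 2) hc0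
        linarith
    _ = 2 * w * bump r s w + (c * bump r s (w + 1) + c * bump r s (w - 1)) := by
        rw [← hsum]; ring
    _ ≤ _ := by
        have := mul_le_mul_of_nonneg_right h1 (hb (w + 1))
        have := mul_le_mul_of_nonneg_right h2 (hb (w - 1))
        linarith

/-- The first linear programming bound for entanglement-assisted codes, before the passage to
the limit. -/
theorem code_lp_bound {n M d c : ℕ} {Q : Submodule ℂ (StateSpace n c)} (hQ : IsEACode n M d c Q)
    (hM : 0 < M) (hd : 0 < d) {r s : ℕ} (hs : 1 ≤ s) (hsr : s ≤ r) (hrn : r ≤ n)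
    (hlam : (3 * n - 4 * d + 1 : ℝ) ≤
      2 * ((r : ℝ) - s) + 2 * (1 - 1 / s) * √(3 * ((r : ℝ) - s) * (n - r))) (L : ℝ)
    (hL : ∀ σ : Fin n → Pauli, wt σ < d → bCoeff Q σ ≠ 0 → ∀ w, r - s < w → w ≤ r →
      kraw n w (wt σ) ^ 2 ≤ L * pairCount σ w) :
    (M : ℝ) * 2 ^ n / 2 ^ c ≤ 4 * d * ((n + 1) * L) := by
  have hfin : (Module.finrank ℂ Q : ℝ) = M := by rw [hQ.finrank_eq]
  have hwin : ∀ w, bump r s w / √(shell n w) ≠ 0 → r - s < w ∧ w ≤ r := by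
    intro w h
    by_contra hn
    exact h (by unfold bump; rw [if_neg hn, zero_div])
  refine radial_lp_bound (bCoeff Q) (dCoeff Q) (bDual Q) _ (by positivity) d hd (bCoeff_nonneg Q)
    (bCoeff_le_dCoeff Q) (bDual_nonneg Q) (fun σ hσ => bDual_eq_bCoeff Q σ (hQ.detects σ hσ))
    (bCoeff_zero Q (by rw [hQ.finrank_eq]; exact hM))
    (fun υ => by rw [sum_chi_mul_bDual, hfin]) (fun w => bump r s w / √(shell n w))
    (fun w => div_nonneg (bump_nonneg hsr w) (Real.sqrt_nonneg _)) ⟨r, hrn, ?_⟩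
    (bump_eigen hs hsr hrn hlam) L
    (fun σ h1 h2 w _ h3 => hL σ h1 h2 w (hwin w h3).1 (hwin w h3).2)
  have hs' : (1 : ℝ) ≤ s := by exact_mod_cast hs
  rw [bump_eq hsr (by omega) (by omega)]
  refine div_ne_zero ?_ (Real.sqrt_pos.mpr (shell_pos hrn)).ne'
  have : ((r : ℝ) - (r - s)) * (r + 1 - r) = s := by ring
  rw [this]; linarith

end

/-! ### Ratios of normalised Krawtchouk values from the recurrence. -/

section

/-- The three-term recurrence in `i` satisfied by the normalised Krawtchouk polynomials
`K_w(i) / K_w(0)`. -/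
structure KrawSeq (n w : ℕ) (k : ℕ → ℝ) : Prop where
  zero : k 0 = 1
  step : ∀ i ≤ n, 3 * ((n : ℝ) - i) * k (i + 1) + 2 * i * k i + i * k (i - 1) =
    (3 * n - 4 * w) * k i

theorem krawSeq_kraw {n w : ℕ} (h : w ≤ n) : KrawSeq n w fun i => kraw n w i / shell n w where
  zero := by rw [kraw_zero_right]; exact div_self (shell_pos h).ne'
  step i hi := by
    have := kraw_recurrence w hi
    have hs := (shell_pos h).ne'
    field_simp
    linear_combination this

namespace KrawSeq

variable {n w : ℕ} {k : ℕ → ℝ}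

/-- A constant subsolution of the ratio recurrence forces positivity. -/
theorem pos_of_quadratic (hk : KrawSeq n w k) {y x : ℝ} (hy0 : 0 < y) (hy1 : y ≤ 1) (hx : x < n)
    (hq : 3 * (n - x) * y ^ 2 - (3 * n - 4 * w - 2 * x) * y + x ≤ 0) (i : ℕ) (hi : (i : ℝ) ≤ x) :
    0 < k i ∧ y * k i ≤ k (i + 1) := by
  have hq' : ∀ j : ℕ, (j : ℝ) ≤ x →
      3 * ((n : ℝ) - j) * y ^ 2 - (3 * n - 4 * w - 2 * j) * y + j ≤ 0 := by
    intro j hj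
    -- This product is the slope in j of the quadratic condition, so the condition at x implies it
    -- at every j ≤ x.
    have : 0 ≤ (1 - y) * (1 + 3 * y) := mul_nonneg (by linarith) (by linarith)
    nlinarith
  induction i with
  | zero =>
    refine ⟨by rw [hk.zero]; exact one_pos, ?_⟩
    have h1 := hk.step 0 (Nat.zero_le n)
    have h2 := hq' 0 hi
    rw [hk.zero] at h1 ⊢
    simp only [Nat.cast_zero, sub_zero, mul_zero, add_zero, mul_one, zero_add] at h1 h2 ⊢
    have h3 : 3 * (n : ℝ) * y ≤ 3 * n - 4 * w := by
      refine le_of_mul_le_mul_right ?_ hy0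
      nlinarith
    have hn : (0 : ℝ) < n := by
      have : ((0 : ℕ) : ℝ) ≤ x := hi
      push_cast at this; linarith
    refine le_of_mul_le_mul_left ?_ (by positivity : (0 : ℝ) < 3 * n)
    linarith
  | succ i ih =>
    have hix : (i : ℝ) ≤ x := by push_cast at hi; linarith
    obtain ⟨ih1, ih2⟩ := ih hix
    have hpos : 0 < k (i + 1) := lt_of_lt_of_le (by positivity) ih2
    refine ⟨hpos, ?_⟩
    have hin : ((i + 1 : ℕ) : ℝ) < n := lt_of_le_of_lt hi hx
    have h1 := hk.step (i + 1) (by exact_mod_cast hin.le)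
    have h2 := hq' (i + 1) hi
    rw [Nat.add_sub_cancel] at h1
    set j : ℝ := ((i + 1 : ℕ) : ℝ)
    have hj : 0 ≤ j := Nat.cast_nonneg _
    have h3 : 0 < 3 * ((n : ℝ) - j) := by linarith
    refine le_of_mul_le_mul_left ?_ (mul_pos h3 hy0)
    nlinarith [mul_le_mul_of_nonneg_left ih2 hj]

/-- A supersolution of the ratio recurrence bounds the ratios. -/
theorem ratio_le (hk : KrawSeq n w k) (I : ℕ) (hI : I < n) (hpos : ∀ i ≤ I, 0 < k i) (U : ℕ → ℝ)
    (hU : ∀ i ≤ I, 0 < U i) (h0 : (3 * n - 4 * w : ℝ) ≤ 3 * n * U 0)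
    (hsup : ∀ i, i + 1 ≤ I → (3 * n - 4 * w - 2 * (i + 1 : ℕ) : ℝ) - (i + 1 : ℕ) / U i ≤
      3 * (n - (i + 1 : ℕ)) * U (i + 1)) (i : ℕ) (hi : i ≤ I) : k (i + 1) ≤ U i * k i := by
  induction i with
  | zero =>
    have h1 := hk.step 0 (Nat.zero_le n)
    rw [hk.zero] at h1 ⊢
    simp only [Nat.cast_zero, sub_zero, mul_zero, add_zero, mul_one, zero_add] at h1 ⊢
    have hn : (0 : ℝ) < n := by exact_mod_cast (Nat.zero_le I).trans_lt hI
    refine le_of_mul_le_mul_left ?_ (by positivity : (0 : ℝ) < 3 * n)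
    linarith
  | succ i ih =>
    have hii : i ≤ I := by omega
    have h1 := hk.step (i + 1) (by omega)
    rw [Nat.add_sub_cancel] at h1
    have h2 := ih hii
    have h3 := hsup i hi
    have hin : ((i + 1 : ℕ) : ℝ) < n := by exact_mod_cast hi.trans_lt hI
    set j : ℝ := ((i + 1 : ℕ) : ℝ)
    have hj : 0 ≤ j := Nat.cast_nonneg _
    have h4 : j / U i * k (i + 1) ≤ j * k i := by
      rw [div_mul_eq_mul_div, div_le_iff₀ (hU i hii)]
      nlinarith
    have h5 := mul_le_mul_of_nonneg_right h3 (hpos (i + 1) hi).le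
    refine le_of_mul_le_mul_left ?_ (by linarith : (0 : ℝ) < 3 * ((n : ℝ) - j))
    linarith

/-- A single step of the recurrence grows by a factor of at most three. -/
theorem abs_growth (hk : KrawSeq n w k) (hw : w ≤ n) {I : ℕ} {B : ℝ}
    (h0 : |k I| ≤ B) (h1 : |k (I + 1)| ≤ B) (m : ℕ) (hm : 2 * (I + m) ≤ n) :
    |k (I + m)| ≤ 3 ^ m * B ∧ |k (I + m + 1)| ≤ 3 ^ m * B := by
  have hB : 0 ≤ B := (abs_nonneg _).trans h0
  induction m with
  | zero => simpa using ⟨h0, h1⟩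
  | succ m ih =>
    obtain ⟨a1, a2⟩ := ih (by omega)
    have h3 : (3 : ℝ) ^ m * B ≤ 3 ^ (m + 1) * B := by
      rw [pow_succ]; nlinarith [mul_nonneg (pow_nonneg (by norm_num : (0 : ℝ) ≤ 3) m) hB]
    refine ⟨a2.trans h3, ?_⟩
    have h4 := hk.step (I + m + 1) (by omega)
    rw [Nat.add_sub_cancel] at h4
    have hj : 2 * ((I + m + 1 : ℕ) : ℝ) ≤ n := by exact_mod_cast hm
    rw [show I + (m + 1) = I + m + 1 by ring]
    have hwn : (w : ℝ) ≤ n := by exact_mod_cast hw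
    have hw0 : (0 : ℝ) ≤ w := Nat.cast_nonneg _
    set j : ℝ := ((I + m + 1 : ℕ) : ℝ)
    have hj1 : 1 ≤ j := by simp only [j]; push_cast; linarith [(Nat.cast_nonneg I : (0:ℝ) ≤ I), (Nat.cast_nonneg m : (0:ℝ) ≤ m)]
    set P := 3 ^ m * B
    have hP : 0 ≤ P := by positivity
    rw [show (3 : ℝ) ^ (m + 1) * B = 3 * P by simp only [P]; ring]
    obtain ⟨b1, b2⟩ := abs_le.mp a1
    obtain ⟨c1, c2⟩ := abs_le.mp a2
    have hc : |(3 * n - 4 * w - 2 * j) * k (I + m + 1)| ≤ (3 * n + 2 * j) * P := by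
      rw [abs_mul]
      refine mul_le_mul ?_ a2 (abs_nonneg _) (by linarith)
      rw [abs_le]; constructor <;> linarith
    obtain ⟨d1, d2⟩ := abs_le.mp hc
    have hpos : (0 : ℝ) < 3 * (n - j) := by linarith
    have hjk := mul_le_mul_of_nonneg_left b1 (by linarith : (0 : ℝ) ≤ j)
    have hjk2 := mul_le_mul_of_nonneg_left b2 (by linarith : (0 : ℝ) ≤ j)
    -- This amounts to 3n + 3j ≤ 9(n − j), that is 2j ≤ n.
    have hfin : (3 * n + 2 * j) * P + j * P ≤ 3 * (n - j) * (3 * P) := by nlinarith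
    rw [abs_le]
    constructor
    · refine le_of_mul_le_mul_left ?_ hpos
      linarith
    · refine le_of_mul_le_mul_left ?_ hpos
      linarith

/-- Extension of an exponential bound past the region of positivity. -/
theorem abs_le_exp (hk : KrawSeq n w k) (hw : w ≤ n) {I : ℕ} {A β : ℝ} (hβ : β ≤ 0) (hβ2 : -2 ≤ β)
    (hb : ∀ i ≤ I + 1, |k i| ≤ Real.exp (A + β * i)) (m : ℕ) (i : ℕ) (hi : i ≤ I + m + 1)
    (hm : 2 * (I + m) ≤ n) : |k i| ≤ Real.exp (A + β * i + 4 * (m + 1)) := by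
  rcases le_or_gt i (I + 1) with h | h
  · refine (hb i h).trans (Real.exp_le_exp.mpr ?_)
    have : (0 : ℝ) ≤ m := Nat.cast_nonneg _
    linarith
  · obtain ⟨l, rfl⟩ := Nat.exists_eq_add_of_lt h
    have h0 : |k (I + 1)| ≤ Real.exp (A + β * I) := by
      refine (hb (I + 1) le_rfl).trans (Real.exp_le_exp.mpr ?_)
      push_cast; linarith
    have h1 := (hk.abs_growth hw (hb I (Nat.le_succ I)) h0 (l + 1) (by omega)).2
    -- The allowance of 4 per step is 2 for the growth factor 3 ≤ e² and 2 for extending the line of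
    -- slope β ≥ −2.
    have h3 : (3 : ℝ) ≤ Real.exp 2 := by
      have := Real.add_one_le_exp (2 : ℝ); linarith
    have hl : (l : ℝ) + 1 ≤ m := by exact_mod_cast (by omega : l + 1 ≤ m)
    rw [show I + 1 + l + 1 = I + (l + 1) + 1 by ring]
    refine h1.trans ?_
    calc (3 : ℝ) ^ (l + 1) * Real.exp (A + β * I)
        ≤ Real.exp 2 ^ (l + 1) * Real.exp (A + β * I) := by gcongr
      _ = Real.exp (2 * (l + 1) + (A + β * I)) := by
          rw [← Real.exp_nat_mul, ← Real.exp_add]; congr 1; push_cast; ring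
      _ ≤ _ := by
          apply Real.exp_le_exp.mpr
          push_cast
          have hl0 : (0 : ℝ) ≤ l := Nat.cast_nonneg _
          nlinarith

end KrawSeq

end

/-! ### The saddle-point bound at relative degree 19/100. -/

section

open Real

/-- The exponent of the binomial coefficient `(x + y choose x)`. -/
def mix (x y : ℝ) : ℝ := negMulLog x + negMulLog y - negMulLog (x + y)

/-- The exponent of the size of the quaternary Hamming sphere of relative radius `x`. -/
def rate (x : ℝ) : ℝ := mix x (1 - x) + x * log 3

/-- The saddle-point exponent, linear in `x`, of the normalised Krawtchouk polynomial of degree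
`19 / 100`. -/
def saddleLine (z x : ℝ) : ℝ :=
  (1 - x) * log (1 + 3 * z) + x * log (1 - z) - 19 / 100 * log z - rate (19 / 100)

/-- The abscissa at which `z` is the saddle point. -/
def crit (z : ℝ) : ℝ := 131 / 200 - 19 / (400 * z) - 243 / 400 * z

/-- For τ = 19/100, the point τ/(3(1−τ)) = 19/243 is the saddle at x = 0, where the exponent is
exactly that of the sphere. It starts the induction at k 0 = 1. -/
theorem saddleLine_zero : saddleLine (19 / 243) 0 = 0 := by
  have h1 : log (1 + 3 * (19 / 243)) = - log (81 / 100) := by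
    rw [← log_inv]; norm_num
  have h2 : log (19 / 243 : ℝ) = log (19 / 100) - log (81 / 100) - log 3 := by
    rw [← log_div (by norm_num) (by norm_num), ← log_div (by norm_num) (by norm_num)]; norm_num
  unfold saddleLine rate mix negMulLog
  rw [h1, h2]
  norm_num
  ring

theorem crit_sub_crit {z z' : ℝ} (hz : 0 < z) (hz' : 0 < z') :
    crit z' - crit z = (z' - z) * (19 / (400 * (z * z')) - 243 / 400) := by
  unfold crit
  field_simp
  ring

/-- The derivative 19/(400z²) − 243/400 vanishes at √(19/243) ≈ 0.2796, where the two saddles merge.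
Stopping at 11/40 keeps it above 1/50. -/
theorem crit_le_crit {z z' : ℝ} (hz : 0 < z) (hzz : z ≤ z') (hz' : z' ≤ 11 / 40) :
    1 / 50 * (z' - z) ≤ crit z' - crit z := by
  have hz0 : 0 < z' := by linarith
  rw [crit_sub_crit hz hz0, mul_comm]
  refine mul_le_mul_of_nonneg_left ?_ (by linarith)
  have h1 : z * z' ≤ 11 / 40 * (11 / 40) := mul_le_mul (by linarith) hz' hz0.le (by norm_num)
  have h2 : 0 < z * z' := by positivity
  rw [le_sub_iff_add_le, le_div_iff₀ (by positivity)]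
  nlinarith

theorem hasDerivAt_saddleLine {z x : ℝ} (hz : 0 < z) (hz1 : z < 1) :
    HasDerivAt (fun z => saddleLine z x) (4 * (crit z - x) / ((1 + 3 * z) * (1 - z))) z := by
  have h1 : HasDerivAt (fun z : ℝ => log (1 + 3 * z)) (3 / (1 + 3 * z)) z := by
    have := ((hasDerivAt_id z).const_mul 3).const_add 1
    simpa using this.log (by simp only [id]; positivity)
  have h2 : HasDerivAt (fun z : ℝ => log (1 - z)) (-1 / (1 - z)) z := by
    have := (hasDerivAt_id z).const_sub 1
    simpa using this.log (by simp only [id]; linarith)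
  have h3 := hasDerivAt_log hz.ne'
  have := (((h1.const_mul (1 - x)).add (h2.const_mul x)).sub (h3.const_mul (19 / 100))).sub_const
    (rate (19 / 100))
  refine this.congr_deriv ?_
  unfold crit
  have : 1 - z ≠ 0 := by linarith
  field_simp
  ring

/-- The z-derivative has the sign of crit z − x and `crit` is increasing here, so the saddle point
minimises the exponent. -/
theorem saddleLine_crit_le {z z' : ℝ} (hz : 0 < z) (hz1 : z ≤ 11 / 40) (hz' : 0 < z')
    (hz1' : z' ≤ 11 / 40) : saddleLine z (crit z) ≤ saddleLine z' (crit z) := by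
  have hcont : ∀ s : Set ℝ, s ⊆ Set.Ioc 0 (11 / 40) →
      ContinuousOn (fun y => saddleLine y (crit z)) s := fun s hs y hy =>
    (hasDerivAt_saddleLine (hs hy).1 (by linarith [(hs hy).2])).continuousAt.continuousWithinAt
  rcases le_total z z' with h | h
  · have hs : Set.Icc z z' ⊆ Set.Ioc 0 (11 / 40) := fun y hy =>
      ⟨lt_of_lt_of_le hz hy.1, hy.2.trans hz1'⟩
    refine monotoneOn_of_deriv_nonneg (convex_Icc z z') (hcont _ hs) ?_ ?_
      (Set.left_mem_Icc.mpr h) (Set.right_mem_Icc.mpr h) h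
    · intro y hy
      rw [interior_Icc] at hy
      have hy' := hs (Set.Ioo_subset_Icc_self hy)
      exact (hasDerivAt_saddleLine hy'.1 (by linarith [hy'.2])).differentiableAt.differentiableWithinAt
    · intro y hy
      rw [interior_Icc] at hy
      have hy' := hs (Set.Ioo_subset_Icc_self hy)
      have hlt : 0 < 1 - y := by linarith [hy'.2]
      rw [(hasDerivAt_saddleLine hy'.1 (by linarith)).deriv]
      have := crit_le_crit hz hy.1.le hy'.2
      have hy0 := hy'.1
      refine div_nonneg ?_ (by positivity)
      linarith [hy.1]
  · have hs : Set.Icc z' z ⊆ Set.Ioc 0 (11 / 40) := fun y hy =>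
      ⟨lt_of_lt_of_le hz' hy.1, hy.2.trans hz1⟩
    refine antitoneOn_of_deriv_nonpos (convex_Icc z' z) (hcont _ hs) ?_ ?_
      (Set.left_mem_Icc.mpr h) (Set.right_mem_Icc.mpr h) h
    · intro y hy
      rw [interior_Icc] at hy
      have hy' := hs (Set.Ioo_subset_Icc_self hy)
      exact (hasDerivAt_saddleLine hy'.1 (by linarith [hy'.2])).differentiableAt.differentiableWithinAt
    · intro y hy
      rw [interior_Icc] at hy
      have hy' := hs (Set.Ioo_subset_Icc_self hy)
      have hlt : 0 < 1 - y := by linarith [hy'.2]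
      rw [(hasDerivAt_saddleLine hy'.1 (by linarith)).deriv]
      have := crit_le_crit hy'.1 hy.2.le hz1
      have hy0 := hy'.1
      refine div_nonpos_of_nonpos_of_nonneg ?_ (by positivity)
      linarith [hy.2]

/-- `crit` runs from 0 at 19/243 to just above 0.3152102 at 11/40. The excess over 0.3152 leaves
room for the index I + 1 when n ≥ 4·10⁶. -/
theorem exists_crit_eq {x : ℝ} (h0 : 0 ≤ x) (h1 : x ≤ 3152102 / 10 ^ 7) :
    ∃ z, 19 / 243 ≤ z ∧ z ≤ 11 / 40 ∧ crit z = x := by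
  have hc : ContinuousOn crit (Set.Icc (19 / 243) (11 / 40)) := by
    unfold crit
    refine ContinuousOn.sub (ContinuousOn.sub continuousOn_const
      (ContinuousOn.div continuousOn_const (by fun_prop) ?_)) (by fun_prop)
    intro z hz
    have : 0 < z := lt_of_lt_of_le (by norm_num) hz.1
    positivity
  have := intermediate_value_Icc (by norm_num) hc
  obtain ⟨z, hz, rfl⟩ := this ⟨show crit (19 / 243) ≤ x by unfold crit; norm_num; exact h0,
    show x ≤ crit (11 / 40) by refine h1.trans ?_; unfold crit; norm_num⟩
  exact ⟨z, hz.1, hz.2, rfl⟩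

/-- The limit ratio of consecutive values at the saddle point `z`. -/
theorem crit_quadratic {z : ℝ} (hz : 0 < z) (hz1 : z < 1) :
    crit z / ((1 - z) / (1 + 3 * z)) =
      (3 - 4 * (19 / 100) - 2 * crit z) - 3 * (1 - crit z) * ((1 - z) / (1 + 3 * z)) := by
  have : 1 - z ≠ 0 := by linarith
  unfold crit
  field_simp
  ring

/-- Upper bound for the normalised Krawtchouk polynomials before their first zero. -/
theorem KrawSeq.le_exp_saddleLine {n w : ℕ} {k : ℕ → ℝ} (hk : KrawSeq n w k)
    (hn : 4 * 10 ^ 6 ≤ n) (hw : 19004 / 10 ^ 5 * (n : ℝ) ≤ w) (I : ℕ)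
    (hI : (I : ℝ) ≤ 3152 / 10 ^ 4 * n) (hpos : ∀ i ≤ I, 0 < k i) (i : ℕ) (hi : i ≤ I + 1) {z : ℝ}
    (hz0 : 19 / 243 ≤ z) (hz1 : z ≤ 11 / 40) : k i ≤ exp (n * saddleLine z (i / n)) := by
  have hn' : (4 * 10 ^ 6 : ℝ) ≤ n := by exact_mod_cast hn
  have hnpos : (0 : ℝ) < n := by linarith
  have hrange : ∀ i ≤ I + 1, (i : ℝ) / n ≤ 3152102 / 10 ^ 7 := by
    intro i hi
    have : (i : ℝ) ≤ I + 1 := by exact_mod_cast hi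
    rw [div_le_iff₀ hnpos]; linarith
  have hex : ∀ i : ℕ, ∃ z, i ≤ I + 1 → 19 / 243 ≤ z ∧ z ≤ 11 / 40 ∧ crit z = i / n := by
    intro i
    by_cases h : i ≤ I + 1
    · obtain ⟨z, hz⟩ := exists_crit_eq (by positivity) (hrange i h)
      exact ⟨z, fun _ => hz⟩
    · exact ⟨0, fun h' => absurd h' h⟩
  choose Z hZ using hex
  have hZ0 : crit (Z 0) = 0 := by simpa using (hZ 0 (Nat.zero_le _)).2.2
  -- The saddle is taken at i + 1: with that z fixed, passing from i to i + 1 changes n ·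
  -- `saddleLine` by exactly log (U i), and minimality of the saddle at i lets z be replaced
  -- beforehand.
  set U : ℕ → ℝ := fun i => (1 - Z (i + 1)) / (1 + 3 * Z (i + 1)) with hUdef
  have hUpos : ∀ i ≤ I, 0 < U i := by
    intro i hi
    obtain ⟨h1, h2, -⟩ := hZ (i + 1) (by omega)
    exact div_pos (by linarith) (by linarith)
  have hstep : ∀ i ≤ I, (1 - Z i) / (1 + 3 * Z i) - U i ≤ 200 / n := by
    intro i hi
    obtain ⟨h1, h2, h3⟩ := hZ (i + 1) (by omega)
    obtain ⟨g1, g2, g3⟩ := hZ i (by omega)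
    have hle : Z (i + 1) - Z i ≤ 50 / n := by
      rcases le_total (Z i) (Z (i + 1)) with h | h
      · have := crit_le_crit (by linarith) h h2
        rw [h3, g3] at this
        push_cast at this
        rw [← sub_div, add_sub_cancel_left] at this
        rw [show (50 : ℝ) / n = 50 * (1 / n) by ring]; linarith
      · have : (0 : ℝ) ≤ 50 / n := by positivity
        linarith
    have hp : 0 < 1 + 3 * Z i := by linarith
    have hq : 0 < 1 + 3 * Z (i + 1) := by linarith
    have e : (1 - Z i) / (1 + 3 * Z i) - U i =
        4 * (Z (i + 1) - Z i) / ((1 + 3 * Z i) * (1 + 3 * Z (i + 1))) := by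
      simp only [U]; field_simp; ring
    rw [e, div_le_iff₀ (by positivity)]
    have h5 : (1 : ℝ) ≤ (1 + 3 * Z i) * (1 + 3 * Z (i + 1)) := by nlinarith
    have h6 : (0 : ℝ) ≤ 200 / n := by positivity
    have h7 : (200 : ℝ) / n = 4 * (50 / n) := by ring
    nlinarith
  -- Moving the saddle from i to i + 1 costs at most 3 · 200 = 600. The excess of w over 0.19n
  -- contributes 4 · 4·10⁻⁵ · n ≥ 640.
  have hsuper : ∀ i ≤ I, (3 * n - 4 * w - 2 * i : ℝ) - n * (crit (Z i) / ((1 - Z i) / (1 + 3 * Z i))) ≤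
      3 * (n - i) * U i := by
    intro i hi
    obtain ⟨g1, g2, g3⟩ := hZ i (by omega)
    have h1 := hstep i hi
    rw [crit_quadratic (by linarith) (by linarith)]
    have hin : (i : ℝ) = n * crit (Z i) := by rw [g3]; field_simp
    have hi0 : 0 ≤ crit (Z i) := by rw [g3]; positivity
    have hle1 : crit (Z i) ≤ 1 := by
      rw [g3]; exact (hrange i (by omega)).trans (by norm_num)
    set u := (1 - Z i) / (1 + 3 * Z i)
    have h2 : 3 * n * (1 - crit (Z i)) * (u - U i) ≤ 600 := by
      calc 3 * n * (1 - crit (Z i)) * (u - U i) ≤ 3 * n * (1 - crit (Z i)) * (200 / n) :=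
            mul_le_mul_of_nonneg_left h1 (mul_nonneg (by positivity) (by linarith))
        _ = 600 * (1 - crit (Z i)) := by field_simp; ring
        _ ≤ 600 := by linarith
    rw [hin]
    have h3 : 3 * n * (1 - crit (Z i)) * (u - U i) =
      3 * (n - n * crit (Z i)) * u - 3 * (n - n * crit (Z i)) * U i := by ring
    linarith
  have hratio := hk.ratio_le I (by
      have : (I : ℝ) < n := by linarith
      exact_mod_cast this) hpos U hUpos (by
      have := hsuper 0 (Nat.zero_le _)
      rw [hZ0] at this
      simpa using this) (by
      intro i hi
      have := hsuper (i + 1) hi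
      rw [(hZ (i + 1) (by omega)).2.2] at this
      refine le_trans (le_of_eq ?_) this
      simp only [U]
      field_simp)
  have hmain : ∀ i ≤ I + 1, k i ≤ exp (n * saddleLine (Z i) (i / n)) := by
    intro i hi
    induction i with
    | zero =>
      rw [hk.zero]
      refine Real.one_le_exp ?_
      have h1 := hZ 0 (Nat.zero_le _)
      have h2 := crit_le_crit (z := 19 / 243) (z' := Z 0) (by norm_num) h1.1 h1.2.1
      have h3 : crit (19 / 243) = 0 := by unfold crit; norm_num
      rw [hZ0, h3] at h2
      have h4 : Z 0 = 19 / 243 := by linarith [h1.1]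
      rw [h4]; simp [saddleLine_zero]
    | succ i ih =>
      have h1 := hratio i (by omega)
      have h2 := ih (by omega)
      obtain ⟨g1, g2, g3⟩ := hZ i (by omega)
      obtain ⟨g1', g2', g3'⟩ := hZ (i + 1) hi
      have h3 : saddleLine (Z i) (i / n) ≤ saddleLine (Z (i + 1)) (i / n) := by
        rw [← g3]; exact saddleLine_crit_le (by linarith) g2 (by linarith) g2'
      have hU := hUpos i (by omega)
      have h4 : n * saddleLine (Z (i + 1)) ((i + 1 : ℕ) / n) =
          n * saddleLine (Z (i + 1)) (i / n) + log (U i) := by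
        simp only [U]
        rw [log_div (by linarith) (by linarith)]
        unfold saddleLine
        push_cast
        field_simp
        ring
      rw [h4, exp_add, exp_log hU, mul_comm]
      refine h1.trans (mul_le_mul_of_nonneg_left (h2.trans (exp_le_exp.mpr ?_)) hU.le)
      exact mul_le_mul_of_nonneg_left h3 hnpos.le
  refine (hmain i hi).trans (exp_le_exp.mpr (mul_le_mul_of_nonneg_left ?_ hnpos.le))
  obtain ⟨g1, g2, g3⟩ := hZ i hi
  rw [← g3]
  exact saddleLine_crit_le (by linarith) g2 (by linarith) hz1

/-- Upper bound for the normalised Krawtchouk polynomials of degree at least `n / 2`. -/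
theorem KrawSeq.le_exp_log_three {n w : ℕ} {k : ℕ → ℝ} (hk : KrawSeq n w k)
    (hw : n ≤ 2 * w) (I : ℕ) (hI : I < n) (hpos : ∀ i ≤ I, 0 < k i) (i : ℕ) (hi : i ≤ I + 1) :
    k i ≤ exp (-log 3 * i) := by
  have hw' : (n : ℝ) ≤ 2 * w := by exact_mod_cast hw
  -- Since 3n − 4w ≤ n, the constant 1/3 is a supersolution.
  have hratio := hk.ratio_le I hI hpos (fun _ => 1 / 3) (fun _ _ => by norm_num) (by linarith)
    (fun i hi => by
      have : (0 : ℝ) ≤ (i + 1 : ℕ) := Nat.cast_nonneg _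
      rw [div_div_eq_mul_div]
      linarith)
  induction i with
  | zero => simp [hk.zero]
  | succ i ih =>
    have h1 := hratio i (by omega)
    have h2 := ih (by omega)
    rw [show -log 3 * ((i + 1 : ℕ) : ℝ) = -log 3 * i + log (1 / 3) by
      rw [one_div, log_inv]; push_cast; ring, exp_add, exp_log (by norm_num)]
    linarith

end

/-! ### Entropy exponents of binomial coefficients. -/

section

open Real

theorem mix_zero_left (y : ℝ) : mix 0 y = 0 := by simp [mix]

theorem mix_zero_right (x : ℝ) : mix x 0 = 0 := by simp [mix]

theorem mix_eq_of_pos {x y : ℝ} (hx : 0 < x) (hy : 0 < y) :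
    mix x y = -x * log (x / (x + y)) - y * log (1 - x / (x + y)) := by
  have h : 1 - x / (x + y) = y / (x + y) := by field_simp; ring
  rw [h, log_div hx.ne' (by positivity), log_div hy.ne' (by positivity)]
  unfold mix negMulLog
  ring

theorem mul_log_div_le {x u : ℝ} (hx : 0 ≤ x) (hu : 0 < u) : negMulLog x + x * log u ≤ u - x := by
  rcases hx.eq_or_lt with rfl | hx
  · simpa using hu.le
  · have := log_le_sub_one_of_pos (div_pos hu hx)
    rw [log_div hu.ne' hx.ne'] at this
    have h2 := mul_le_mul_of_nonneg_left this hx.le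
    have h3 : x * (u / x - 1) = u - x := by field_simp
    unfold negMulLog
    linarith

/-- Gibbs' inequality. -/
theorem mix_le {x y p : ℝ} (hx : 0 ≤ x) (hy : 0 ≤ y) (hp0 : 0 < p) (hp1 : p < 1) :
    mix x y ≤ -x * log p - y * log (1 - p) := by
  rcases (add_nonneg hx hy).eq_or_lt with h | h
  · have h1 : x = 0 := by linarith
    have h2 : y = 0 := by linarith
    simp [h1, h2, mix]
  · have hq : 0 < 1 - p := by linarith
    have h1 := mul_log_div_le hx (mul_pos h hp0)
    have h2 := mul_log_div_le hy (mul_pos h hq)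
    rw [log_mul h.ne' hp0.ne'] at h1
    rw [log_mul h.ne' hq.ne'] at h2
    unfold mix
    have : negMulLog (x + y) = -(x + y) * log (x + y) := rfl
    rw [this]
    linarith

theorem mix_nonneg {x y : ℝ} (hx : 0 ≤ x) (hy : 0 ≤ y) : 0 ≤ mix x y := by
  rcases hx.eq_or_lt with rfl | hx
  · rw [mix_zero_left]
  rcases hy.eq_or_lt with rfl | hy
  · rw [mix_zero_right]
  rw [mix_eq_of_pos hx hy]
  have h0 : 0 < x / (x + y) := by positivity
  have h1 : x / (x + y) < 1 := by rw [div_lt_one (by positivity)]; linarith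
  have h2 := log_nonpos h0.le h1.le
  have h3 := log_nonpos (by linarith : 0 ≤ 1 - x / (x + y)) (by linarith)
  nlinarith

/-- The mixing exponent is jointly concave. -/
theorem mix_concave {x y x' y' a b : ℝ} (hx : 0 ≤ x) (hy : 0 ≤ y) (hx' : 0 ≤ x') (hy' : 0 ≤ y')
    (ha : 0 ≤ a) (hb : 0 ≤ b) :
    a * mix x y + b * mix x' y' ≤ mix (a * x + b * x') (a * y + b * y') := by
  have hX : 0 ≤ a * x + b * x' := by positivity
  have hY : 0 ≤ a * y + b * y' := by positivity
  have hzero : ∀ c u v : ℝ, c * u = 0 → c * mix u v = 0 := by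
    intro c u v h
    rcases mul_eq_zero.mp h with h | h <;> simp [h, mix_zero_left]
  have hzero' : ∀ c u v : ℝ, c * v = 0 → c * mix u v = 0 := by
    intro c u v h
    rcases mul_eq_zero.mp h with h | h <;> simp [h, mix_zero_right]
  rcases hX.eq_or_lt with h | hXp
  · have h1 : a * x = 0 := by nlinarith [mul_nonneg ha hx, mul_nonneg hb hx']
    have h2 : b * x' = 0 := by nlinarith [mul_nonneg ha hx, mul_nonneg hb hx']
    rw [hzero _ _ _ h1, hzero _ _ _ h2, ← h, mix_zero_left, add_zero]
  rcases hY.eq_or_lt with h | hYp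
  · have h1 : a * y = 0 := by nlinarith [mul_nonneg ha hy, mul_nonneg hb hy']
    have h2 : b * y' = 0 := by nlinarith [mul_nonneg ha hy, mul_nonneg hb hy']
    rw [hzero' _ _ _ h1, hzero' _ _ _ h2, ← h, mix_zero_right, add_zero]
  rw [mix_eq_of_pos hXp hYp]
  -- Gibbs' inequality at the proportion of the mixture is an equality for the mixture and an upper
  -- bound for each component.
  set p := (a * x + b * x') / (a * x + b * x' + (a * y + b * y'))
  have h0 : 0 < p := by positivity
  have h1 : p < 1 := by simp only [p]; rw [div_lt_one (by positivity)]; linarith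
  have h2 := mul_le_mul_of_nonneg_left (mix_le hx hy h0 h1) ha
  have h3 := mul_le_mul_of_nonneg_left (mix_le hx' hy' h0 h1) hb
  linarith

theorem mix_homogeneous (c x y : ℝ) : mix (c * x) (c * y) = c * mix x y := by
  unfold mix
  rw [← mul_add]
  simp only [negMulLog_mul]
  ring

theorem exp_mix_natCast (a b : ℕ) :
    exp (mix a b) * (a ^ a * b ^ b) = ((a : ℝ) + b) ^ (a + b) := by
  have key : ∀ m : ℕ, (m : ℝ) ^ m = exp (-negMulLog m) := by
    intro m
    rcases Nat.eq_zero_or_pos m with rfl | h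
    · simp
    · have : (0 : ℝ) < m := by exact_mod_cast h
      unfold negMulLog
      rw [neg_mul, neg_neg, exp_nat_mul, exp_log this]
  rw [key a, key b, ← exp_add, ← exp_add, show ((a : ℝ) + b) = ((a + b : ℕ) : ℝ) by push_cast; rfl,
    key (a + b)]
  congr 1
  unfold mix
  push_cast
  ring

/-- The term of a binomial expansion at the mean is the largest. -/
theorem binomial_term_le (a b j : ℕ) (hj : j ≤ a + b) :
    (a + b).choose j * a ^ j * b ^ (a + b - j) ≤ (a + b).choose a * a ^ a * b ^ b := by
  set N := a + b with hN
  set t : ℕ → ℕ := fun j => N.choose j * a ^ j * b ^ (N - j) with ht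
  have hta : t a = N.choose a * a ^ a * b ^ b := by
    simp only [ht]
    rw [show N - a = b by omega]
  have hstep : ∀ j, j < N → t (j + 1) * ((j + 1) * b) = t j * ((N - j) * a) := by
    intro j hj
    have h1 := Nat.choose_succ_right_eq N j
    have h2 : N - j = (N - (j + 1)) + 1 := by omega
    simp only [ht]
    calc N.choose (j + 1) * a ^ (j + 1) * b ^ (N - (j + 1)) * ((j + 1) * b)
        = (N.choose (j + 1) * (j + 1)) * a ^ (j + 1) * b ^ (N - (j + 1) + 1) := by ring
      _ = _ := by rw [h1, ← h2]; ring
  rw [← hta]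
  change t j ≤ t a
  rcases Nat.eq_zero_or_pos b with hb | hb
  · subst hb
    rcases hj.eq_or_lt with h | h
    · rw [h, hN, Nat.add_zero]
    · have : t j = 0 := by simp only [ht]; rw [zero_pow (by omega), mul_zero]
      rw [this]; exact Nat.zero_le _
  rcases le_total j a with h | h
  · induction h using Nat.decreasingInduction with
    | self => exact le_rfl
    | of_succ k hk ih =>
      refine le_trans ?_ (ih (by omega))
      have h1 := hstep k (by omega)
      have h2 : (k + 1) * b ≤ (N - k) * a := by
        obtain ⟨l, rfl⟩ := Nat.exists_eq_add_of_lt hk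
        rw [show N - k = l + 1 + b by omega]
        nlinarith
      have h3 : 0 < (k + 1) * b := by positivity
      refine Nat.le_of_mul_le_mul_right ?_ h3
      rw [h1]
      exact Nat.mul_le_mul_left _ h2
  · induction j, h using Nat.le_induction with
    | base => exact le_rfl
    | succ k hk ih =>
      refine le_trans ?_ (ih (by omega))
      have h1 := hstep k (by omega)
      have h2 : (N - k) * a ≤ (k + 1) * b := by
        obtain ⟨l, rfl⟩ := Nat.exists_eq_add_of_le hk
        have : N - (a + l) ≤ b := by omega
        nlinarith
      have h3 : 0 < (k + 1) * b := by positivity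
      refine Nat.le_of_mul_le_mul_right ?_ h3
      rw [h1]
      exact Nat.mul_le_mul_left _ h2

/-- The expansion of (a + b)^(a + b) has a + b + 1 terms, the largest being the one at a. -/
theorem exp_mix_le_choose (a b : ℕ) :
    exp (mix a b) ≤ (a + b + 1) * (a + b).choose a := by
  have h1 : (a + b) ^ (a + b) ≤ (a + b + 1) * ((a + b).choose a * a ^ a * b ^ b) := by
    rw [add_pow]
    calc ∑ m ∈ Finset.range (a + b + 1), a ^ m * b ^ (a + b - m) * (a + b).choose m
        ≤ ∑ m ∈ Finset.range (a + b + 1), (a + b).choose a * a ^ a * b ^ b := by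
          refine Finset.sum_le_sum fun m hm => ?_
          have := binomial_term_le a b m (Finset.mem_range_succ_iff.mp hm)
          calc _ = (a + b).choose m * a ^ m * b ^ (a + b - m) := by ring
            _ ≤ _ := this
      _ = _ := by rw [Finset.sum_const, Finset.card_range, smul_eq_mul]
  have h2 : ((a : ℝ) + b) ^ (a + b) ≤ (a + b + 1) * ((a + b).choose a * a ^ a * b ^ b) := by
    exact_mod_cast h1
  have hpos : ∀ m : ℕ, (0 : ℝ) < (m : ℝ) ^ m := by
    intro m
    rcases Nat.eq_zero_or_pos m with rfl | h
    · simp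
    · positivity
  have h3 : (0 : ℝ) < (a : ℝ) ^ a * b ^ b := mul_pos (hpos a) (hpos b)
  refine le_of_mul_le_mul_right ?_ h3
  rw [exp_mix_natCast]
  linarith

/-- An upper bound for the size of a Hamming sphere. -/
theorem shell_le_exp {n w : ℕ} {x : ℝ} (hx0 : 0 < x) (hx1 : x ≤ 3 / 4) (hw : (w : ℝ) ≤ x * n) :
    shell n w ≤ exp (n * rate x) := by
  by_cases hwn : w ≤ n
  swap
  · unfold shell
    rw [Nat.choose_eq_zero_of_lt (not_le.mp hwn)]
    simpa using (exp_pos _).le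
  have hx : 0 < 1 - x := by linarith
  have h1 : (n.choose w : ℝ) * x ^ w * (1 - x) ^ (n - w) ≤ 1 := by
    calc (n.choose w : ℝ) * x ^ w * (1 - x) ^ (n - w)
        = x ^ w * (1 - x) ^ (n - w) * n.choose w := by ring
      _ ≤ ∑ m ∈ Finset.range (n + 1), x ^ m * (1 - x) ^ (n - m) * n.choose m :=
          Finset.single_le_sum (f := fun m => x ^ m * (1 - x) ^ (n - m) * (n.choose m : ℝ))
            (fun _ _ => by positivity) (Finset.mem_range_succ_iff.mpr hwn)
      _ = 1 := by rw [← add_pow, add_sub_cancel, one_pow]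
  have h2 : exp (n * rate x) = exp (w * log 3 - w * log x - (n - w) * log (1 - x)) *
      exp ((x * n - w) * (log 3 + log (1 - x) - log x)) := by
    rw [← exp_add]
    congr 1
    unfold rate mix negMulLog
    rw [add_sub_cancel, log_one]
    ring
  -- Here x ≤ 3/4 enters: 3(1 − x) ≥ x, so the tilted exponent does not decrease as w rises to xn.
  have h3 : 0 ≤ log 3 + log (1 - x) - log x := by
    rw [← log_mul (by norm_num) hx.ne', sub_nonneg]
    exact log_le_log hx0 (by linarith)
  have h4 : 1 ≤ exp ((x * n - w) * (log 3 + log (1 - x) - log x)) :=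
    one_le_exp (mul_nonneg (by linarith) h3)
  have h5 : exp (w * log 3 - w * log x - (n - w) * log (1 - x)) * (x ^ w * (1 - x) ^ (n - w)) =
      3 ^ w := by
    have e1 : x ^ w = exp (w * log x) := by rw [exp_nat_mul, exp_log hx0]
    have e2 : (1 - x) ^ (n - w) = exp ((n - w) * log (1 - x)) := by
      rw [← Nat.cast_sub hwn, exp_nat_mul, exp_log hx]
    have e3 : (3 : ℝ) ^ w = exp (w * log 3) := by rw [exp_nat_mul, exp_log (by norm_num)]
    rw [e1, e2, e3, ← exp_add, ← exp_add]
    congr 1; ring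
  rw [h2]
  refine le_trans ?_ (le_mul_of_one_le_right (exp_pos _).le h4)
  have h6 : 0 < x ^ w * (1 - x) ^ (n - w) := by positivity
  refine le_of_mul_le_mul_right ?_ h6
  rw [h5]
  unfold shell
  have : (0 : ℝ) < 3 ^ w := by positivity
  nlinarith

end

/-! ### The exponent of the pair count: monotonicity, concavity, rational points. -/

section

open Real

/-- The exponent of the number of vectors of relative weight `τ` at relative distance `τ` from a
vector of relative weight `x`, in which a fraction `e` of the coordinates is balanced. -/
def pairRate (τ x e : ℝ) : ℝ :=
  x * log 2 + mix e (x - e) + mix (τ - x + e / 2) (1 - τ - e / 2) + (τ - x + e / 2) * log 3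

/-- Each of the three binomials in `le_pairCount` is its exponential up to a factor n + 1; the
central one accounts for 4^a. -/
theorem exp_pairRate_le_pairCount {n : ℕ} (hn : 0 < n) (σ : Fin n → Pauli) {w a : ℕ}
    (hw : w + a ≤ n) (ha : 2 * a ≤ wt σ) (hwa : wt σ ≤ w + a) :
    exp (n * pairRate (w / n) (wt σ / n) ((2 * a : ℕ) / n)) ≤ (n + 1) ^ 3 * pairCount σ w := by
  have h0 := le_pairCount σ (by omega : w ≤ n) ha hwa
  have hin := wt_le σ
  set i := wt σ
  obtain ⟨b, hb⟩ := Nat.exists_eq_add_of_le ha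
  obtain ⟨u, hu⟩ := Nat.exists_eq_add_of_le hwa
  obtain ⟨v, hv⟩ := Nat.exists_eq_add_of_le hw
  have e1 : w + a - i = u := by omega
  have e2 : n - i = u + v := by omega
  have e3 : i - 2 * a = b := by omega
  rw [e1, e2, e3] at h0
  have hn' : (n : ℝ) ≠ 0 := by positivity
  have c1 : (i : ℝ) = 2 * a + b := by exact_mod_cast hb
  have c2 : (w : ℝ) + a = i + u := by exact_mod_cast hu
  have c3 : (n : ℝ) = w + a + v := by exact_mod_cast hv
  have hrate : n * pairRate (w / n) (i / n) ((2 * a : ℕ) / n) =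
      mix ((2 * a : ℕ) : ℝ) b + (i * log 2 + (mix u v + u * log 3)) := by
    unfold pairRate
    have f1 : (n : ℝ) * mix ((2 * a : ℕ) / n) (i / n - (2 * a : ℕ) / n) =
        mix ((2 * a : ℕ) : ℝ) b := by
      rw [← mix_homogeneous]
      congr 1
      · field_simp
      · field_simp; push_cast; linarith
    have f2 : (n : ℝ) * mix ((w : ℝ) / n - i / n + (2 * a : ℕ) / n / 2)
        (1 - w / n - (2 * a : ℕ) / n / 2) = mix u v := by
      rw [← mix_homogeneous]
      congr 1
      · field_simp; push_cast; linarith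
      · field_simp; push_cast; linarith
    rw [mul_add, mul_add, mul_add, f1, f2]
    have f3 : (n : ℝ) * ((i : ℝ) / n * log 2) = i * log 2 := by field_simp
    have f4 : (n : ℝ) * (((w : ℝ) / n - i / n + (2 * a : ℕ) / n / 2) * log 3) = u * log 3 := by
      rw [← mul_assoc]
      congr 1
      field_simp; push_cast; linarith
    rw [f3, f4]; ring
  rw [hrate, exp_add, exp_add, exp_add]
  have g1 := exp_mix_le_choose (2 * a) b
  have g2 := exp_mix_le_choose u v
  have g3 : exp (u * log 3) = (3 : ℝ) ^ u := by rw [exp_nat_mul, exp_log (by norm_num)]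
  have g4 : exp (i * log 2) ≤ (2 * a + 1) * ((2 * a).choose a) * 2 ^ b := by
    rw [exp_nat_mul, exp_log (by norm_num), hb, pow_add, pow_mul]
    have : (4 : ℝ) ^ a ≤ (2 * a + 1) * ((2 * a).choose a) := by
      exact_mod_cast Nat.four_pow_le_two_mul_add_one_mul_central_binom a
    have h5 : (0 : ℝ) < 2 ^ b := by positivity
    rw [show (2 : ℝ) ^ 2 = 4 by norm_num]
    exact mul_le_mul_of_nonneg_right this h5.le
  rw [g3]
  rw [← hb] at g1
  have hi' : (i : ℝ) ≤ n := by exact_mod_cast hin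
  have k1 : exp (mix ((2 * a : ℕ) : ℝ) b) ≤ (n + 1) * i.choose (2 * a) := by
    refine g1.trans (mul_le_mul_of_nonneg_right ?_ (Nat.cast_nonneg _))
    push_cast; linarith
  have k2 : exp (mix (u : ℝ) v) ≤ (n + 1) * (u + v).choose u := by
    refine g2.trans (mul_le_mul_of_nonneg_right ?_ (Nat.cast_nonneg _))
    linarith [(Nat.cast_nonneg i : (0 : ℝ) ≤ i)]
  have k3 : exp (i * log 2) ≤ (n + 1) * ((2 * a).choose a * 2 ^ b) := by
    refine g4.trans ?_
    rw [mul_assoc]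
    refine mul_le_mul_of_nonneg_right ?_ (by positivity)
    linarith [(Nat.cast_nonneg b : (0 : ℝ) ≤ b)]
  calc exp (mix ((2 * a : ℕ) : ℝ) b) * (exp (i * log 2) * (exp (mix u v) * 3 ^ u))
      ≤ ((n + 1) * i.choose (2 * a)) * (((n + 1) * ((2 * a).choose a * 2 ^ b)) *
          (((n + 1) * (u + v).choose u) * 3 ^ u)) := by gcongr
    _ = (n + 1) ^ 3 * ((i.choose (2 * a) * ((2 * a).choose a) * 2 ^ b *
          ((u + v).choose u * 3 ^ u) : ℕ) : ℝ) := by push_cast; ring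
    _ ≤ _ := by
        refine mul_le_mul_of_nonneg_left ?_ (by positivity)
        exact_mod_cast h0

theorem continuous_pairRate : Continuous fun p : ℝ × ℝ × ℝ => pairRate p.1 p.2.1 p.2.2 := by
  unfold pairRate mix
  fun_prop

theorem continuous_rate : Continuous rate := by
  unfold rate mix
  fun_prop

/-- The relative exponent `pairRate - rate` increases with the relative weight. -/
theorem pairRate_sub_rate_mono {x e τ τ' : ℝ} (he : 0 ≤ e) (hτ : 0 < τ) (hτ' : τ' < 1) (hττ : τ ≤ τ')
    (hxe : x - e / 2 ≤ τ) (hex : e / 2 ≤ x * (1 - τ')) :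
    pairRate τ x e - rate τ ≤ pairRate τ' x e - rate τ' := by
  have hc0 : 0 ≤ x := by
    by_contra h
    have : x * (1 - τ') < 0 := mul_neg_of_neg_of_pos (not_le.mp h) (by linarith)
    linarith
  have hbτ : e / 2 + τ' ≤ 1 := by
    by_cases hx1 : x ≤ 1
    · nlinarith
    · have : 1 < x := not_le.mp hx1
      nlinarith
  have hform : ∀ y, pairRate y x e - rate y =
      (x * log 2 + mix e (x - e) - (x - e / 2) * log 3) - negMulLog (1 - x) + negMulLog 1 +
        (negMulLog (y - x + e / 2) + negMulLog (1 - y - e / 2) - negMulLog y - negMulLog (1 - y)) := by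
    intro y
    unfold pairRate rate
    unfold mix
    rw [show y - x + e / 2 + (1 - y - e / 2) = 1 - x by ring, show y + (1 - y) = 1 by ring]
    ring
  rw [hform, hform]
  refine add_le_add_right ?_ _
  refine monotoneOn_of_deriv_nonneg (convex_Icc τ τ')
    (f := fun y => negMulLog (y - x + e / 2) + negMulLog (1 - y - e / 2) - negMulLog y -
      negMulLog (1 - y)) (by fun_prop) ?_ ?_
      (Set.left_mem_Icc.mpr hττ) (Set.right_mem_Icc.mpr hττ) hττ
  all_goals
    intro y hy
    rw [interior_Icc] at hy
    obtain ⟨hy1, hy2⟩ := hy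
    have p1 : 0 < y - x + e / 2 := by linarith
    have p2 : 0 < 1 - y - e / 2 := by linarith
    have p3 : 0 < y := by linarith
    have p4 : 0 < 1 - y := by linarith
    have d1 : HasDerivAt (fun y : ℝ => y - x + e / 2) 1 y :=
      ((hasDerivAt_id y).sub_const x).add_const (e / 2)
    have d2 : HasDerivAt (fun y : ℝ => 1 - y - e / 2) (-1) y :=
      ((hasDerivAt_id y).const_sub 1).sub_const (e / 2)
    have d4 : HasDerivAt (fun y : ℝ => 1 - y) (-1) y := (hasDerivAt_id y).const_sub 1
    have D1 := (hasDerivAt_negMulLog p1.ne').comp y d1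
    have D2 := (hasDerivAt_negMulLog p2.ne').comp y d2
    have D4 := (hasDerivAt_negMulLog p4.ne').comp y d4
    have D := ((D1.add D2).sub (hasDerivAt_negMulLog p3.ne')).sub D4
  · exact D.differentiableAt.differentiableWithinAt
  · have D' : deriv (fun y => negMulLog (y - x + e / 2) + negMulLog (1 - y - e / 2) - negMulLog y -
      negMulLog (1 - y)) y = log (1 - y - e / 2) + log y - (log (y - x + e / 2) + log (1 - y)) := by
      refine Eq.trans D.deriv ?_
      ring
    rw [D', ← log_mul p2.ne' p3.ne', ← log_mul p1.ne' p4.ne', sub_nonneg]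
    -- The difference of the two products is x(1 − y) − e/2, which `hex` keeps nonnegative for y ≤
    -- τ'.
    refine log_le_log (by positivity) ?_
    have : x * y ≤ x * τ' := mul_le_mul_of_nonneg_left hy2.le hc0
    nlinarith

/-- Joint concavity of `pairRate`, in the form of a chord bound. -/
theorem pairRate_chord {τ s₀ e₀ s₁ e₁ α β x : ℝ} (h₀ : 0 ≤ e₀) (h₀' : e₀ ≤ s₀)
    (h₀'' : s₀ - e₀ / 2 ≤ τ) (g₀ : τ + e₀ / 2 ≤ 1) (h₁ : 0 ≤ e₁) (h₁' : e₁ ≤ s₁)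
    (h₁'' : s₁ - e₁ / 2 ≤ τ) (g₁ : τ + e₁ / 2 ≤ 1)
    (hL₀ : α + β * s₀ ≤ pairRate τ s₀ e₀ - rate τ) (hL₁ : α + β * s₁ ≤ pairRate τ s₁ e₁ - rate τ)
    (hx₀ : s₀ ≤ x) (hx₁ : x ≤ s₁) (hs : s₀ < s₁) :
    ∃ e, 0 ≤ e ∧ (∀ κ, e₀ ≤ κ * s₀ → e₁ ≤ κ * s₁ → e ≤ κ * x) ∧ x - e / 2 ≤ τ ∧
      α + β * x ≤ pairRate τ x e - rate τ := by
  have hd : 0 < s₁ - s₀ := by linarith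
  obtain ⟨a, b, ha, hb, hab, rfl⟩ : ∃ a b : ℝ, 0 ≤ a ∧ 0 ≤ b ∧ a + b = 1 ∧ x = a * s₀ + b * s₁ :=
    ⟨(s₁ - x) / (s₁ - s₀), (x - s₀) / (s₁ - s₀), div_nonneg (by linarith) hd.le,
      div_nonneg (by linarith) hd.le, by field_simp; ring, by field_simp; ring⟩
  refine ⟨a * e₀ + b * e₁, by positivity, ?_, ?_, ?_⟩
  · intro κ k₀ k₁
    calc a * e₀ + b * e₁ ≤ a * (κ * s₀) + b * (κ * s₁) :=
          add_le_add (mul_le_mul_of_nonneg_left k₀ ha) (mul_le_mul_of_nonneg_left k₁ hb)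
      _ = _ := by ring
  · have k1 := mul_le_mul_of_nonneg_left h₀'' ha
    have k2 := mul_le_mul_of_nonneg_left h₁'' hb
    have : a * τ + b * τ = τ := by rw [← add_mul, hab, one_mul]
    linarith
  · have c1 := mix_concave h₀ (sub_nonneg.mpr h₀') h₁ (sub_nonneg.mpr h₁') ha hb
    have c2 := mix_concave (x := τ - s₀ + e₀ / 2) (y := 1 - τ - e₀ / 2)
      (x' := τ - s₁ + e₁ / 2) (y' := 1 - τ - e₁ / 2) (by linarith) (by linarith) (by linarith)
      (by linarith) ha hb
    obtain rfl : b = 1 - a := by linarith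
    have m1 : a * (s₀ - e₀) + (1 - a) * (s₁ - e₁) = a * s₀ + (1 - a) * s₁ - (a * e₀ + (1 - a) * e₁) := by ring
    have m2 : a * (τ - s₀ + e₀ / 2) + (1 - a) * (τ - s₁ + e₁ / 2) =
        τ - (a * s₀ + (1 - a) * s₁) + (a * e₀ + (1 - a) * e₁) / 2 := by ring
    have m3 : a * (1 - τ - e₀ / 2) + (1 - a) * (1 - τ - e₁ / 2) =
        1 - τ - (a * e₀ + (1 - a) * e₁) / 2 := by ring
    rw [m1] at c1
    rw [m2, m3] at c2
    have k1 := mul_le_mul_of_nonneg_left hL₀ ha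
    have k2 := mul_le_mul_of_nonneg_left hL₁ hb
    unfold pairRate at *
    linarith

/-- The exponent at a rational point, as the logarithm of a quotient of integers. -/
theorem mul_pairRate_sub_rate (T T' S A B W R : ℕ) (h1 : S = 2 * A + B) (h2 : T + A = W + S)
    (h3 : T' = R + A) (hN : 0 < T + T') :
    ((T + T' : ℕ) : ℝ) * (pairRate (T / (T + T' : ℕ)) (S / (T + T' : ℕ)) ((2 * A : ℕ) / (T + T' : ℕ)) +
      rate (T / (T + T' : ℕ))) =
    log (2 ^ S * S ^ S * (W + R) ^ (W + R) * 3 ^ W * ((T + T') ^ (T + T') * 3 ^ T)) -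
      log ((2 * A) ^ (2 * A) * B ^ B * (W ^ W * R ^ R) * (T ^ T * T' ^ T')) ∧
    ((T + T' : ℕ) : ℝ) * (pairRate (T / (T + T' : ℕ)) (S / (T + T' : ℕ)) ((2 * A : ℕ) / (T + T' : ℕ)) -
      rate (T / (T + T' : ℕ))) =
    log (2 ^ S * S ^ S * (W + R) ^ (W + R) * 3 ^ W * (T ^ T * T' ^ T')) -
      log ((2 * A) ^ (2 * A) * B ^ B * (W ^ W * R ^ R) * ((T + T') ^ (T + T') * 3 ^ T)) := by
  have hpos : ∀ m : ℕ, (m : ℝ) ^ m ≠ 0 := by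
    intro m
    rcases Nat.eq_zero_or_pos m with rfl | h
    · simp
    · positivity
  have hmix : ∀ a b : ℕ, mix a b = log (((a + b : ℕ) : ℝ) ^ (a + b)) - log ((a : ℝ) ^ a) -
      log ((b : ℝ) ^ b) := by
    intro a b
    unfold mix negMulLog
    simp only [log_pow]
    push_cast
    ring
  set N := T + T' with hNdef
  have hN' : (N : ℝ) ≠ 0 := by positivity
  have c1 : (S : ℝ) = 2 * A + B := by exact_mod_cast h1
  have c2 : (T : ℝ) + A = W + S := by exact_mod_cast h2
  have c3 : (T' : ℝ) = R + A := by exact_mod_cast h3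
  have c4 : (N : ℝ) = T + T' := by exact_mod_cast hNdef
  have r1 : (N : ℝ) * pairRate (T / N) (S / N) ((2 * A : ℕ) / N) =
      S * log 2 + mix ((2 * A : ℕ) : ℝ) B + mix W R + W * log 3 := by
    unfold pairRate
    rw [mul_add, mul_add, mul_add, ← mix_homogeneous, ← mix_homogeneous]
    have f1 : (N : ℝ) * ((2 * A : ℕ) / N) = (2 * A : ℕ) := by field_simp
    have f2 : (N : ℝ) * (S / N - (2 * A : ℕ) / N) = B := by field_simp; push_cast; linarith
    have f3 : (N : ℝ) * (T / N - S / N + (2 * A : ℕ) / N / 2) = W := by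
      field_simp; push_cast; linarith
    have f4 : (N : ℝ) * (1 - T / N - (2 * A : ℕ) / N / 2) = R := by
      field_simp; push_cast; linarith
    rw [f1, f2, f3, f4, ← mul_assoc, ← mul_assoc, f3]
    congr 3
    field_simp
  have r2 : (N : ℝ) * rate (T / N) = mix T T' + T * log 3 := by
    unfold rate
    rw [mul_add, ← mix_homogeneous]
    have f1 : (N : ℝ) * (T / N) = T := by field_simp
    have f2 : (N : ℝ) * (1 - T / N) = T' := by field_simp; linarith
    rw [← mul_assoc, f1, f2]
  have p2 : ((2 : ℝ) * A) ^ (2 * A) ≠ 0 := by exact_mod_cast hpos (2 * A)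
  have p3 : ((W : ℝ) + R) ^ (W + R) ≠ 0 := by exact_mod_cast hpos (W + R)
  have p4 : ((T : ℝ) + T') ^ (T + T') ≠ 0 := by exact_mod_cast hpos (T + T')
  have q2 : (2 : ℝ) ^ S ≠ 0 := by positivity
  have q3 : ∀ m : ℕ, (3 : ℝ) ^ m ≠ 0 := fun m => by positivity
  have key : S * log 2 + mix ((2 * A : ℕ) : ℝ) B + mix W R + W * log 3 =
      log (2 ^ S * S ^ S * (W + R) ^ (W + R) * 3 ^ W) -
        log ((2 * A) ^ (2 * A) * B ^ B * (W ^ W * R ^ R)) := by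
    rw [hmix, hmix, ← h1]
    push_cast
    rw [log_mul (mul_ne_zero (mul_ne_zero q2 (hpos S)) p3) (q3 W),
      log_mul (mul_ne_zero q2 (hpos S)) p3, log_mul q2 (hpos S),
      log_mul (mul_ne_zero p2 (hpos B)) (mul_ne_zero (hpos W) (hpos R)), log_mul p2 (hpos B),
      log_mul (hpos W) (hpos R), log_pow 2, log_pow 3]
    ring
  have key2 : mix (T : ℝ) T' + T * log 3 =
      log ((T + T') ^ (T + T') * 3 ^ T) - log (T ^ T * T' ^ T') := by
    rw [hmix]
    push_cast
    rw [log_mul p4 (q3 T), log_mul (hpos T) (hpos T'), log_pow 3]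
    ring
  have n1 : (2 : ℝ) ^ S * S ^ S * (W + R) ^ (W + R) * 3 ^ W ≠ 0 :=
    mul_ne_zero (mul_ne_zero (mul_ne_zero q2 (hpos S)) p3) (q3 W)
  have n2 : ((2 : ℝ) * A) ^ (2 * A) * B ^ B * (W ^ W * R ^ R) ≠ 0 :=
    mul_ne_zero (mul_ne_zero p2 (hpos B)) (mul_ne_zero (hpos W) (hpos R))
  have n3 : ((T : ℝ) + T') ^ (T + T') * 3 ^ T ≠ 0 := mul_ne_zero p4 (q3 T)
  have n4 : (T : ℝ) ^ T * T' ^ T' ≠ 0 := mul_ne_zero (hpos T) (hpos T')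
  constructor
  · rw [mul_add, r1, r2, key, key2, log_mul n1 n3, log_mul n2 n4]; ring
  · rw [mul_sub, r1, r2, key, key2, log_mul n1 n4, log_mul n2 n3]; ring

end

/-! ### Numerical comparison of the Krawtchouk and pair exponents. -/

section

open Real

/-- Comparison of the two exponents at a rational point, as an inequality between integers. -/
theorem saddle_node {s e z : ℝ} (T T' S A B W R p m : ℕ) (hs : s = S / (T + T' : ℕ))
    (he : e = (2 * A : ℕ) / (T + T' : ℕ)) (hz : z = p / (p + m : ℕ)) (h1 : S = 2 * A + B)
    (h2 : T + A = W + S) (h3 : T' = R + A) (hT : (19 / 100 : ℝ) = T / (T + T' : ℕ)) (hp : 0 < p)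
    (hm : 0 < m)
    (key : (4 * p + m) ^ (2 * (W + R)) * m ^ (2 * S) * (p + m) ^ (2 * T) *
        ((2 * A) ^ (2 * A) * B ^ B * (W ^ W * R ^ R) * (T ^ T * T' ^ T')) ≤
      2 ^ S * S ^ S * (W + R) ^ (W + R) * 3 ^ W * ((T + T') ^ (T + T') * 3 ^ T) *
        ((p + m) ^ (2 * (T + T')) * p ^ (2 * T))) :
    2 * saddleLine z s ≤ pairRate (19 / 100) s e - rate (19 / 100) := by
  have hN : 0 < T + T' := by
    by_contra h
    have : T + T' = 0 := by omega
    rw [this] at hT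
    norm_num at hT
  have hN' : (0 : ℝ) < (T + T' : ℕ) := by exact_mod_cast hN
  obtain ⟨h4, -⟩ := mul_pairRate_sub_rate T T' S A B W R h1 h2 h3 hN
  rw [← hs, ← he, ← hT] at h4
  have hp' : (0 : ℝ) < p := by exact_mod_cast hp
  have hm' : (0 : ℝ) < m := by exact_mod_cast hm
  have hWR : ((T + T' : ℕ) : ℝ) = W + R + S := by exact_mod_cast (by omega : T + T' = W + R + S)
  have l1 : log (1 + 3 * z) = log (4 * p + m) - log (p + m) := by
    rw [← log_div (by positivity) (by positivity), hz]
    congr 1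
    push_cast
    field_simp
    ring
  have l2 : log (1 - z) = log m - log (p + m) := by
    rw [← log_div (by positivity) (by positivity), hz]
    congr 1
    push_cast
    field_simp
    ring
  have l3 : log z = log p - log (p + m) := by
    rw [← log_div (by positivity) (by positivity), hz]
    push_cast
    rfl
  -- Adding 2 · rate removes the rate contained in `saddleLine`, so the sum form of
  -- `mul_pairRate_sub_rate` is the one to compare with.
  have h5 : ((T + T' : ℕ) : ℝ) * (2 * saddleLine z s + 2 * rate (19 / 100)) =
      log ((4 * p + m) ^ (2 * (W + R)) * m ^ (2 * S) * (p + m) ^ (2 * T)) -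
        log ((p + m) ^ (2 * (T + T')) * p ^ (2 * T)) := by
    have g1 : ((T + T' : ℕ) : ℝ) * s = S := by rw [hs]; field_simp
    have g2 : ((T + T' : ℕ) : ℝ) * (19 / 100) = T := by rw [hT]; field_simp
    have hTT : (T : ℝ) + T' = W + R + S := by rw [← hWR]; push_cast; rfl
    rw [log_mul (by positivity) (by positivity), log_mul (by positivity) (by positivity),
      log_mul (by positivity) (by positivity), log_pow, log_pow, log_pow, log_pow, log_pow]
    unfold saddleLine
    rw [l1, l2, l3]
    push_cast
    push_cast at g1 g2 hWR
    rw [hTT] at g1 g2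
    rw [hTT]
    linear_combination (2 * (log m - log (p + m)) - 2 * (log (4 * p + m) - log (p + m))) * g1 -
      2 * (log p - log (p + m)) * g2
  have hposN : ∀ a : ℕ, (0 : ℝ) < (a : ℝ) ^ a := by
    intro a
    rcases Nat.eq_zero_or_pos a with rfl | h
    · simp
    · positivity
  have p2 : (0 : ℝ) < (2 * (A : ℝ)) ^ (2 * A) := by exact_mod_cast hposN (2 * A)
  have p3 : (0 : ℝ) < ((W : ℝ) + R) ^ (W + R) := by exact_mod_cast hposN (W + R)
  have p4 : (0 : ℝ) < ((T : ℝ) + T') ^ (T + T') := by exact_mod_cast hposN (T + T')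
  have q1 := hposN S
  have q2 := hposN B
  have q3 := hposN W
  have q4 := hposN R
  have q5 := hposN T
  have q6 := hposN T'
  have key' : log ((4 * p + m) ^ (2 * (W + R)) * m ^ (2 * S) * (p + m) ^ (2 * T) *
        ((2 * A) ^ (2 * A) * B ^ B * (W ^ W * R ^ R) * (T ^ T * T' ^ T'))) ≤
      log (2 ^ S * S ^ S * (W + R) ^ (W + R) * 3 ^ W * ((T + T') ^ (T + T') * 3 ^ T) *
        ((p + m) ^ (2 * (T + T')) * p ^ (2 * T))) := by
    refine log_le_log (by positivity) ?_
    exact_mod_cast key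
  rw [log_mul (by positivity) (by positivity), log_mul (x := 2 ^ S * _ * _ * _ * _)
    (by positivity) (by positivity)] at key'
  have h6 : ((T + T' : ℕ) : ℝ) * (2 * saddleLine z s + 2 * rate (19 / 100)) ≤
      ((T + T' : ℕ) : ℝ) * (pairRate (19 / 100) s e + rate (19 / 100)) := by
    rw [h4, h5]; linarith
  have := le_of_mul_le_mul_left h6 hN'
  linarith

set_option exponentiation.threshold 100000 in
/-- The pair exponent dominates twice the saddle-point exponent. -/
theorem exists_saddleLine_le_pairRate {x : ℝ} (h0 : 0 ≤ x) (h1 : x ≤ 3152 / 10 ^ 4) :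
    ∃ z, 19 / 243 ≤ z ∧ z ≤ 11 / 40 ∧ ∃ e, 0 ≤ e ∧ e ≤ x ∧ x - e / 2 ≤ 19 / 100 ∧
      2 * saddleLine z x ≤ pairRate (19 / 100) x e - rate (19 / 100) := by
  -- For fixed z the left side is affine in x, while the right side is jointly concave in (x, e), so
  -- two endpoint checks settle an interval. Each z below is a rational close to the saddle points
  -- of its interval.
  have seg : ∀ z s₀ e₀ s₁ e₁ : ℝ,
      2 * saddleLine z s₀ ≤ pairRate (19 / 100) s₀ e₀ - rate (19 / 100) →
      2 * saddleLine z s₁ ≤ pairRate (19 / 100) s₁ e₁ - rate (19 / 100) →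
      19 / 243 ≤ z ∧ z ≤ 11 / 40 →
      0 ≤ e₀ ∧ e₀ ≤ s₀ ∧ s₀ - e₀ / 2 ≤ 19 / 100 ∧ 19 / 100 + e₀ / 2 ≤ 1 →
      0 ≤ e₁ ∧ e₁ ≤ s₁ ∧ s₁ - e₁ / 2 ≤ 19 / 100 ∧ 19 / 100 + e₁ / 2 ≤ 1 →
      s₀ < s₁ → s₀ ≤ x → x ≤ s₁ →
      ∃ z, 19 / 243 ≤ z ∧ z ≤ 11 / 40 ∧ ∃ e, 0 ≤ e ∧ e ≤ x ∧ x - e / 2 ≤ 19 / 100 ∧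
        2 * saddleLine z x ≤ pairRate (19 / 100) x e - rate (19 / 100) := by
    rintro z s₀ e₀ s₁ e₁ hL₀ hL₁ ⟨hz0, hz1⟩ ⟨a1, a2, a3, a4⟩ ⟨b1, b2, b3, b4⟩ hs hx0 hx1
    have hline : ∀ y, 2 * saddleLine z y =
        2 * (log (1 + 3 * z) - 19 / 100 * log z - rate (19 / 100)) +
          2 * (log (1 - z) - log (1 + 3 * z)) * y := by
      intro y; unfold saddleLine; ring
    rw [hline] at hL₀ hL₁
    obtain ⟨e, c1, c2, c3, c4⟩ := pairRate_chord a1 a2 a3 a4 b1 b2 b3 b4 hL₀ hL₁ hx0 hx1 hs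
    exact ⟨z, hz0, hz1, e, c1, by linarith [c2 1 (by linarith) (by linarith)], c3, (hline x).trans_le c4⟩
  rcases le_total x (1 / 20) with h | h
  · exact seg (19 / 243) (0) (0) (1 / 20) (1 / 25)
      (saddle_node 38 162 0 0 0 38 162 19 224 (by norm_num) (by norm_num) (by norm_num) rfl rfl rfl
        (by norm_num) (by norm_num) (by norm_num) (by norm_num))
      (saddle_node 38 162 10 4 2 32 158 19 224 (by norm_num) (by norm_num) (by norm_num) rfl rfl rfl
        (by norm_num) (by norm_num) (by norm_num) (by norm_num))
      (by norm_num) (by norm_num) (by norm_num) (by norm_num) (by linarith) (by linarith)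
  rcases le_total x (3 / 20) with h | h
  · exact seg (3 / 32) (1 / 20) (1 / 25) (3 / 20) (3 / 25)
      (saddle_node 38 162 10 4 2 32 158 3 29 (by norm_num) (by norm_num) (by norm_num) rfl rfl rfl
        (by norm_num) (by norm_num) (by norm_num) (by norm_num))
      (saddle_node 38 162 30 12 6 20 150 3 29 (by norm_num) (by norm_num) (by norm_num) rfl rfl rfl
        (by norm_num) (by norm_num) (by norm_num) (by norm_num))
      (by norm_num) (by norm_num) (by norm_num) (by norm_num) (by linarith) (by linarith)
  rcases le_total x (11 / 50) with h | h
  · exact seg (4 / 33) (3 / 20) (3 / 25) (11 / 50) (19 / 100)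
      (saddle_node 38 162 30 12 6 20 150 4 29 (by norm_num) (by norm_num) (by norm_num) rfl rfl rfl
        (by norm_num) (by norm_num) (by norm_num) (by norm_num))
      (saddle_node 38 162 44 19 6 13 143 4 29 (by norm_num) (by norm_num) (by norm_num) rfl rfl rfl
        (by norm_num) (by norm_num) (by norm_num) (by norm_num))
      (by norm_num) (by norm_num) (by norm_num) (by norm_num) (by linarith) (by linarith)
  rcases le_total x (13 / 50) with h | h
  · exact seg (8 / 53) (11 / 50) (19 / 100) (13 / 50) (23 / 100)
      (saddle_node 38 162 44 19 6 13 143 8 45 (by norm_num) (by norm_num) (by norm_num) rfl rfl rfl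
        (by norm_num) (by norm_num) (by norm_num) (by norm_num))
      (saddle_node 38 162 52 23 6 9 139 8 45 (by norm_num) (by norm_num) (by norm_num) rfl rfl rfl
        (by norm_num) (by norm_num) (by norm_num) (by norm_num))
      (by norm_num) (by norm_num) (by norm_num) (by norm_num) (by linarith) (by linarith)
  rcases le_total x (7 / 25) with h | h
  · exact seg (9 / 52) (13 / 50) (23 / 100) (7 / 25) (1 / 4)
      (saddle_node 38 162 52 23 6 9 139 9 43 (by norm_num) (by norm_num) (by norm_num) rfl rfl rfl
        (by norm_num) (by norm_num) (by norm_num) (by norm_num))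
      (saddle_node 38 162 56 25 6 7 137 9 43 (by norm_num) (by norm_num) (by norm_num) rfl rfl rfl
        (by norm_num) (by norm_num) (by norm_num) (by norm_num))
      (by norm_num) (by norm_num) (by norm_num) (by norm_num) (by linarith) (by linarith)
  rcases le_total x (29 / 100) with h | h
  · exact seg (10 / 53) (7 / 25) (1 / 4) (29 / 100) (13 / 50)
      (saddle_node 38 162 56 25 6 7 137 10 43 (by norm_num) (by norm_num) (by norm_num) rfl rfl rfl
        (by norm_num) (by norm_num) (by norm_num) (by norm_num))
      (saddle_node 38 162 58 26 6 6 136 10 43 (by norm_num) (by norm_num) (by norm_num) rfl rfl rfl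
        (by norm_num) (by norm_num) (by norm_num) (by norm_num))
      (by norm_num) (by norm_num) (by norm_num) (by norm_num) (by linarith) (by linarith)
  rcases le_total x (3 / 10) with h | h
  · exact seg (1 / 5) (29 / 100) (13 / 50) (3 / 10) (27 / 100)
      (saddle_node 38 162 58 26 6 6 136 1 4 (by norm_num) (by norm_num) (by norm_num) rfl rfl rfl
        (by norm_num) (by norm_num) (by norm_num) (by norm_num))
      (saddle_node 38 162 60 27 6 5 135 1 4 (by norm_num) (by norm_num) (by norm_num) rfl rfl rfl
        (by norm_num) (by norm_num) (by norm_num) (by norm_num))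
      (by norm_num) (by norm_num) (by norm_num) (by norm_num) (by linarith) (by linarith)
  rcases le_total x (31 / 100) with h | h
  · exact seg (8 / 37) (3 / 10) (27 / 100) (31 / 100) (7 / 25)
      (saddle_node 38 162 60 27 6 5 135 8 29 (by norm_num) (by norm_num) (by norm_num) rfl rfl rfl
        (by norm_num) (by norm_num) (by norm_num) (by norm_num))
      (saddle_node 38 162 62 28 6 4 134 8 29 (by norm_num) (by norm_num) (by norm_num) rfl rfl rfl
        (by norm_num) (by norm_num) (by norm_num) (by norm_num))
      (by norm_num) (by norm_num) (by norm_num) (by norm_num) (by linarith) (by linarith)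
  -- The endpoint 0.3152 = 788/2500 is not a multiple of 1/200, hence the larger denominator.
  exact seg (11 / 47) (31 / 100) (7 / 25) (197 / 625) (359 / 1250)
      (saddle_node 38 162 62 28 6 4 134 11 36 (by norm_num) (by norm_num) (by norm_num) rfl rfl rfl
        (by norm_num) (by norm_num) (by norm_num) (by norm_num))
      (saddle_node 475 2025 788 359 70 46 1666 11 36 (by norm_num) (by norm_num) (by norm_num) rfl rfl rfl
        (by norm_num) (by norm_num) (by norm_num) (by norm_num))
      (by norm_num) (by norm_num) (by norm_num) (by norm_num) (by linarith) (by linarith)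

/-- The pair exponent at relative weight one half dominates the crude bound on the Krawtchouk
polynomials. -/
theorem log_three_le_pairRate {x : ℝ} (h0 : 0 ≤ x) (h1 : x ≤ 1 / 10) :
    ∃ e, 0 ≤ e ∧ e ≤ x ∧ x - e / 2 ≤ 1 / 2 ∧ e / 2 ≤ x * (1 - 3 / 4) ∧
      -2 * log 3 * x ≤ pairRate (1 / 2) x e - rate (1 / 2) := by
  have hnode : -2 * log 3 * (1 / 10) ≤ pairRate (1 / 2) (1 / 10) (1 / 20) - rate (1 / 2) := by
    obtain ⟨-, h⟩ := mul_pairRate_sub_rate 20 20 4 1 2 17 19 rfl rfl rfl (by norm_num)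
    have hle : log (2 ^ (2 * 1) * (2 ^ 2) * (17 ^ 17 * 19 ^ 19) * ((20 + 20) ^ (20 + 20) * 3 ^ 20)) ≤
        log (2 ^ 4 * 4 ^ 4 * (17 + 19) ^ (17 + 19) * 3 ^ 17 * (20 ^ 20 * 20 ^ 20)) + 8 * log 3 := by
      rw [show (8 : ℝ) * log 3 = log (3 ^ 8) by rw [log_pow]; norm_num,
        ← log_mul (by positivity) (by positivity)]
      exact log_le_log (by positivity) (by norm_num)
    norm_num at h hle ⊢
    linarith
  have hzero : pairRate (1 / 2) 0 0 - rate (1 / 2) = 0 := by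
    unfold pairRate rate
    simp [mix_zero_left]
  obtain ⟨e, c1, c2, c3, c4⟩ := pairRate_chord (τ := 1 / 2) (s₀ := 0) (e₀ := 0) (s₁ := 1 / 10)
    (e₁ := 1 / 20) (α := 0) (β := -2 * log 3) (x := x) (by norm_num) (by norm_num) (by norm_num)
    (by norm_num) (by norm_num) (by norm_num) (by norm_num) (by norm_num) (by linarith)
    (by linarith) h0 h1 (by norm_num)
  -- Both endpoints have e ≤ x/2, so e/2 ≤ x/4 throughout, as monotonicity up to relative weight 3/4
  -- requires.
  have := c2 (1 / 2) (by norm_num) (by norm_num)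
  exact ⟨e, c1, by linarith, c3, by linarith, by linarith⟩

end

/-! ### Krawtchouk bounds slightly past the region of positivity. -/

section

open Real

theorem lpGamma_mul_four (x : ℝ) : 4 * lpGamma x = 3 - 2 * x - 2 * √(3 * x * (1 - x)) := by
  unfold lpGamma; ring

/-- γ(x) is the relative degree at which the ratio quadratic 3(1−x)y² − (3 − 4τ − 2x)y + x has a
double root, at y = √(x/(3(1−x))). For smaller degrees this y still makes it nonpositive. -/
theorem KrawSeq.pos_of_le_lpGamma {n w : ℕ} {k : ℕ → ℝ} (hk : KrawSeq n w k) (hn : 0 < n) {x : ℝ}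
    (hx0 : 0 < x) (hx1 : x ≤ 3 / 4) (hw : (w : ℝ) ≤ lpGamma x * n) (i : ℕ) (hi : (i : ℝ) ≤ x * n) :
    0 < k i ∧ 0 < k (i + 1) := by
  have hn' : (0 : ℝ) < n := by exact_mod_cast hn
  set s := √(3 * x * (1 - x)) with hs
  have h1x : 0 < 1 - x := by linarith
  have hs2 : s * s = 3 * x * (1 - x) := mul_self_sqrt (by positivity)
  have hspos : 0 < s := sqrt_pos.mpr (by positivity)
  have hg := lpGamma_mul_four x
  rw [← hs] at hg
  have hsy : s * (s / (3 * (1 - x))) = x := by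
    rw [← mul_div_assoc, hs2]; field_simp
  have hyy : 3 * (1 - x) * (s / (3 * (1 - x))) ^ 2 = x := by
    rw [div_pow, sq, hs2]; field_simp
  suffices h : 0 < k i ∧ s / (3 * (1 - x)) * k i ≤ k (i + 1) from
    ⟨h.1, lt_of_lt_of_le (mul_pos (by positivity) h.1) h.2⟩
  refine hk.pos_of_quadratic (y := s / (3 * (1 - x))) (x := x * n) (by positivity) ?_
    (by nlinarith) ?_ i hi
  · rw [div_le_one (by positivity)]
    nlinarith
  · set y := s / (3 * (1 - x))
    have hy : 0 < y := by positivity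
    have h2 : 2 * s * n ≤ 3 * n - 4 * w - 2 * (x * n) := by
      have : 4 * (w : ℝ) ≤ 4 * lpGamma x * n := by linarith
      rw [hg] at this
      linarith
    have h3 := mul_le_mul_of_nonneg_right h2 hy.le
    have h4 : 3 * (n - x * n) * y ^ 2 = n * x := by
      calc 3 * (n - x * n) * y ^ 2 = n * (3 * (1 - x) * y ^ 2) := by ring
        _ = _ := by rw [hyy]
    have h5 : 2 * s * n * y = 2 * (n * x) := by
      calc 2 * s * n * y = 2 * n * (s * y) := by ring
        _ = _ := by rw [hsy]; ring
    rw [h4]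
    linarith

/-- An exponential upper bound for the normalised Krawtchouk polynomials, matched by the number of
pairs. -/
theorem exists_exponent {n w i : ℕ} (hn : 4 * 10 ^ 6 ≤ n) {x₀ η : ℝ} (hx0 : 0 < x₀)
    (hx1 : x₀ ≤ 3152 / 10 ^ 4) (hη0 : 0 ≤ η) (hη1 : η ≤ 1 / 100) (hw0 : 19004 / 10 ^ 5 * (n : ℝ) ≤ w)
    (hw1 : (w : ℝ) ≤ lpGamma x₀ * n) (hi : (i : ℝ) ≤ (x₀ + η) * n)
    (hi1 : (i : ℝ) ≤ 3152 / 10 ^ 4 * n) :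
    ∃ e, 0 ≤ e ∧ e ≤ (i : ℝ) / n ∧ (i : ℝ) / n - e / 2 ≤ w / n ∧
      |kraw n w i / shell n w| ^ 2 ≤
        exp (n * (pairRate (w / n) (i / n) e - rate (w / n)) + 8 * (η * n + 2)) := by
  have hn' : (4 * 10 ^ 6 : ℝ) ≤ n := by exact_mod_cast hn
  have hnpos : (0 : ℝ) < n := by linarith
  have hg4 := lpGamma_mul_four x₀
  have hsq := sqrt_nonneg (3 * x₀ * (1 - x₀))
  have hw34 : (w : ℝ) ≤ 3 / 4 * n := hw1.trans (mul_le_mul_of_nonneg_right (by linarith) hnpos.le)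
  have hwn : w ≤ n := by
    have : (w : ℝ) ≤ n := by linarith
    exact_mod_cast this
  have hk := krawSeq_kraw hwn
  set k : ℕ → ℝ := fun i => kraw n w i / shell n w with hkdef
  set I := ⌊x₀ * n⌋₊ with hI
  have hIle : (I : ℝ) ≤ x₀ * n := Nat.floor_le (by positivity)
  have hIlt : x₀ * n < I + 1 := Nat.lt_floor_add_one _
  set m := ⌈η * n⌉₊ with hm
  have hmle : η * n ≤ m := Nat.le_ceil _
  have hmlt : (m : ℝ) < η * n + 1 := Nat.ceil_lt_add_one (by positivity)
  have hpos' : ∀ j ≤ I, 0 < k j ∧ 0 < k (j + 1) := fun j hj =>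
    hk.pos_of_le_lpGamma (by omega) hx0 (by linarith) hw1 j
      (le_trans (by exact_mod_cast hj) hIle)
  have hpos : ∀ j ≤ I, 0 < k j := fun j hj => (hpos' j hj).1
  have hI1 : (I : ℝ) ≤ 3152 / 10 ^ 4 * n :=
    hIle.trans (mul_le_mul_of_nonneg_right hx1 hnpos.le)
  have hIm : 2 * (I + m) ≤ n := by
    have : 2 * ((I : ℝ) + m) ≤ n := by nlinarith
    exact_mod_cast this
  have hiI : i ≤ I + m + 1 := by
    have : (i : ℝ) ≤ I + m + 1 := by linarith
    exact_mod_cast this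
  have hImn : I < n := by
    have : (I : ℝ) < n := by linarith
    exact_mod_cast this
  have hext : ∀ A β : ℝ, β ≤ 0 → -2 ≤ β → (∀ j ≤ I + 1, |k j| ≤ exp (A + β * j)) →
      |k i| ^ 2 ≤ exp (2 * (A + β * i) + 8 * (η * n + 2)) := by
    intro A β h1 h2 h3
    have h4 := hk.abs_le_exp hwn h1 h2 h3 m i hiI hIm
    calc |k i| ^ 2 ≤ exp (A + β * i + 4 * (m + 1)) ^ 2 := by gcongr
      _ = exp (2 * (A + β * i) + 8 * (m + 1)) := by
          rw [← exp_nat_mul]; congr 1; push_cast; ring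
      _ ≤ _ := exp_le_exp.mpr (by linarith)
  have hsub : ∀ B : ℕ → ℝ, (∀ j ≤ I + 1, k j ≤ exp (B j)) → 0 ≤ k (I + 1) →
      ∀ j ≤ I + 1, |k j| ≤ exp (B j) := by
    intro B hB h0 j hj
    rw [abs_of_nonneg]
    · exact hB j hj
    · rcases hj.eq_or_lt with h | h
      · rw [h]; exact h0
      · exact (hpos j (by omega)).le
  have hlast0 : 0 ≤ k (I + 1) := (hpos' I le_rfl).2.le
  have hwdiv : 19004 / 10 ^ 5 ≤ (w : ℝ) / n := by rw [le_div_iff₀ hnpos]; linarith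
  have hwdiv34 : (w : ℝ) / n ≤ 3 / 4 := by rw [div_le_iff₀ hnpos]; linarith
  have hidiv : (i : ℝ) / n ≤ 3152 / 10 ^ 4 := by rw [div_le_iff₀ hnpos]; linarith
  have hidiv0 : (0 : ℝ) ≤ i / n := by positivity
  -- Up to degree n/2, e ≤ x is enough to compare with degree 0.19. Beyond it monotonicity needs
  -- smaller e, so the comparison starts at 1/2 instead; γ(x₀) ≥ 1/2 then forces x₀ ≤ 0.09, where
  -- the crude bound 3^(−i) is good enough.
  rcases le_total (2 * w) n with h2w | h2w
  · have hwdiv2 : (w : ℝ) / n ≤ 1 / 2 := by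
      have : 2 * (w : ℝ) ≤ n := by exact_mod_cast h2w
      rw [div_le_iff₀ hnpos]; linarith
    obtain ⟨z, hz0, hz1, e, he0, he1, he2, he3⟩ := exists_saddleLine_le_pairRate hidiv0 hidiv
    have hmono := pairRate_sub_rate_mono (x := i / n) (e := e) (τ := 19 / 100) (τ' := w / n) he0
      (by norm_num) (by linarith) (by linarith) he2 (by
        have := mul_le_mul_of_nonneg_left (by linarith : (1 / 2 : ℝ) ≤ 1 - w / n) hidiv0
        linarith)
    refine ⟨e, he0, he1, by linarith, ?_⟩
    have hline : ∀ j : ℕ, n * saddleLine z (j / n) =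
        n * (log (1 + 3 * z) - 19 / 100 * log z - rate (19 / 100)) +
          (log (1 - z) - log (1 + 3 * z)) * j := by
      intro j; unfold saddleLine; field_simp; ring
    have hl1 : log (1 + 3 * z) ≤ 3 * z := by
      have := log_le_sub_one_of_pos (by linarith : 0 < 1 + 3 * z); linarith
    have hl2 : 0 ≤ log (1 + 3 * z) := log_nonneg (by linarith)
    have hl3 : log (1 - z) ≤ 0 := log_nonpos (by linarith) (by linarith)
    have hl4 : -1 ≤ log (1 - z) := by
      have h5 := one_sub_inv_le_log_of_pos (by linarith : 0 < 1 - z)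
      have h6 : (1 - z)⁻¹ ≤ 2 := by
        rw [inv_le_comm₀ (by linarith) (by norm_num)]; linarith
      linarith
    have hb := hsub (fun j => n * saddleLine z (j / n)) (fun j hj =>
      hk.le_exp_saddleLine hn hw0 I hI1 hpos j hj hz0 hz1) hlast0
    simp only [hline] at hb
    have := hext _ _ (by linarith) (by linarith) hb
    refine this.trans (exp_le_exp.mpr ?_)
    rw [← hline]
    have := mul_le_mul_of_nonneg_left (he3.trans hmono) hnpos.le
    linarith
  · have hwdiv2 : 1 / 2 ≤ (w : ℝ) / n := by
      have : (n : ℝ) ≤ 2 * w := by exact_mod_cast h2w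
      rw [le_div_iff₀ hnpos]; linarith
    have hx09 : x₀ ≤ 9 / 100 := by
      by_contra hcon
      have hcon' : 9 / 100 < x₀ := not_le.mp hcon
      have hg : 1 / 2 ≤ lpGamma x₀ := by
        refine hwdiv2.trans ?_
        rw [div_le_iff₀ hnpos]; exact hw1
      have : (49 / 100 : ℝ) ≤ √(3 * x₀ * (1 - x₀)) := by
        apply le_sqrt_of_sq_le; nlinarith
      linarith
    have hi10 : (i : ℝ) / n ≤ 1 / 10 := by
      rw [div_le_iff₀ hnpos]
      refine hi.trans (mul_le_mul_of_nonneg_right (by linarith) hnpos.le)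
    obtain ⟨e, he0, he1, he2, he3, he4⟩ := log_three_le_pairRate hidiv0 hi10
    have hmono := pairRate_sub_rate_mono (x := i / n) (e := e) (τ := 1 / 2) (τ' := w / n) he0
      (by norm_num) (by linarith) (by linarith) he2 (by
        have := mul_le_mul_of_nonneg_left (by linarith : (1 - 3 / 4 : ℝ) ≤ 1 - w / n) hidiv0
        linarith)
    refine ⟨e, he0, he1, by linarith, ?_⟩
    have hb := hsub (fun j => 0 + -log 3 * j) (fun j hj => by
      rw [zero_add]; exact hk.le_exp_log_three h2w I hImn hpos j hj) hlast0
    have hl3 : 0 ≤ log 3 := log_nonneg (by norm_num)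
    have hl3' : log 3 ≤ 2 := by
      have := log_le_sub_one_of_pos (by norm_num : (0 : ℝ) < 3); linarith
    have := hext _ _ (by linarith) (by linarith) hb
    refine this.trans (exp_le_exp.mpr ?_)
    have h5 := mul_le_mul_of_nonneg_left (he4.trans hmono) hnpos.le
    have h6 : (n : ℝ) * (-2 * log 3 * (i / n)) = 2 * (-log 3 * i) := by field_simp
    rw [h6] at h5
    linarith

end

/-! ### The uniform Krawtchouk estimate and properties of γ. -/

section

open Real Filter

theorem eventually_log_le {ε : ℝ} (hε : 0 < ε) : ∀ᶠ n : ℕ in atTop, log (n + 1) ≤ ε * n := by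
  have h1 := (isLittleO_log_id_atTop.def (half_pos hε))
  have h2 : Tendsto (fun n : ℕ => (n : ℝ) + 1) atTop atTop :=
    tendsto_atTop_add_const_right _ _ tendsto_natCast_atTop_atTop
  filter_upwards [h2.eventually h1, eventually_ge_atTop 1] with n hn hn1
  have hn1' : (1 : ℝ) ≤ n := by exact_mod_cast hn1
  have h3 := (le_abs_self _).trans hn
  simp only [id, norm_eq_abs] at h3
  rw [abs_of_nonneg (by linarith : (0 : ℝ) ≤ n + 1)] at h3
  nlinarith

theorem eventually_le_natCast (C : ℝ) : ∀ᶠ n : ℕ in atTop, C ≤ n :=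
  tendsto_natCast_atTop_atTop.eventually_ge_atTop C

/-- Up to a subexponential factor, the square of a Krawtchouk polynomial before its first zero is
at most the size of the sphere times the number of pairs. -/
theorem exists_kraw_sq_le {ε : ℝ} (hε : 0 < ε) : ∃ η₀ > 0, ∀ η, 0 < η → η ≤ η₀ →
    ∀ᶠ n : ℕ in atTop, ∀ (x₀ : ℝ) (w : ℕ) (σ : Fin n → Pauli), 0 < x₀ → x₀ ≤ 3152 / 10 ^ 4 →
      19004 / 10 ^ 5 * (n : ℝ) ≤ w → (w : ℝ) ≤ lpGamma x₀ * n → (wt σ : ℝ) ≤ (x₀ + η) * n →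
      (wt σ : ℝ) ≤ 3152 / 10 ^ 4 * n →
      kraw n w (wt σ) ^ 2 ≤ exp (ε * n) * shell n w * pairCount σ w := by
  have hcomp : IsCompact (Set.Icc (0 : ℝ) 1 ×ˢ Set.Icc (0 : ℝ) 1 ×ˢ Set.Icc (0 : ℝ) 1) :=
    isCompact_Icc.prod (isCompact_Icc.prod isCompact_Icc)
  have huc := hcomp.uniformContinuousOn_of_continuous continuous_pairRate.continuousOn
  obtain ⟨μ, hμ, hclose⟩ := Metric.uniformContinuousOn_iff.mp huc (ε / 4) (by positivity)
  refine ⟨min (1 / 100) (ε / 32), by positivity, fun η hη0 hη1 => ?_⟩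
  filter_upwards [eventually_ge_atTop (4 * 10 ^ 6), eventually_le_natCast (64 / ε),
    eventually_le_natCast (4 / μ), eventually_log_le (show 0 < ε / 12 by positivity)]
    with n hn hn1 hn2 hn3 x₀ w σ hx0 hx1 hw0 hw1 hi hi1
  have hn' : (4 * 10 ^ 6 : ℝ) ≤ n := by exact_mod_cast hn
  have hnpos : (0 : ℝ) < n := by linarith
  obtain ⟨e, he0, he1, he2, hk⟩ := exists_exponent hn hx0 hx1 hη0.le
    (hη1.trans (min_le_left _ _)) hw0 hw1 hi hi1
  set i := wt σ
  have hsq := sqrt_nonneg (3 * x₀ * (1 - x₀))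
  have hg4 := lpGamma_mul_four x₀
  have hw34 : (w : ℝ) ≤ 3 / 4 * n := hw1.trans (mul_le_mul_of_nonneg_right (by linarith) hnpos.le)
  have hwn : w ≤ n := by
    have : (w : ℝ) ≤ n := by linarith
    exact_mod_cast this
  -- The balanced fraction must be an even number of coordinates; rounding moves it by at most 2/n,
  -- which uniform continuity of `pairRate` absorbs.
  set a := ⌊e * n / 2⌋₊ with ha
  have ha1 : (a : ℝ) ≤ e * n / 2 := Nat.floor_le (by positivity)
  have ha2 : e * n / 2 < a + 1 := Nat.lt_floor_add_one _
  have hen : e * n ≤ i := by rwa [le_div_iff₀ hnpos] at he1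
  have h2a : 2 * a ≤ i := by
    have : 2 * (a : ℝ) ≤ i := by linarith
    exact_mod_cast this
  have hiwa : i ≤ w + a := by
    have h1 : i - w ≤ a := by
      refine Nat.le_floor ?_
      rcases le_total i w with h | h
      · rw [Nat.sub_eq_zero_of_le h]; push_cast; positivity
      · rw [Nat.cast_sub h]
        have h2 := mul_le_mul_of_nonneg_right he2 hnpos.le
        have h3 : ((i : ℝ) / n - e / 2) * n = i - e * n / 2 := by field_simp
        have h4 : (w : ℝ) / n * n = w := by field_simp
        linarith
    omega
  have hwan : w + a ≤ n := by
    have : (w : ℝ) + a ≤ n := by linarith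
    exact_mod_cast this
  have hcount := exp_pairRate_le_pairCount (by omega) σ hwan h2a hiwa
  have hwdiv : (w : ℝ) / n ≤ 1 := by rw [div_le_one hnpos]; linarith
  have hidiv : (i : ℝ) / n ≤ 1 := by rw [div_le_one hnpos]; linarith
  have he1' : e ≤ 1 := he1.trans hidiv
  have h2adiv : ((2 * a : ℕ) : ℝ) / n ≤ 1 := by
    rw [div_le_one hnpos]; push_cast; linarith
  have hdist := hclose (w / n, i / n, (2 * a : ℕ) / n)
    ⟨⟨by positivity, hwdiv⟩, ⟨by positivity, hidiv⟩, ⟨by positivity, h2adiv⟩⟩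
    (w / n, i / n, e) ⟨⟨by positivity, hwdiv⟩, ⟨by positivity, hidiv⟩, ⟨he0, he1'⟩⟩ (by
      rw [Prod.dist_eq, Prod.dist_eq, dist_self, dist_self, dist_eq]
      have h1 : |((2 * a : ℕ) : ℝ) / n - e| ≤ 2 / n := by
        rw [abs_le]
        constructor
        · rw [le_sub_iff_add_le, le_div_iff₀ hnpos]
          push_cast
          have : (-(2 / (n : ℝ)) + e) * n = e * n - 2 := by field_simp; ring
          linarith
        · rw [sub_le_iff_le_add, div_le_iff₀ hnpos]
          push_cast
          have : (2 / (n : ℝ) + e) * n = 2 + e * n := by field_simp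
          linarith
      have h2 : 2 / (n : ℝ) < μ := by
        rw [div_le_iff₀ hμ] at hn2
        rw [div_lt_iff₀ hnpos]
        linarith
      exact max_lt hμ (max_lt hμ (h1.trans_lt h2)))
  rw [dist_eq] at hdist
  have hpr := (abs_lt.mp hdist).1
  simp only at hpr
  have hs := shell_pos hwn
  have hshell : shell n w ≤ exp (n * rate (w / n)) := by
    refine shell_le_exp ?_ ?_ ?_
    · exact div_pos (by nlinarith) hnpos
    · rw [div_le_iff₀ hnpos]; linarith
    · rw [div_mul_cancel₀ _ hnpos.ne']
  have hlog : ((n : ℝ) + 1) ^ 3 ≤ exp (ε * n / 4) := by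
    calc ((n : ℝ) + 1) ^ 3 = exp (3 * log (n + 1)) := by
          rw [show (3 : ℝ) = (3 : ℕ) by norm_num, exp_nat_mul, exp_log (by positivity)]
      _ ≤ _ := exp_le_exp.mpr (by linarith)
  have hη2 : η ≤ ε / 32 := hη1.trans (min_le_right _ _)
  have hεn : 64 ≤ ε * n := by rw [div_le_iff₀ hε] at hn1; linarith
  have hkr : kraw n w i ^ 2 = shell n w ^ 2 * |kraw n w i / shell n w| ^ 2 := by
    rw [sq_abs, div_pow]; field_simp
  rw [hkr]
  calc shell n w ^ 2 * |kraw n w i / shell n w| ^ 2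
      ≤ (shell n w * exp (n * rate (w / n))) *
          exp (n * (pairRate (w / n) (i / n) e - rate (w / n)) + 8 * (η * n + 2)) := by
        refine mul_le_mul ?_ hk (by positivity) (by positivity)
        rw [sq]; exact mul_le_mul_of_nonneg_left hshell hs.le
    _ = shell n w * exp (n * pairRate (w / n) (i / n) e + 8 * (η * n + 2)) := by
        rw [mul_assoc, ← exp_add]; congr 2; ring
    -- The three quarters of ε pay for the rounding, for 8ηn and for the constant 16. The fourth
    -- pays for (n + 1)³.
    _ ≤ shell n w * exp (3 * (ε * n / 4) + n * pairRate (w / n) (i / n) ((2 * a : ℕ) / n)) := by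
        refine mul_le_mul_of_nonneg_left (exp_le_exp.mpr ?_) hs.le
        have h1 := mul_le_mul_of_nonneg_left hpr.le hnpos.le
        have h2 := mul_le_mul_of_nonneg_right hη2 hnpos.le
        linarith
    _ = shell n w * (exp (3 * (ε * n / 4)) *
          exp (n * pairRate (w / n) (i / n) ((2 * a : ℕ) / n))) := by rw [exp_add]
    _ ≤ shell n w * (exp (3 * (ε * n / 4)) * (exp (ε * n / 4) * pairCount σ w)) := by
        refine mul_le_mul_of_nonneg_left (mul_le_mul_of_nonneg_left (hcount.trans ?_)
          (exp_pos _).le) hs.le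
        exact mul_le_mul_of_nonneg_right hlog (Nat.cast_nonneg _)
    _ = _ := by
        rw [← mul_assoc (exp _), ← exp_add]
        rw [show 3 * (ε * n / 4) + ε * n / 4 = ε * n by ring]; ring

/-- Strict monotonicity, with a modulus, of the largest eigenvalue of a Hamming ball. -/
theorem eigenvalue_gap {δ x h : ℝ} (hδ0 : 0 ≤ δ) (hδ1 : δ ≤ 3 / 4) (hh : 0 ≤ h)
    (hx : lpGamma δ + h ≤ x) (hx1 : x ≤ 3 / 4) :
    3 - 4 * δ + 3 * h ^ 2 / 4 ≤ 2 * x + 2 * √(3 * x * (1 - x)) := by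
  set a := √δ
  set b := √(1 - δ)
  set t := √(3 : ℝ)
  have ha : a ^ 2 = δ := sq_sqrt hδ0
  have hb : b ^ 2 = 1 - δ := sq_sqrt (by linarith)
  have ht : t ^ 2 = 3 := sq_sqrt (by norm_num)
  have ha0 : 0 ≤ a := sqrt_nonneg _
  have hb0 : 0 ≤ b := sqrt_nonneg _
  have ht0 : 0 ≤ t := sqrt_nonneg _
  -- With δ = sin²θ this says γ(δ) = sin²(60° − θ). The same identity at x reads 3 − 2x −
  -- 2√(3x(1−x)) = (√3 q − p)², so the claim becomes (√3 q − p)² + 3h²/4 ≤ 4δ.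
  have hγ : 4 * lpGamma δ = (t * b - a) ^ 2 := by
    have : √(3 * δ * (1 - δ)) = t * a * b := by
      rw [sqrt_mul (by positivity), sqrt_mul (by norm_num)]
    rw [lpGamma_mul_four, this]
    linear_combination -b ^ 2 * ht - 3 * hb - ha
  have hγ0 : 0 ≤ lpGamma δ := by nlinarith [sq_nonneg (t * b - a)]
  have hx0 : 0 ≤ x := by linarith
  set p := √x
  set q := √(1 - x)
  have hp : p ^ 2 = x := sq_sqrt hx0
  have hq : q ^ 2 = 1 - x := sq_sqrt (by linarith)
  have hp0 : 0 ≤ p := sqrt_nonneg _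
  have hq0 : 0 ≤ q := sqrt_nonneg _
  have hpq : √(3 * x * (1 - x)) = t * p * q := by
    rw [sqrt_mul (by positivity), sqrt_mul (by norm_num)]
  rw [hpq]
  have htb : a ≤ t * b := by
    refine abs_le_of_sq_le_sq' ?_ (by positivity) |>.2
    rw [mul_pow, ha, hb, ht]; linarith
  have hptq : p ≤ t * q := by
    refine abs_le_of_sq_le_sq' ?_ (by positivity) |>.2
    rw [mul_pow, hp, hq, ht]; linarith
  have hp' : (t * b - a) / 2 ≤ p := by
    refine abs_le_of_sq_le_sq' ?_ hp0 |>.2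
    rw [div_pow, ← hγ, hp]; linarith
  have hq' : q + h / 2 ≤ (t * a + b) / 2 := by
    have h1 : ((t * a + b) / 2) ^ 2 = 1 - lpGamma δ := by
      have : (t * a + b) ^ 2 + (t * b - a) ^ 2 = 4 := by
        linear_combination (a ^ 2 + b ^ 2) * ht + 4 * ha + 4 * hb
      rw [div_pow]; linarith
    have h2 : q ^ 2 + h ≤ ((t * a + b) / 2) ^ 2 := by rw [h1, hq]; linarith
    have h3 : (t * a + b) / 2 ≤ 1 := by
      refine abs_le_of_sq_le_sq' ?_ (by norm_num) |>.2
      rw [h1]; linarith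
    have h4 : 0 ≤ (t * a + b) / 2 := by positivity
    have h5 : q ≤ (t * a + b) / 2 := abs_le_of_sq_le_sq' (by linarith) h4 |>.2
    have h6 : h ≤ 2 * ((t * a + b) / 2 - q) := by
      calc h ≤ ((t * a + b) / 2 + q) * ((t * a + b) / 2 - q) := by linarith
        _ ≤ _ := mul_le_mul_of_nonneg_right (by linarith) (by linarith)
    linarith
  have hD : (t * q - p) + t * h / 2 ≤ 2 * a := by
    have h1 := mul_le_mul_of_nonneg_left hq' ht0
    have h2 : t * ((t * a + b) / 2) = 3 / 2 * a + t * b / 2 := by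
      linear_combination (a / 2) * ht
    rw [h2] at h1
    linarith
  have hD0 : 0 ≤ t * q - p := by linarith
  have hth : 0 ≤ t * h / 2 := by positivity
  have h6 : (t * q - p) ^ 2 + (t * h / 2) ^ 2 ≤ (2 * a) ^ 2 :=
    calc _ ≤ ((t * q - p) + t * h / 2) ^ 2 := by
          rw [add_sq]; linarith [mul_nonneg hD0 hth]
      _ ≤ _ := pow_le_pow_left₀ (add_nonneg hD0 hth) hD 2
  have h7 : (t * h / 2) ^ 2 = 3 * h ^ 2 / 4 := by
    linear_combination (h ^ 2 / 4) * ht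
  have h8 : (t * q - p) ^ 2 = 3 - 2 * x - 2 * (t * p * q) := by
    linear_combination q ^ 2 * ht + 3 * hq + hp
  rw [h7, h8, mul_pow, ha] at h6
  linarith

theorem lpGamma_nonneg {x : ℝ} (h1 : x ≤ 1) : 0 ≤ lpGamma x := by
  have h : √(3 * x * (1 - x)) ≤ (3 - 2 * x) / 2 := by
    apply sqrt_le_iff.mpr
    constructor
    · linarith
    · nlinarith [sq_nonneg (3 - 4 * x)]
  linarith [lpGamma_mul_four x]

theorem lpGamma_le {x : ℝ} : lpGamma x ≤ 3 / 4 - x / 2 := by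
  linarith [lpGamma_mul_four x, sqrt_nonneg (3 * x * (1 - x))]

theorem continuous_lpGamma : Continuous lpGamma := by
  unfold lpGamma
  fun_prop

theorem lpGamma_add_le {x y : ℝ} (h0 : x ≤ y) (h1 : y ≤ 1 / 2) :
    lpGamma y + (y - x) / 2 ≤ lpGamma x := by
  have : √(3 * x * (1 - x)) ≤ √(3 * y * (1 - y)) := by
    apply sqrt_le_sqrt
    nlinarith
  linarith [lpGamma_mul_four x, lpGamma_mul_four y]

/-- γ decreases on this range and γ(0.3152) lies just above 0.19004; the margin over 0.19 is what
`KrawSeq.le_exp_saddleLine` consumes. -/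
theorem le_lpGamma {x : ℝ} (h1 : x ≤ 3152 / 10 ^ 4) : 19004 / 10 ^ 5 ≤ lpGamma x := by
  have h2 := lpGamma_add_le h1 (by norm_num)
  have h3 : √(3 * (3152 / 10 ^ 4 : ℝ) * (1 - 3152 / 10 ^ 4)) ≤ 80472 / 10 ^ 5 := by
    apply sqrt_le_iff.mpr
    norm_num
  linarith [lpGamma_mul_four (3152 / 10 ^ 4)]

end

/-! ### Choice of the window and the bound for intermediate distances. -/

section

open Real Filter

/-- At offset e/2 beyond γ(δ) the eigenvalue gap is 3e²/16. One third pays for the factor 1 − 1/s,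
one third for n − r in place of n − (r − s), and the last gives the additive 1 once n ≥ 16/e². -/
theorem exists_window {e : ℝ} (he : 0 < e) : ∃ s : ℕ, 1 ≤ s ∧ ∀ᶠ n : ℕ in atTop, ∀ δ : ℝ,
    2 * e ≤ δ → δ ≤ 3 / 4 → ∃ r : ℕ, s ≤ r ∧ r ≤ n ∧ (r : ℝ) ≤ (lpGamma δ + e) * n ∧
      (lpGamma δ + e / 2) * n ≤ (r : ℝ) - s ∧
      3 * n - 4 * (δ * n) + 1 ≤
        2 * ((r : ℝ) - s) + 2 * (1 - 1 / s) * √(3 * ((r : ℝ) - s) * (n - r)) := by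
  obtain ⟨s, hs⟩ := exists_nat_ge (max 1 (32 / e ^ 2))
  have hs1 : (1 : ℝ) ≤ s := (le_max_left _ _).trans hs
  have hs2 : 32 / e ^ 2 ≤ s := (le_max_right _ _).trans hs
  have hs0 : (0 : ℝ) < s := by linarith
  refine ⟨s, by exact_mod_cast hs1, ?_⟩
  filter_upwards [eventually_ge_atTop 1, eventually_le_natCast (4 / e), eventually_le_natCast (s * 4 / e),
    eventually_le_natCast (16 / e ^ 2), eventually_le_natCast (3 * s / (e ^ 2 / 32) ^ 2)]
    with n hn1 hn2 hn3 hn4 hn5 δ hδ0 hδ1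
  have hn : (0 : ℝ) < n := by exact_mod_cast hn1
  rw [div_le_iff₀ he] at hn2 hn3
  rw [div_le_iff₀ (by positivity)] at hs2 hn4 hn5
  have hγ0 : 0 ≤ lpGamma δ := lpGamma_nonneg (by linarith)
  have hγ1 : lpGamma δ + e ≤ 3 / 4 := by linarith [lpGamma_le (x := δ)]
  set τ := lpGamma δ + e with hτ
  have hτ0 : 0 ≤ τ * n := by positivity
  set r := ⌊τ * n⌋₊
  have hr1 : (r : ℝ) ≤ τ * n := Nat.floor_le hτ0
  have hr2 : τ * n < r + 1 := Nat.lt_floor_add_one _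
  have hx0 : (lpGamma δ + e / 2) * n ≤ (r : ℝ) - s := by
    have : τ * n = (lpGamma δ + e / 2) * n + e * n / 2 := by rw [hτ]; ring
    linarith
  have hrn : (r : ℝ) ≤ 3 / 4 * n := hr1.trans (mul_le_mul_of_nonneg_right hγ1 hn.le)
  have hsr : (s : ℝ) ≤ r := by
    have : 0 ≤ (lpGamma δ + e / 2) * n := by positivity
    linarith
  have hrn' : (r : ℝ) ≤ n := by linarith
  refine ⟨r, by exact_mod_cast hsr, by exact_mod_cast hrn', hr1, hx0, ?_⟩
  set x := ((r : ℝ) - s) / n with hx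
  have hxn : (r : ℝ) - s = x * n := by rw [hx]; field_simp
  have hx1 : lpGamma δ + e / 2 ≤ x := by rw [hx, le_div_iff₀ hn]; exact hx0
  have hx2 : x ≤ 3 / 4 := by rw [hx, div_le_iff₀ hn]; linarith
  have hx3 : 0 ≤ x := by linarith
  have hgap := eigenvalue_gap (by linarith) hδ1 (half_pos he).le hx1 hx2
  set y := 1 - x - s / n with hy
  have hyn : (n : ℝ) - r = y * n := by
    have : (s : ℝ) / n * n = s := by field_simp
    rw [hy, sub_mul, this]; linarith
  have hy0 : 0 ≤ y := by
    have : 0 ≤ y * n := by rw [← hyn]; linarith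
    exact nonneg_of_mul_nonneg_left this hn
  have hsn : 0 ≤ (s : ℝ) / n := by positivity
  have hroot : √(3 * ((r : ℝ) - s) * (n - r)) = n * √(3 * x * y) := by
    rw [hxn, hyn, show 3 * (x * n) * (y * n) = n ^ 2 * (3 * x * y) by ring,
      sqrt_mul (by positivity), sqrt_sq hn.le]
  have h1 : √(3 * x * (1 - x)) ≤ √(3 * x * y) + √(3 * x * (s / n)) := by
    refine sqrt_le_iff.mpr ⟨by positivity, ?_⟩
    rw [add_sq, sq_sqrt (by positivity), sq_sqrt (by positivity)]
    have : 3 * x * y + 3 * x * (s / n) = 3 * x * (1 - x) := by rw [hy]; ring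
    linarith [mul_nonneg (sqrt_nonneg (3 * x * y)) (sqrt_nonneg (3 * x * (s / n)))]
  have h2 : √(3 * x * (s / n)) ≤ e ^ 2 / 32 := by
    refine sqrt_le_iff.mpr ⟨by positivity, ?_⟩
    have h3 : 3 * (s / n : ℝ) ≤ (e ^ 2 / 32) ^ 2 := by
      rw [← mul_div_assoc, div_le_iff₀ hn]; linarith
    have h4 : x * (3 * (s / n : ℝ)) ≤ 1 * (3 * (s / n)) :=
      mul_le_mul_of_nonneg_right (by linarith) (by positivity)
    linarith
  have h3 : √(3 * x * y) ≤ 1 := by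
    refine sqrt_le_iff.mpr ⟨by norm_num, ?_⟩
    have : 3 * x * y ≤ 3 * x * (1 - x) := mul_le_mul_of_nonneg_left (by linarith) (by positivity)
    linarith [sq_nonneg (2 * x - 1)]
  have h4 : 1 / (s : ℝ) * √(3 * x * y) ≤ e ^ 2 / 32 := by
    have h5 : 1 / (s : ℝ) ≤ e ^ 2 / 32 := by
      rw [div_le_iff₀ hs0]; linarith
    calc _ ≤ 1 / (s : ℝ) * 1 := mul_le_mul_of_nonneg_left h3 (by positivity)
      _ ≤ _ := by linarith
  rw [hroot, hxn]
  have h6 : 3 - 4 * δ + e ^ 2 / 16 ≤ 2 * x + 2 * (1 - 1 / s) * √(3 * x * y) := by linarith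
  have h7 := mul_le_mul_of_nonneg_right h6 hn.le
  linarith

theorem kraw_sq_le_of_wt_eq_zero {n w : ℕ} (hw : w ≤ n) (σ : Fin n → Pauli) (hσ : wt σ = 0) :
    kraw n w (wt σ) ^ 2 ≤ shell n w * pairCount σ w := by
  have h := le_pairCount σ (a := 0) hw (by simp) (by simp [hσ])
  simp only [hσ, mul_zero, Nat.choose_self, Nat.sub_zero, pow_zero, mul_one, one_mul,
    add_zero] at h
  have h' : shell n w ≤ pairCount σ w := by unfold shell; exact_mod_cast h
  rw [hσ, kraw_zero_right, sq]
  exact mul_le_mul_of_nonneg_left h' (shell_pos hw).le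

theorem IsEACode.mul_le_four_pow {n M d c : ℕ} {Q : Submodule ℂ (StateSpace n c)}
    (hQ : IsEACode n M d c Q) : (M : ℝ) * 2 ^ n / 2 ^ c ≤ 4 ^ n := by
  have h := Q.finrank_le
  rw [hQ.finrank_eq] at h
  have h2 : M ≤ 2 ^ n * 2 ^ c := by simpa using h
  have h3 : (M : ℝ) ≤ 2 ^ n * 2 ^ c := by exact_mod_cast h2
  rw [div_le_iff₀ (by positivity), show (4 : ℝ) = 2 * 2 by norm_num, mul_pow]
  nlinarith [pow_pos (two_pos (α := ℝ)) n]

theorem IsEACode.mono {n M d d' c : ℕ} {Q : Submodule ℂ (StateSpace n c)}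
    (hQ : IsEACode n M d c Q) (h : d' ≤ d) : IsEACode n M d' c Q :=
  ⟨hQ.finrank_eq, hQ.reduced, fun σ hσ => hQ.detects σ (hσ.trans_le h)⟩

theorem IsDegenerate.mono {n d d' c : ℕ} {Q : Submodule ℂ (StateSpace n c)}
    (hQ : IsDegenerate d' Q) (h : d' ≤ d) : IsDegenerate d Q := by
  obtain ⟨i, h0, h1, h2⟩ := hQ
  exact ⟨i, h0, h1.trans_le h, h2⟩

theorem eventually_poly_le {ε : ℝ} (hε : 0 < ε) :
    ∀ᶠ n : ℕ in atTop, 4 * n * ((n : ℝ) + 1) ≤ exp (n * ε) := by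
  filter_upwards [eventually_log_le (show 0 < ε / 4 by positivity),
    eventually_le_natCast (log 4 / (ε / 2))] with n h1 h2
  rw [div_le_iff₀ (by positivity)] at h2
  have hn : (0 : ℝ) < n + 1 := by positivity
  calc 4 * n * ((n : ℝ) + 1) ≤ 4 * (n + 1) * (n + 1) := by gcongr; linarith
    _ = exp (log 4 + log (n + 1) + log (n + 1)) := by
        rw [exp_add, exp_add, exp_log hn, exp_log (by norm_num)]
    _ ≤ _ := exp_le_exp.mpr (by linarith)

theorem exists_modulus {f : ℝ → ℝ} (hf : Continuous f) {ε : ℝ} (hε : 0 < ε) :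
    ∃ μ > 0, ∀ x y, 0 ≤ x → x ≤ 1 → 0 ≤ y → y ≤ 1 → |x - y| < μ → f x < f y + ε := by
  have huc := isCompact_Icc.uniformContinuousOn_of_continuous
    (hf.continuousOn (s := Set.Icc (0 : ℝ) 1))
  obtain ⟨μ, hμ, h⟩ := Metric.uniformContinuousOn_iff.mp huc ε hε
  refine ⟨μ, hμ, fun x y hx0 hx1 hy0 hy1 hxy => ?_⟩
  have := h x ⟨hx0, hx1⟩ y ⟨hy0, hy1⟩ hxy
  rw [dist_eq] at this
  linarith [(abs_lt.mp this).2]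

theorem code_bound_of_le {ε μ : ℝ} (hε : 0 < ε) (hμ : 0 < μ) : ∀ᶠ n : ℕ in atTop,
    ∀ (M d c : ℕ) (Q : Submodule ℂ (StateSpace n c)), 0 < M → IsEACode n M d c Q →
      μ ≤ (d : ℝ) / n → (d : ℝ) / n ≤ 3 / 4 →
      ((d : ℝ) / n ≤ 3152 / 10 ^ 4 ∨ ¬ IsDegenerate d Q) →
      (M : ℝ) * 2 ^ n / 2 ^ c ≤ exp (n * (rate (lpGamma ((d : ℝ) / n)) + ε)) := by
  obtain ⟨η₀, hη₀, hk⟩ := exists_kraw_sq_le (show 0 < ε / 3 by positivity)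
  obtain ⟨μ', hμ', hrate⟩ := exists_modulus continuous_rate (show 0 < ε / 3 by positivity)
  set η := min η₀ (μ / 2) with hη
  have hη0 : 0 < η := lt_min hη₀ (by positivity)
  have hη1 : η ≤ μ / 2 := min_le_right _ _
  set e := min (η / 2) (μ' / 2) with he
  have he0 : 0 < e := lt_min (by positivity) (by positivity)
  have he1 : e ≤ η / 2 := min_le_left _ _
  have he2 : e ≤ μ' / 2 := min_le_right _ _
  obtain ⟨s, hs, hwin⟩ := exists_window he0
  filter_upwards [hwin, hk η hη0 (min_le_left _ _), eventually_poly_le (show 0 < ε / 3 by positivity),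
    eventually_ge_atTop 1] with n hwin hk hpoly hn1 M d c Q hM hQ hδ0 hδ1 hcase
  have hn : (0 : ℝ) < n := by exact_mod_cast hn1
  set δ := (d : ℝ) / n with hδ
  have hdn : (d : ℝ) = δ * n := by rw [hδ]; field_simp
  obtain ⟨r, hsr, hrn, hr, hrs, hlam⟩ := hwin δ (by linarith) hδ1
  rw [← hdn] at hlam
  have hγ0 : 0 ≤ lpGamma δ := lpGamma_nonneg (by linarith)
  have hγ1 : lpGamma δ + e ≤ 3 / 4 := by linarith [lpGamma_le (x := δ)]
  have hd : 0 < d := by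
    have : (0 : ℝ) < d := by rw [hdn]; exact mul_pos (by linarith) hn
    exact_mod_cast this
  have hd' : (d : ℝ) ≤ n := by
    rw [hdn]; exact mul_le_of_le_one_left hn.le (by linarith)
  set L := exp (ε / 3 * n) * exp (n * rate (lpGamma δ + e)) with hL
  have hshell : ∀ w ≤ r, shell n w ≤ exp (n * rate (lpGamma δ + e)) := fun w hw =>
    shell_le_exp (by linarith) hγ1 (le_trans (by exact_mod_cast hw) hr)
  have hbound := code_lp_bound hQ hM hd hs hsr hrn hlam L (by
    intro σ hσd hσB w hw1 hw2
    have hw1' : (r : ℝ) - s ≤ w := by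
      rw [← Nat.cast_sub hsr]; exact_mod_cast hw1.le
    have hw2' : (w : ℝ) ≤ r := by exact_mod_cast hw2
    have hσd' : (wt σ : ℝ) ≤ δ * n := by rw [← hdn]; exact_mod_cast hσd.le
    have hexp : 1 ≤ exp (ε / 3 * n) := one_le_exp (by positivity)
    have hfin : exp (ε / 3 * n) * shell n w * pairCount σ w ≤ L * pairCount σ w := by
      rw [hL]
      have := hshell w hw2
      gcongr
    refine le_trans ?_ hfin
    rcases hcase with hsmall | hnd
    -- The window exceeds γ(δ)n by at most en, and e ≤ η/2 keeps it below γ(δ − η)n, since γ falls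
    -- with slope at least 1/2. So x₀ = δ − η is admissible, and the weights up to δn = (x₀ + η)n
    -- are the overshoot allowed there.
    · have hmono := lpGamma_add_le (x := δ - η) (y := δ) (by linarith) (by linarith)
      refine hk (δ - η) w σ (by linarith) (by linarith) ?_ ?_ ?_ ?_
      · have h1 := mul_le_mul_of_nonneg_right (le_lpGamma hsmall) hn.le
        have h2 : (lpGamma δ + e / 2) * n = lpGamma δ * n + e / 2 * n := by ring
        have h3 : 0 < e / 2 * n := by positivity
        linarith
      · exact (hw2'.trans hr).trans (mul_le_mul_of_nonneg_right (by linarith) hn.le)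
      · rwa [sub_add_cancel]
      · exact hσd'.trans (mul_le_mul_of_nonneg_right hsmall hn.le)
    · have hσ : wt σ = 0 := by
        by_contra h
        exact hσB (bCoeff_eq_zero_of_not_isDegenerate _ hnd σ (Nat.pos_of_ne_zero h) hσd)
      have hwn : w ≤ n := hw2.trans hrn
      refine (kraw_sq_le_of_wt_eq_zero hwn σ hσ).trans ?_
      rw [mul_assoc]
      exact le_mul_of_one_le_left (mul_nonneg (shell_pos hwn).le (Nat.cast_nonneg _)) hexp)
  have hrate' := hrate (lpGamma δ + e) (lpGamma δ) (by linarith) (by linarith) hγ0 (by linarith)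
    (by rw [add_sub_cancel_left, abs_of_pos he0]; linarith)
  calc (M : ℝ) * 2 ^ n / 2 ^ c ≤ 4 * d * ((n + 1) * L) := hbound
    _ ≤ 4 * n * ((n + 1) * L) := by gcongr
    _ = 4 * n * (n + 1) * L := by ring
    _ ≤ exp (n * (ε / 3)) * L := by gcongr
    _ = exp (n * (ε / 3) + (ε / 3 * n + n * rate (lpGamma δ + e))) := by rw [hL, exp_add, exp_add]
    _ ≤ _ := by
      apply exp_le_exp.mpr
      have := mul_le_mul_of_nonneg_left hrate'.le hn.le
      linarith

end

/-! ### Extreme distances and passage to bits. -/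

section

open Real Filter

theorem rate_three_quarters : rate (3 / 4) = 2 * log 2 := by
  have h1 : log (3 / 4) = log 3 - 2 * log 2 := by
    rw [log_div (by norm_num) (by norm_num), show (4 : ℝ) = 2 ^ 2 by norm_num, log_pow]; norm_num
  have h2 : log (1 / 4) = - (2 * log 2) := by
    rw [one_div, log_inv, show (4 : ℝ) = 2 ^ 2 by norm_num, log_pow]; norm_num
  unfold rate mix negMulLog
  rw [show (1 : ℝ) - 3 / 4 = 1 / 4 by norm_num, show (3 / 4 : ℝ) + 1 / 4 = 1 by norm_num, h1, h2,
    log_one]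
  ring

theorem four_pow_eq_exp (n : ℕ) : (4 : ℝ) ^ n = exp (n * (2 * log 2)) := by
  rw [exp_nat_mul, mul_comm, exp_mul, exp_log two_pos]; norm_num

theorem rate_lpGamma_nonneg {x : ℝ} (h0 : 0 ≤ x) (h1 : x ≤ 1) : 0 ≤ rate (lpGamma x) := by
  have h2 := lpGamma_nonneg h1
  have h3 := lpGamma_le (x := x)
  exact add_nonneg (mix_nonneg h2 (by linarith)) (mul_nonneg h2 (log_nonneg (by norm_num)))

theorem lpGamma_zero : lpGamma 0 = 3 / 4 := by simp [lpGamma]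

theorem lpGamma_three_quarters : lpGamma (3 / 4) = 0 := by
  have : √(3 * (3 / 4) * (1 - 3 / 4)) = 3 / 4 := by
    rw [show (3 * (3 / 4) * (1 - 3 / 4) : ℝ) = (3 / 4) ^ 2 by norm_num, sqrt_sq (by norm_num)]
  unfold lpGamma
  rw [this]; norm_num

theorem rate_zero : rate 0 = 0 := by simp [rate, mix_zero_left]

/-- Continuity of rate ∘ γ handles the ends. Near δ = 0 the exponent is close to 2 log 2, which the
dimension count already gives. Beyond 3/4 the distance is lowered to ⌊3n/4⌋, where the exponent is
close to rate(γ(3/4)) = 0. -/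
theorem code_bound {ε : ℝ} (hε : 0 < ε) : ∀ᶠ n : ℕ in atTop,
    ∀ (M d c : ℕ) (Q : Submodule ℂ (StateSpace n c)), 0 < M → IsEACode n M d c Q →
      ((d : ℝ) / n ≤ 3152 / 10 ^ 4 ∨ (d ≤ n ∧ ¬ IsDegenerate d Q)) →
      (M : ℝ) * 2 ^ n / 2 ^ c ≤ exp (n * (rate (lpGamma ((d : ℝ) / n)) + ε)) := by
  obtain ⟨μ, hμ, hmod⟩ := exists_modulus (continuous_rate.comp continuous_lpGamma) (half_pos hε)
  have hν : 0 < min μ (1 / 2) := lt_min hμ (by norm_num)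
  filter_upwards [code_bound_of_le (half_pos hε) hν, eventually_le_natCast (1 / (μ / 2)),
    eventually_ge_atTop 4] with n hB hnμ hn4 M d c Q hM hQ hcase
  have hn4' : (4 : ℝ) ≤ n := by exact_mod_cast hn4
  have hn : (0 : ℝ) < n := by linarith
  rw [div_le_iff₀ (by positivity)] at hnμ
  have hδ0 : 0 ≤ (d : ℝ) / n := by positivity
  have hδ1 : (d : ℝ) / n ≤ 1 := by
    rcases hcase with h | h
    · linarith
    · rw [div_le_one hn]; exact_mod_cast h.1
  rcases lt_or_ge ((d : ℝ) / n) (min μ (1 / 2)) with h1 | h1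
  · refine hQ.mul_le_four_pow.trans ?_
    rw [four_pow_eq_exp]
    have h2 := hmod 0 (d / n) le_rfl zero_le_one hδ0 hδ1
      (by rw [zero_sub, abs_neg, abs_of_nonneg hδ0]; exact h1.trans_le (min_le_left _ _))
    simp only [Function.comp_apply, lpGamma_zero, rate_three_quarters] at h2
    exact exp_le_exp.mpr (mul_le_mul_of_nonneg_left (by linarith) hn.le)
  rcases le_or_gt ((d : ℝ) / n) (3 / 4) with h2 | h2
  · refine (hB M d c Q hM hQ h1 h2 (hcase.imp_right And.right)).trans ?_
    exact exp_le_exp.mpr (mul_le_mul_of_nonneg_left (by linarith) hn.le)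
  · have hnd : ¬ IsDegenerate d Q := by
      rcases hcase with h | h
      · linarith
      · exact h.2
    set d' := ⌊3 / 4 * (n : ℝ)⌋₊
    have h3 : (d' : ℝ) ≤ 3 / 4 * n := Nat.floor_le (by positivity)
    have h4 : 3 / 4 * n < (d' : ℝ) + 1 := Nat.lt_floor_add_one _
    rw [lt_div_iff₀ hn] at h2
    have hdd : d' ≤ d := by
      have : (d' : ℝ) ≤ d := by linarith
      exact_mod_cast this
    have h5 : (d' : ℝ) / n ≤ 3 / 4 := by rwa [div_le_iff₀ hn]
    have h6 : 1 / 2 ≤ (d' : ℝ) / n := by rw [le_div_iff₀ hn]; linarith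
    have h7 : 3 / 4 - μ < (d' : ℝ) / n := by rw [lt_div_iff₀ hn]; nlinarith
    refine (hB M d' c Q hM (hQ.mono hdd) ((min_le_right _ _).trans h6) h5
      (Or.inr fun h => hnd (h.mono hdd))).trans ?_
    have h8 := hmod (d' / n) (3 / 4) (by positivity) (by linarith) (by norm_num) (by norm_num)
      (by rw [abs_lt]; constructor <;> linarith)
    simp only [Function.comp_apply, lpGamma_three_quarters, rate_zero] at h8
    have h9 := rate_lpGamma_nonneg hδ0 hδ1
    exact exp_le_exp.mpr (mul_le_mul_of_nonneg_left (by linarith) hn.le)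

theorem H₂_add_mul_logb (y : ℝ) : H₂ y + y * logb 2 3 = rate y / log 2 := by
  unfold H₂ rate mix negMulLog logb
  rw [add_sub_cancel, log_one]
  ring

theorem logb_div_le {n M c : ℕ} (hn : 0 < n) (hM : 0 < M) {y t : ℝ}
    (h : (M : ℝ) * 2 ^ n / 2 ^ c ≤ exp (n * (rate y + t * log 2))) :
    logb 2 M / n ≤ (c : ℝ) / n - 1 + H₂ y + y * logb 2 3 + t := by
  have hn' : (0 : ℝ) < n := by exact_mod_cast hn
  have hM' : (0 : ℝ) < M := by exact_mod_cast hM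
  have hl : 0 < log 2 := log_pos one_lt_two
  have h1 := log_le_log (by positivity) h
  rw [log_exp, log_div (by positivity) (by positivity), log_mul (by positivity) (by positivity),
    log_pow, log_pow] at h1
  have h2 : logb 2 M ≤ n * (rate y / log 2) + n * t - n + c := by
    unfold logb
    rw [div_le_iff₀ hl]
    have : n * (rate y / log 2) * log 2 = n * rate y := by field_simp
    linarith
  have h3 : (c : ℝ) / n * n = c := by field_simp
  rw [add_assoc _ (H₂ y), H₂_add_mul_logb, div_le_iff₀ hn']
  linarith

end

end EAQuantum

end

/-! ### The error term as an infimum. -/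

open EAQuantum Real Filter

theorem mainTheorem6 :
    ∃ η : ℕ → ℝ, Filter.Tendsto η Filter.atTop (nhds 0) ∧
      ∀ (n M d c : ℕ) (Q : Submodule ℂ (EAQuantum.StateSpace n c)),
        0 < n → 0 < M → EAQuantum.IsEACode n M d c Q →
        ((d : ℝ) / n ≤ 0.3152 ∨ (d ≤ n ∧ ¬ EAQuantum.IsDegenerate d Q)) →
        Real.logb 2 M / n ≤
          (c : ℝ) / n - 1 + EAQuantum.H₂ (EAQuantum.lpGamma ((d : ℝ) / n))
            + EAQuantum.lpGamma ((d : ℝ) / n) * Real.logb 2 3 + η n := by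
  have hl : 0 < log 2 := log_pos one_lt_two
  -- The estimates hold for each ε only from some n on. Taking η(n) as the least error valid for all
  -- codes of length n turns them into one null sequence; 2 is always admissible by the dimension
  -- count, so the infimum is over a nonempty set when n > 0.
  set S : ℕ → Set ℝ := fun n => {t | 0 ≤ t ∧ ∀ (M d c : ℕ) (Q : Submodule ℂ (StateSpace n c)),
    0 < M → IsEACode n M d c Q → ((d : ℝ) / n ≤ 0.3152 ∨ (d ≤ n ∧ ¬ IsDegenerate d Q)) →
    logb 2 M / n - ((c : ℝ) / n - 1 + H₂ (lpGamma ((d : ℝ) / n)) +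
      lpGamma ((d : ℝ) / n) * logb 2 3) ≤ t} with hS
  have hbdd : ∀ n, BddBelow (S n) := fun n => ⟨0, fun t ht => ht.1⟩
  have htwo : ∀ n, 0 < n → 2 ∈ S n := by
    refine fun n hn => ⟨two_pos.le, fun M d c Q hM hQ hcase => ?_⟩
    have hn' : (0 : ℝ) < n := by exact_mod_cast hn
    have hδ1 : (d : ℝ) / n ≤ 1 := by
      rcases hcase with h | h
      · norm_num at h; linarith
      · rw [div_le_one hn']; exact_mod_cast h.1
    rw [sub_le_iff_le_add']
    refine logb_div_le hn hM (hQ.mul_le_four_pow.trans ?_)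
    rw [four_pow_eq_exp]
    have := rate_lpGamma_nonneg (by positivity) hδ1
    exact exp_le_exp.mpr (mul_le_mul_of_nonneg_left (by linarith) hn'.le)
  refine ⟨fun n => sInf (S n), ?_, ?_⟩
  · refine tendsto_order.mpr ⟨fun a ha => ?_, fun a ha => ?_⟩
    · exact Eventually.of_forall fun n => ha.trans_le (Real.sInf_nonneg fun t ht => ht.1)
    · filter_upwards [code_bound (mul_pos (half_pos ha) hl), eventually_gt_atTop 0] with n h hn
      refine (csInf_le (hbdd n) ⟨(half_pos ha).le, fun M d c Q hM hQ hcase => ?_⟩).trans_lt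
        (half_lt_self ha)
      rw [sub_le_iff_le_add']
      refine logb_div_le hn hM (h M d c Q hM hQ ?_)
      rwa [show (0.3152 : ℝ) = 3152 / 10 ^ 4 by norm_num] at hcase
  · intro n M d c Q hn hM hQ hcase
    rw [← sub_le_iff_le_add']
    exact le_csInf ⟨2, htwo n hn⟩ fun t ht => ht.2 M d c Q hM hQ hcase
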